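/- Let $I$ be a set with a Cartan datum: a symmetric $\mathbb Z$-bilinear form $(\nu,\mu)\mapsto\nu\cdot\mu\in\mathbb Z$ on $\mathbb Z[I]$ with $i\cdot i\in\{2,4,6,\dots\}$ for $i\in I$ and $a_{ij}:=2\frac{i\cdot j}{i\cdot i}\in\{0,-1,-2,\dots\}$ for $i\neq j$. Let $\mathbb F$ be a field containing $\mathbb Q(v)$, and put $v_i=v^{(i\cdot i)/2}$. Let $\beta,\xi:\mathbb N[I]\times\mathbb N[I]\to\mathbb F$ be multiplicative bilinear forms such that $\beta(i,j)\beta(j,i)=1$ and $\beta(i,i)=1$ for all $i,j\in I$, and such that $\xi$ is symmetric with non-zero values and every $\xi(i,i)$, $i\in I$, has a square root in $\mathbb F$. Put $\langle i,j\rangle=v^{-i\cdot j}\beta(i,j)\xi(j,i)$. **The algebras.** Let $\widehat{{}'\mathfrak f^+}$ be the associative $\mathbb F$-algebra generated by $E_i,K_i^{\pm1},J_i^{\pm1}$ $(i\in I)$ with the following relations: the $K_i^{\pm1},J_i^{\pm1}$ commute with each other, $K_iK_i^{-1}=J_iJ_i^{-1}=1$, $K_iE_j=\langle i,j\rangle E_jK_i$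 and $J_iE_j=\xi(j,i)E_jJ_i$. Let $\widehat{{}'\mathfrak f^-}$ be the one generated by $F_i,K_i'^{\pm1},J_i'^{\pm1}$ with the following relations: the $K_i'^{\pm1},J_i'^{\pm1}$ commute with each other, $K'_iK_i'^{-1}=J'_iJ_i'^{-1}=1$, $K'_iF_j=\langle j,i\rangle\xi(i,j)^{-1}F_jK'_i$ and $J'_iF_j=F_jJ'_i$. With $x^{(n)}=x^n/[n]^!_{v_i}$ for $x\in\{E_i,F_i\}$, where $[n]^!_c=\prod_{k=1}^n\frac{c^k-c^{-k}}{c-c^{-1}}$, let $\widehat{\mathfrak f}^+$ and $\widehat{\mathfrak f}^-$ be the quotients of $\widehat{{}'\mathfrak f^+}$ and $\widehat{{}'\mathfrak f^-}$ by the two-sided ideals generated, respectively, by the elements $$\sum_{k+k'=1-a_{ij}}(-1)^k\beta(i,j)^{-k}E_i^{(k)}E_jE_i^{(k')}\quad\text{and}\quad \sum_{k+k'=1-a_{ij}}(-1)^k\beta(i,j)^{-k}F_i^{(k')}F_jF_i^{(k)}\qquad(i\neq j).$$ **The form $\phi$.** On $\widehat{{}'\mathfrak f^-}$ let $\mathcal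 K_j$ and $\mathcal J_j$ be the algebra automorphisms that fix all $J'_i$ and satisfy $\mathcal K_j(F_i)=\langle j,i\rangle F_i$, $\mathcal K_j(K'_i)=\langle j,i\rangle K'_i$, $\mathcal J_j(F_i)=\xi(i,j)F_i$, $\mathcal J_j(K'_i)=\xi(i,j)K'_i$. Let ${}_j\mathcal S$ be the linear map with ${}_j\mathcal S(xy)={}_j\mathcal S(x)\mathcal J_j(y)+\mathcal K_j(x)\,{}_j\mathcal S(y)$ that vanishes on $1$, $K_i'^{\pm1}$ and $J_i'^{\pm1}$ and has ${}_j\mathcal S(F_i)=\delta_{ij}\xi(i,j)$. Let $\rho^+:\widehat{{}'\mathfrak f^+}\to\operatorname{End}_{\mathbb F}(\widehat{{}'\mathfrak f^-})$ be the algebra anti-homomorphism with $E_j\mapsto(v_j^{-1}-v_j)^{-1}{}_j\mathcal S$, $K_j^{\pm1}\mapsto\mathcal K_j^{\pm1}$, $J_j^{\pm1}\mapsto\mathcal J_j^{\pm1}$, and put $\phi(x,y)=\varepsilon_-(\rho^+(x)y)$ for $x\in\widehat{{}'\mathfrak f^+}$ and $y\in\widehat{{}'\mathfrak f^-}$, where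 $\varepsilon_-$ is the algebra homomorphism $\widehat{{}'\mathfrak f^-}\to\mathbb F$ with $F_i\mapsto0$, $K'_i,J'_i\mapsto1$. **Skew-Hopf pairings.** A skew-Hopf pairing of Hopf algebras $A,B$ is a bilinear form $\psi:A\times B\to\mathbb F$ such that $\psi(1,y)=\varepsilon_B(y)$, $\psi(x,1)=\varepsilon_A(x)$, $\psi(x,y'y'')=\psi(\Delta_A(x),y'\otimes y'')$, $\psi(x'x'',y)=\psi(x'\otimes x'',\Delta_B^{\mathrm{op}}(y))$ and $\psi(S_A(x),y)=\psi(x,S_B^{-1}(y))$ (with $S_B$ bijective), where $\psi(x'\otimes x'',y'\otimes y'')=\psi(x',y')\psi(x'',y'')$. **Theorem.** 1. $\widehat{\mathfrak f}^+$ and $\widehat{\mathfrak f}^-$ are Hopf algebras with $\Delta(E_i)=E_i\otimes J_i+K_i\otimes E_i$, $\varepsilon(E_i)=0$, $S(E_i)=-K_i^{-1}E_iJ_i^{-1}$, and $\Delta(F_i)=J'_i\otimes F_i+F_i\otimes K'_i$, $\varepsilon(F_i)=0$, $S(F_i)=-J_i'^{-1}F_iK_i'^{-1}$, and with $\Delta(g)=g\otimes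 g$, $\varepsilon(g)=1$, $S(g)=g^{-1}$ for $g=K_i^{\pm1},J_i^{\pm1}$, respectively $g=K_i'^{\pm1},J_i'^{\pm1}$. 2. $\phi$ descends to a bilinear form $\psi:\widehat{\mathfrak f}^+\times\widehat{\mathfrak f}^-\to\mathbb F$, and $\psi$ is a skew-Hopf pairing. 3. (Drinfeld double) There is a Hopf algebra $\mathbf U_{\beta,\xi}$ with underlying vector space $\widehat{\mathfrak f}^+\otimes\widehat{\mathfrak f}^-$ and unit $1\otimes1$ such that, for $x,x'\in\widehat{\mathfrak f}^+$ and $y,y'\in\widehat{\mathfrak f}^-$, $(x\otimes1)(x'\otimes1)=xx'\otimes1$, $(1\otimes y)(1\otimes y')=1\otimes yy'$, $(x\otimes1)(1\otimes y)=x\otimes y$, $(1\otimes y)(x\otimes1)=\sum\psi(x_1,S(y_1))\,x_2\otimes y_2\,\psi(x_3,y_3)$, where $\sum x_1\otimes x_2\otimes x_3$ and $\sum y_1\otimes y_2\otimes y_3$ are the iterated coproducts of $x$ and $y$; moreover $\Delta(x\otimes y)=\sum(x_1\otimes y_1)\otimes(x_2\otimes y_2)$, $\varepsilon(x\otimes y)=\varepsilon(x)\varepsilon(y)$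 and $S(x\otimes y)=(1\otimes S(y))(S(x)\otimes1)$. 4. As an algebra, $\mathbf U_{\beta,\xi}$ is presented by the generators $E_i,F_i,K_i^{\pm1},J_i^{\pm1},K_i'^{\pm1},J_i'^{\pm1}$ $(i\in I)$, which correspond to $E_i\otimes1$, $1\otimes F_i$, $K_i^{\pm1}\otimes1$, $J_i^{\pm1}\otimes1$, $1\otimes K_i'^{\pm1}$, $1\otimes J_i'^{\pm1}$, and the relations (for all $i,j\in I$) - (R1) $K_i^{\pm1},J_i^{\pm1},K_i'^{\pm1},J_i'^{\pm1}$ commute with each other, and $K_iK_i^{-1}=J_iJ_i^{-1}=K'_iK_i'^{-1}=J'_iJ_i'^{-1}=1$; - (R2) $K_iE_j=\langle i,j\rangle E_jK_i$, $K'_iE_j=\langle j,i\rangle^{-1}\xi(i,j)E_jK'_i$, $K_iF_j=\langle i,j\rangle^{-1}F_jK_i$, $K'_iF_j=\langle j,i\rangle\xi(i,j)^{-1}F_jK'_i$, $J_iE_j=\xi(j,i)E_jJ_i$, $J'_iE_j=E_jJ'_i$, $J_iF_j=\xi(j,i)^{-1}F_jJ_i$, $J'_iF_j=F_jJ'_i$;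 - (R3) $E_iF_j-\xi(j,i)^{-1}F_jE_i=\delta_{ij}\dfrac{K_iJ'_i-J_iK'_i}{v_i-v_i^{-1}}$; - (R4) for $i\ne j$: $\sum_{k+k'=1-a_{ij}}(-1)^k\beta(i,j)^{-k}E_i^{(k)}E_jE_i^{(k')}=0$ and $\sum_{k+k'=1-a_{ij}}(-1)^k\beta(i,j)^{-k}F_i^{(k')}F_jF_i^{(k)}=0$. On these generators $\Delta$, $\varepsilon$ and $S$ of $\mathbf U_{\beta,\xi}$ are given by the formulas in 1. -/

import Mathlib

open scoped TensorProduct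

universe u w

/-! ## Hopf algebra structures, skew-Hopf pairings, Drinfeld doubles -/

section Hopf

/-- A Hopf algebra structure on a given `R`-algebra `A`
(see `HopfStructure.toHopfAlgebra` for the comparison with `HopfAlgebra`). -/
structure HopfStructure (R : Type u) (A : Type w) [CommRing R] [Ring A] [Algebra R A] where
  comul : A →ₐ[R] A ⊗[R] A
  counit : A →ₐ[R] R
  antipode : A →ₗ[R] A
  coassoc : (Algebra.TensorProduct.assoc R R R A A A).toAlgHom.comp
      ((Algebra.TensorProduct.map comul (.id R A)).comp comul)
      = (Algebra.TensorProduct.map (.id R A) comul).comp comul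
  counit_left : (Algebra.TensorProduct.map counit (.id R A)).comp comul
      = (Algebra.TensorProduct.lid R A).symm
  counit_right : (Algebra.TensorProduct.map (.id R A) counit).comp comul
      = (Algebra.TensorProduct.rid R R A).symm
  antipode_left : LinearMap.mul' R A ∘ₗ antipode.rTensor A ∘ₗ comul.toLinearMap
      = Algebra.linearMap R A ∘ₗ counit.toLinearMap
  antipode_right : LinearMap.mul' R A ∘ₗ antipode.lTensor A ∘ₗ comul.toLinearMap
      = Algebra.linearMap R A ∘ₗ counit.toLinearMap

/-- The Hopf algebra (in the sense of Mathlib) given by a `HopfStructure`. -/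
abbrev HopfStructure.toHopfAlgebra {R : Type u} {A : Type w} [CommRing R] [Ring A] [Algebra R A]
    (h : HopfStructure R A) : HopfAlgebra R A :=
  letI : Bialgebra R A :=
    Bialgebra.ofAlgHom h.comul h.counit h.coassoc h.counit_left h.counit_right
  { antipode := h.antipode
    mul_antipode_rTensor_comul := h.antipode_left
    mul_antipode_lTensor_comul := h.antipode_right }

variable {R : Type u} [CommRing R]
variable {A B U : Type w} [Ring A] [Algebra R A] [Ring B] [Algebra R B] [Ring U] [Algebra R U]

/-- The extension of `ψ` to tensors:
`(x' ⊗ x'') ⊗ (y' ⊗ y'') ↦ ψ(x', y') ψ(x'', y'')`. -/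
noncomputable def tensorPairing (ψ : A →ₗ[R] B →ₗ[R] R) : (A ⊗[R] A) ⊗[R] (B ⊗[R] B) →ₗ[R] R :=
  LinearMap.mul' R R ∘ₗ TensorProduct.map (TensorProduct.lift ψ) (TensorProduct.lift ψ) ∘ₗ
    (TensorProduct.tensorTensorTensorComm R A A B B).toLinearMap

/-- Skew-Hopf pairings of two Hopf algebras. -/
structure IsSkewHopfPairing (hA : HopfStructure R A) (hB : HopfStructure R B)
    (ψ : A →ₗ[R] B →ₗ[R] R) : Prop where
  one_left : ∀ y, ψ 1 y = hB.counit y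
  one_right : ∀ x, ψ x 1 = hA.counit x
  mul_right : ∀ x y' y'', ψ x (y' * y'') = tensorPairing ψ (hA.comul x ⊗ₜ[R] (y' ⊗ₜ[R] y''))
  mul_left : ∀ x' x'' y, ψ (x' * x'') y =
    tensorPairing ψ ((x' ⊗ₜ[R] x'') ⊗ₜ[R] TensorProduct.comm R B B (hB.comul y))
  antipode_bijective : Function.Bijective hB.antipode
  antipode : ∀ x y,
    ψ (hA.antipode x) y = ψ x ((LinearEquiv.ofBijective hB.antipode antipode_bijective).symm y)

/-- The iterated comultiplication `x ↦ ∑ x₁ ⊗ (x₂ ⊗ x₃)`. -/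
noncomputable def HopfStructure.comul₂ (h : HopfStructure R A) : A →ₗ[R] A ⊗[R] (A ⊗[R] A) :=
  h.comul.toLinearMap.lTensor A ∘ₗ h.comul.toLinearMap

/-- The linear map
`(x₁ ⊗ (x₂ ⊗ x₃)) ⊗ (y₁ ⊗ (y₂ ⊗ y₃)) ↦ ψ(x₁, S y₁) ψ(x₃, y₃) (x₂ ⊗ y₂)`. -/
noncomputable def doubleContraction (S : B →ₗ[R] B) (ψ : A →ₗ[R] B →ₗ[R] R) :
    (A ⊗[R] (A ⊗[R] A)) ⊗[R] (B ⊗[R] (B ⊗[R] B)) →ₗ[R] A ⊗[R] B :=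
  (TensorProduct.lid R (A ⊗[R] B)).toLinearMap ∘ₗ
    TensorProduct.map (TensorProduct.lift (ψ.compl₂ S))
      ((TensorProduct.rid R (A ⊗[R] B)).toLinearMap ∘ₗ
        TensorProduct.map LinearMap.id (TensorProduct.lift ψ) ∘ₗ
        (TensorProduct.tensorTensorTensorComm R A A B B).toLinearMap) ∘ₗ
    (TensorProduct.tensorTensorTensorComm R A (A ⊗[R] A) B (B ⊗[R] B)).toLinearMap

/-- The element `∑ ψ(x₁, S_B y₁) (x₂ ⊗ y₂) ψ(x₃, y₃)` of `A ⊗ B`. -/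
noncomputable def doubleCross (hA : HopfStructure R A) (hB : HopfStructure R B)
    (ψ : A →ₗ[R] B →ₗ[R] R) (x : A) (y : B) : A ⊗[R] B :=
  doubleContraction hB.antipode ψ (hA.comul₂ x ⊗ₜ[R] hB.comul₂ y)

/-- The Hopf algebra `U` with structure `hU` is the Drinfeld double of `A` and `B` with respect to
`ψ`: under the linear identification `t` of `A ⊗ B` with `U`, the unit, the multiplication,
the comultiplication, the counit and the antipode are those of the Drinfeld double. -/
structure IsDrinfeldDouble (hA : HopfStructure R A) (hB : HopfStructure R B)
    (ψ : A →ₗ[R] B →ₗ[R] R) (hU : HopfStructure R U) (t : A ⊗[R] B ≃ₗ[R] U) : Prop where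
  one : t (1 ⊗ₜ 1) = 1
  mul_left : ∀ x x' : A, t (x ⊗ₜ 1) * t (x' ⊗ₜ 1) = t ((x * x') ⊗ₜ 1)
  mul_right : ∀ y y' : B, t (1 ⊗ₜ y) * t (1 ⊗ₜ y') = t (1 ⊗ₜ (y * y'))
  mul_left_right : ∀ (x : A) (y : B), t (x ⊗ₜ 1) * t (1 ⊗ₜ y) = t (x ⊗ₜ y)
  mul_right_left : ∀ (x : A) (y : B),
    t (1 ⊗ₜ y) * t (x ⊗ₜ 1) = t (doubleCross hA hB ψ x y)
  comul : ∀ (x : A) (y : B), hU.comul (t (x ⊗ₜ y)) =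
    TensorProduct.map t.toLinearMap t.toLinearMap
      (TensorProduct.tensorTensorTensorComm R A A B B (hA.comul x ⊗ₜ hB.comul y))
  counit : ∀ (x : A) (y : B), hU.counit (t (x ⊗ₜ y)) = hA.counit x * hB.counit y
  antipode : ∀ (x : A) (y : B), hU.antipode (t (x ⊗ₜ y)) =
    t (1 ⊗ₜ hB.antipode y) * t (hA.antipode x ⊗ₜ 1)

/-- `a` is group-like with inverse `a'`, and the antipode exchanges `a` and `a'`. -/
structure IsGroupLikePair (h : HopfStructure R A) (a a' : A) : Prop where
  comul : h.comul a = a ⊗ₜ a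
  comul_inv : h.comul a' = a' ⊗ₜ a'
  counit : h.counit a = 1
  counit_inv : h.counit a' = 1
  antipode : h.antipode a = a'
  antipode_inv : h.antipode a' = a

/-- `Δ(x) = x ⊗ b + a ⊗ x`, `ε(x) = 0`, `S(x) = - a' x b'` (where `a'`, `b'` are the inverses of
`a`, `b`). -/
structure IsSkewPrimitive (h : HopfStructure R A) (x a a' b b' : A) : Prop where
  comul : h.comul x = x ⊗ₜ b + a ⊗ₜ x
  counit : h.counit x = 0
  antipode : h.antipode x = -(a' * x * b')

end Hopf

/-! ## The parameters -/

/-- A Cartan datum `(I, ·)`, given by the values `i · j`. -/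
structure CartanDatum (I : Type u) where
  dot : I → I → ℤ
  symm : ∀ i j, dot i j = dot j i
  pos : ∀ i, 0 < dot i i
  even : ∀ i, Even (dot i i)
  dvd : ∀ i j, i ≠ j → dot i i ∣ 2 * dot i j
  nonpos : ∀ i j, i ≠ j → dot i j ≤ 0

/-- Multiplicative bilinear forms `ℕ[I] × ℕ[I] → F`. -/
structure MulForm (I : Type u) (F : Type w) [Field F] where
  toFun : (I →₀ ℕ) → (I →₀ ℕ) → F
  zero_left : ∀ ν, toFun 0 ν = 1
  zero_right : ∀ μ, toFun μ 0 = 1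
  add_left : ∀ μ μ' ν, toFun (μ + μ') ν = toFun μ ν * toFun μ' ν
  add_right : ∀ μ ν ν', toFun μ (ν + ν') = toFun μ ν * toFun μ ν'

/-- The value `f(i, j)` for `i, j ∈ I`. -/
noncomputable def MulForm.at {I : Type u} {F : Type w} [Field F] (f : MulForm I F) (i j : I) : F :=
  f.toFun (Finsupp.single i 1) (Finsupp.single j 1)

/-- A Cartan datum with two multiplicative bilinear forms `β`, `ξ` such that
`β(i,j) β(j,i) = 1`, `β(i,i) = 1`, and `ξ` is symmetric, has non-zero values, and each `ξ(i,i)` has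
a square root in `F`. -/
structure DeformationDatum (I : Type u) (F : Type w) [Field F] where
  cartan : CartanDatum I
  β : MulForm I F
  ξ : MulForm I F
  β_mul : ∀ i j, β.at i j * β.at j i = 1
  β_diag : ∀ i, β.at i i = 1
  ξ_symm : ∀ μ ν, ξ.toFun μ ν = ξ.toFun ν μ
  ξ_ne_zero : ∀ i j, ξ.at i j ≠ 0
  ξ_sqrt : ∀ i, IsSquare (ξ.at i i)

/-! ## The algebras generated by `X_i`, `K_i^{±1}`, `J_i^{±1}` -/

/-- The generators of the torus part. -/
inductive TorusGen (I : Type u) : Type u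
  | K (i : I) | Kinv (i : I) | J (i : I) | Jinv (i : I)

/-- The generators `X_i`, `K_i^{±1}`, `J_i^{±1}`. -/
inductive HalfGen (I : Type u) : Type u
  | X (i : I)
  | T (s : TorusGen I)

section Half

variable {I : Type u} {F : Type w} [Field F]

/-- The relations of the smash product of the free algebra on the `X_i` with the Laurent polynomial
algebra in the `K_i`, `J_i`, where `K_i X_j = p_{ij} X_j K_i` and `J_i X_j = q_{ij} X_j J_i`. -/
inductive HalfRel (p q : I → I → F) :
    FreeAlgebra F (HalfGen I) → FreeAlgebra F (HalfGen I) → Prop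
  | comm (s t : TorusGen I) : HalfRel p q
      (FreeAlgebra.ι F (.T s) * FreeAlgebra.ι F (.T t))
      (FreeAlgebra.ι F (.T t) * FreeAlgebra.ι F (.T s))
  | K_inv (i : I) : HalfRel p q
      (FreeAlgebra.ι F (.T (.K i)) * FreeAlgebra.ι F (.T (.Kinv i))) 1
  | J_inv (i : I) : HalfRel p q
      (FreeAlgebra.ι F (.T (.J i)) * FreeAlgebra.ι F (.T (.Jinv i))) 1
  | K_X (i j : I) : HalfRel p q
      (FreeAlgebra.ι F (.T (.K i)) * FreeAlgebra.ι F (.X j))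
      (p i j • (FreeAlgebra.ι F (.X j) * FreeAlgebra.ι F (.T (.K i))))
  | J_X (i j : I) : HalfRel p q
      (FreeAlgebra.ι F (.T (.J i)) * FreeAlgebra.ι F (.X j))
      (q i j • (FreeAlgebra.ι F (.X j) * FreeAlgebra.ι F (.T (.J i))))

/-- The smash product described by `HalfRel`. -/
abbrev Half (p q : I → I → F) : Type (max u w) := RingQuot (HalfRel p q)

namespace Half

variable {p q : I → I → F}

/-- The image of a generator. -/
noncomputable def gen (p q : I → I → F) (g : HalfGen I) : Half p q :=
  RingQuot.mkAlgHom F (HalfRel p q) (FreeAlgebra.ι F g)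

/-- The image of `X_i`. -/
noncomputable abbrev X (p q : I → I → F) (i : I) : Half p q := gen p q (.X i)

/-- The image of a torus generator. -/
noncomputable abbrev T (p q : I → I → F) (s : TorusGen I) : Half p q := gen p q (.T s)

theorem comm (s t : TorusGen I) : T p q s * T p q t = T p q t * T p q s := by
  simpa [T, gen] using RingQuot.mkAlgHom_rel F (HalfRel.comm (p := p) (q := q) s t)

theorem K_inv (i : I) : T p q (.K i) * T p q (.Kinv i) = 1 := by
  simpa [T, gen] using RingQuot.mkAlgHom_rel F (HalfRel.K_inv (p := p) (q := q) i)

theorem J_inv (i : I) : T p q (.J i) * T p q (.Jinv i) = 1 := by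
  simpa [T, gen] using RingQuot.mkAlgHom_rel F (HalfRel.J_inv (p := p) (q := q) i)

theorem K_X (i j : I) : T p q (.K i) * X p q j = p i j • (X p q j * T p q (.K i)) := by
  simpa [T, X, gen] using RingQuot.mkAlgHom_rel F (HalfRel.K_X (p := p) (q := q) i j)

theorem J_X (i j : I) : T p q (.J i) * X p q j = q i j • (X p q j * T p q (.J i)) := by
  simpa [T, X, gen] using RingQuot.mkAlgHom_rel F (HalfRel.J_X (p := p) (q := q) i j)

/-- The universal property of `Half p q`. -/
noncomputable def lift {A : Type*} [Ring A] [Algebra F A] (f : HalfGen I → A)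
    (comm : ∀ s t, f (.T s) * f (.T t) = f (.T t) * f (.T s))
    (K_inv : ∀ i, f (.T (.K i)) * f (.T (.Kinv i)) = 1)
    (J_inv : ∀ i, f (.T (.J i)) * f (.T (.Jinv i)) = 1)
    (K_X : ∀ i j, f (.T (.K i)) * f (.X j) = p i j • (f (.X j) * f (.T (.K i))))
    (J_X : ∀ i j, f (.T (.J i)) * f (.X j) = q i j • (f (.X j) * f (.T (.J i)))) :
    Half p q →ₐ[F] A :=
  RingQuot.liftAlgHom F ⟨FreeAlgebra.lift F f, by
    intro x y h
    cases h with
    | comm s t => simpa using comm s t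
    | K_inv i => simpa using K_inv i
    | J_inv i => simpa using J_inv i
    | K_X i j => simpa using K_X i j
    | J_X i j => simpa using J_X i j⟩

@[simp] theorem lift_gen {A : Type*} [Ring A] [Algebra F A] (f : HalfGen I → A)
    (h₁ : ∀ s t, f (.T s) * f (.T t) = f (.T t) * f (.T s))
    (h₂ : ∀ i, f (.T (.K i)) * f (.T (.Kinv i)) = 1)
    (h₃ : ∀ i, f (.T (.J i)) * f (.T (.Jinv i)) = 1)
    (h₄ : ∀ i j, f (.T (.K i)) * f (.X j) = p i j • (f (.X j) * f (.T (.K i))))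
    (h₅ : ∀ i j, f (.T (.J i)) * f (.X j) = q i j • (f (.X j) * f (.T (.J i))))
    (g : HalfGen I) : lift (p := p) (q := q) f h₁ h₂ h₃ h₄ h₅ (gen p q g) = f g := by
  simp [lift, gen]

theorem induction {motive : Half p q → Prop} (grade0 : ∀ r : F, motive (algebraMap F _ r))
    (grade1 : ∀ g, motive (gen p q g)) (mul : ∀ a b, motive a → motive b → motive (a * b))
    (add : ∀ a b, motive a → motive b → motive (a + b)) (a : Half p q) : motive a := by
  obtain ⟨x, rfl⟩ := RingQuot.mkAlgHom_surjective F (HalfRel p q) a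
  induction x using FreeAlgebra.induction with
  | grade0 r => simpa using grade0 r
  | grade1 g => exact grade1 g
  | mul a b ha hb => simpa using mul _ _ ha hb
  | add a b ha hb => simpa using add _ _ ha hb

theorem algHom_ext {A : Type*} [Ring A] [Algebra F A] {f g : Half p q →ₐ[F] A}
    (h : ∀ x, f (gen p q x) = g (gen p q x)) : f = g := by
  refine AlgHom.ext fun a => ?_
  induction a using Half.induction with
  | grade0 r => simp
  | grade1 x => exact h x
  | mul a b ha hb => simp [ha, hb]
  | add a b ha hb => simp [ha, hb]

/-- The counit: `X_i ↦ 0`, `K_i^{±1}, J_i^{±1} ↦ 1`. -/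
noncomputable def counit (p q : I → I → F) : Half p q →ₐ[F] F :=
  lift (fun g => match g with | .X _ => 0 | .T _ => 1)
    (by simp) (by simp) (by simp) (by simp) (by simp)

/-- The scalars by which `scale` acts on the generators. -/
noncomputable def weight (c : I → Fˣ) : HalfGen I → F
  | .X i => c i
  | .T (.K i) => c i
  | .T (.Kinv i) => (c i)⁻¹
  | .T (.J _) => 1
  | .T (.Jinv _) => 1

/-- The algebra endomorphism `X_i ↦ c_i X_i`, `K_i^{±1} ↦ c_i^{±1} K_i^{±1}`,
`J_i^{±1} ↦ J_i^{±1}`. -/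
noncomputable def scale (c : I → Fˣ) : Half p q →ₐ[F] Half p q :=
  lift (fun g => weight c g • gen p q g)
    (fun s t => by simp only [smul_mul_smul_comm, comm s t, mul_comm])
    (fun i => by simp [weight, K_inv])
    (fun i => by simp [weight, J_inv])
    (fun i j => by
      simp only [smul_mul_smul_comm, K_X, smul_smul]; congr 1; ring)
    (fun i j => by
      simp only [smul_mul_smul_comm, J_X, smul_smul]; congr 1; ring)

@[simp] theorem scale_gen (c : I → Fˣ) (g : HalfGen I) :
    scale c (gen p q g) = weight c g • gen p q g := by
  simp [scale]

theorem scale_scale (c d : I → Fˣ) (y : Half p q) : scale c (scale d y) = scale (c * d) y := by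
  have : (scale c).comp (scale d) = scale (p := p) (q := q) (c * d) := by
    refine algHom_ext fun g => ?_
    rcases g with i | (i | i | i | i) <;>
      simp [weight, smul_smul, mul_comm]
  exact DFunLike.congr_fun this y

theorem scale_one (y : Half p q) : scale 1 y = y := by
  have : scale (p := p) (q := q) 1 = AlgHom.id F _ := by
    refine algHom_ext fun g => ?_
    rcases g with i | (i | i | i | i) <;> simp [weight]
  exact DFunLike.congr_fun this y

end Half

end Half

/-! ## The deformed algebras -/

namespace DeformationDatum

variable {I : Type u} {F : Type w} [Field F] [Algebra (RatFunc ℚ) F]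

variable (F) in
/-- The indeterminate `v`, as an element of `F ⊇ ℚ(v)`. -/
noncomputable def v : F := algebraMap (RatFunc ℚ) F RatFunc.X

theorem v_ne_zero : v F ≠ 0 := by
  simp [v, RatFunc.X_ne_zero]

variable (P : DeformationDatum I F)

/-- `v_i = v^{d_i}` with `d_i = (i · i) / 2`. -/
noncomputable def vi (i : I) : F := v F ^ (P.cartan.dot i i / 2)

/-- The natural number `1 - a_{ij}`, where `a_{ij} = 2 (i · j) / (i · i)`, for `i ≠ j`. -/
def serreOrder (i j : I) : ℕ := (1 - 2 * P.cartan.dot i j / P.cartan.dot i i).toNat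

/-- `⟨i, j⟩ = v^{- i · j} β(i, j) ξ(j, i)`. -/
noncomputable def angle (i j : I) : F := v F ^ (-P.cartan.dot i j) * P.β.at i j * P.ξ.at j i

theorem angle_ne_zero (i j : I) : P.angle i j ≠ 0 :=
  mul_ne_zero (mul_ne_zero (zpow_ne_zero _ v_ne_zero) (left_ne_zero_of_mul_eq_one (P.β_mul i j)))
    (P.ξ_ne_zero j i)

/-- `⟨i, -⟩`, as a function on `I` with values in the units of `F`. -/
noncomputable def angleUnit (i : I) : I → Fˣ := fun j => Units.mk0 _ (P.angle_ne_zero i j)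

/-- `ξ(-, i)`, as a function on `I` with values in the units of `F`. -/
noncomputable def ξUnit (i : I) : I → Fˣ := fun j => Units.mk0 _ (P.ξ_ne_zero j i)

/-! ### The algebras before imposing the Serre relations, and the form `φ` -/

/-- The smash product of the free algebra on the `E_i` with the torus generated by
`K_i^{±1}`, `J_i^{±1}`: `K_i E_j = ⟨i, j⟩ E_j K_i` and `J_i E_j = ξ(j, i) E_j J_i`. -/
abbrev FreePlus : Type (max u w) := Half P.angle (fun i j => P.ξ.at j i)

/-- The smash product of the free algebra on the `F_i` with the torus generated by
`K'_i^{±1}`, `J'_i^{±1}`: `K'_i F_j = ⟨j, i⟩ ξ(i, j)⁻¹ F_j K'_i` and `J'_i F_j = F_j J'_i`. -/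
abbrev FreeMinus : Type (max u w) :=
  Half (fun i j => P.angle j i * (P.ξ.at i j)⁻¹) (fun _ _ => 1)

/-- The generators `E_i`, `K_i^{±1}`, `J_i^{±1}`. -/
noncomputable abbrev genPlus (g : HalfGen I) : P.FreePlus := Half.gen _ _ g

/-- The generators `F_i`, `K'_i^{±1}`, `J'_i^{±1}`. -/
noncomputable abbrev genMinus (g : HalfGen I) : P.FreeMinus := Half.gen _ _ g

/-- `𝒦_i`: `K'_l^{±1} ↦ ⟨i, l⟩^{±1} K'_l^{±1}`, `F_l ↦ ⟨i, l⟩ F_l`, `J'_l^{±1} ↦ J'_l^{±1}`. -/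
noncomputable def opK (i : I) : P.FreeMinus →ₐ[F] P.FreeMinus := Half.scale (P.angleUnit i)

/-- The inverse of `𝒦_i`. -/
noncomputable def opKinv (i : I) : P.FreeMinus →ₐ[F] P.FreeMinus := Half.scale (P.angleUnit i)⁻¹

/-- `𝒥_i`: `K'_l^{±1} ↦ ξ(l, i)^{±1} K'_l^{±1}`, `F_l ↦ ξ(l, i) F_l`, `J'_l^{±1} ↦ J'_l^{±1}`. -/
noncomputable def opJ (i : I) : P.FreeMinus →ₐ[F] P.FreeMinus := Half.scale (P.ξUnit i)

/-- The inverse of `𝒥_i`. -/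
noncomputable def opJinv (i : I) : P.FreeMinus →ₐ[F] P.FreeMinus := Half.scale (P.ξUnit i)⁻¹

section Form

variable [DecidableEq I]

/-- The algebra homomorphism `y ↦ !![𝒦_j y, 𝒮_j y; 0, 𝒥_j y]`, where `𝒮_j` is the twisted
derivation with `𝒮_j F_i = δ_{ij} ξ(i, j)` which vanishes on the torus. -/
noncomputable def opMatrix (j : I) : P.FreeMinus →ₐ[F] Matrix (Fin 2) (Fin 2) P.FreeMinus :=
  Half.lift (fun g => !![P.opK j (P.genMinus g),
      (match g with
        | .X i => if i = j then algebraMap F _ (P.ξ.at i j) else 0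
        | .T _ => 0);
      0, P.opJ j (P.genMinus g)])
    (fun s t => by
      simp only [Matrix.mul_fin_two, ← map_mul, Half.comm s t, mul_zero, zero_mul, add_zero,
        zero_add])
    (fun i => by
      simp only [Matrix.mul_fin_two, ← map_mul, Half.K_inv, mul_zero, zero_mul, add_zero,
        zero_add, map_one, Matrix.one_fin_two])
    (fun i => by
      simp only [Matrix.mul_fin_two, ← map_mul, Half.J_inv, mul_zero, zero_mul, add_zero,
        zero_add, map_one, Matrix.one_fin_two])
    (fun i l => by
      simp only [Matrix.mul_fin_two, ← map_mul, Half.K_X, mul_zero, zero_mul, add_zero,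
        zero_add, Matrix.smul_of, Matrix.smul_cons, smul_zero, Matrix.smul_empty, map_smul]
      congr 1
      split_ifs with h
      · subst h
        have h0 := P.ξ_ne_zero i l
        simp [opK, opJ, Half.weight, angleUnit, ξUnit, ← Algebra.commutes, ← Algebra.smul_def,
          smul_smul]
        congr 1
        field_simp
      · simp)
    (fun i l => by
      simp only [Matrix.mul_fin_two, ← map_mul, Half.J_X, mul_zero, zero_mul, add_zero,
        zero_add, Matrix.smul_of, Matrix.smul_cons, smul_zero, Matrix.smul_empty, map_smul]
      congr 1
      split_ifs with h
      · subst h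
        simp [opK, opJ, Half.weight, ← Algebra.commutes]
      · simp)

/-- The twisted derivation `𝒮_j`; see `opS_F`, `opS_T` and `opS_mul`. -/
noncomputable def opS (j : I) : P.FreeMinus →ₗ[F] P.FreeMinus :=
  (Matrix.entryLinearMap F P.FreeMinus 0 1) ∘ₗ (P.opMatrix j).toLinearMap

theorem opMatrix_eq (j : I) (y : P.FreeMinus) :
    P.opMatrix j y = !![P.opK j y, P.opS j y; 0, P.opJ j y] := by
  have key : P.opMatrix j y 0 0 = P.opK j y ∧ P.opMatrix j y 1 0 = 0 ∧
      P.opMatrix j y 1 1 = P.opJ j y := by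
    induction y using Half.induction with
    | grade0 r => simp [Matrix.algebraMap_matrix_apply]
    | grade1 g => simp [opMatrix]
    | mul a b ha hb => simp [Matrix.mul_apply, ha, hb]
    | add a b ha hb => simp [ha, hb]
  ext a b
  fin_cases a <;> fin_cases b <;> simp [key, opS]

theorem opS_F (j i : I) : P.opS j (P.genMinus (.X i)) =
    if i = j then algebraMap F _ (P.ξ.at i j) else 0 := by
  simp [opS, opMatrix]

theorem opS_T (j : I) (s : TorusGen I) : P.opS j (P.genMinus (.T s)) = 0 := by
  simp [opS, opMatrix]

theorem opS_mul (j : I) (x y : P.FreeMinus) :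
    P.opS j (x * y) = P.opS j x * P.opJ j y + P.opK j x * P.opS j y := by
  have h := congrFun (congrFun (map_mul (P.opMatrix j) x y) 0) 1
  simp only [opMatrix_eq, Matrix.mul_fin_two] at h
  simpa [add_comm] using h

theorem opS_algebraMap (j : I) (r : F) : P.opS j (algebraMap F _ r) = 0 := by
  simp [opS, Matrix.algebraMap_matrix_apply]

theorem opS_scale (j : I) (c : I → Fˣ) (y : P.FreeMinus) :
    P.opS j (Half.scale c y) = (c j : F) • Half.scale c (P.opS j y) := by
  induction y using Half.induction with
  | grade0 r => simp [opS_algebraMap]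
  | grade1 g =>
    rcases g with i | s
    · simp only [Half.scale_gen, map_smul, opS_F, Half.weight]
      split_ifs with h
      · subst h; simp
      · simp
    · simp [opS_T]
  | mul a b ha hb =>
    have hK : P.opK j (Half.scale c a) = Half.scale c (P.opK j a) := by
      simp only [opK, Half.scale_scale, mul_comm]
    have hJ : P.opJ j (Half.scale c b) = Half.scale c (P.opJ j b) := by
      simp only [opJ, Half.scale_scale, mul_comm]
    simp [opS_mul, ha, hb, hK, hJ]
  | add a b ha hb => simp [ha, hb]

/-- The algebra anti-homomorphism `ρ⁺`: `E_j ↦ (v_j⁻¹ - v_j)⁻¹ 𝒮_j`, `K_j^{±1} ↦ 𝒦_j^{±1}`,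
`J_j^{±1} ↦ 𝒥_j^{±1}`. -/
noncomputable def rhoPlus : P.FreePlus →ₐ[F] (Module.End F P.FreeMinus)ᵐᵒᵖ :=
  Half.lift (fun g => MulOpposite.op (match g with
      | .X j => ((P.vi j)⁻¹ - P.vi j)⁻¹ • P.opS j
      | .T (.K j) => (P.opK j).toLinearMap
      | .T (.Kinv j) => (P.opKinv j).toLinearMap
      | .T (.J j) => (P.opJ j).toLinearMap
      | .T (.Jinv j) => (P.opJinv j).toLinearMap))
    (fun s t => by
      rw [← MulOpposite.op_mul, ← MulOpposite.op_mul]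
      congr 1
      ext y
      rcases s with i | i | i | i <;> rcases t with l | l | l | l <;>
        simp [opK, opKinv, opJ, opJinv, Half.scale_scale, mul_comm])
    (fun i => by
      rw [← MulOpposite.op_mul, ← MulOpposite.op_one]
      congr 1
      ext y
      simp [opK, opKinv, Half.scale_scale, Half.scale_one])
    (fun i => by
      rw [← MulOpposite.op_mul, ← MulOpposite.op_one]
      congr 1
      ext y
      simp [opJ, opJinv, Half.scale_scale, Half.scale_one])
    (fun i j => by
      rw [← MulOpposite.op_mul, ← MulOpposite.op_mul, ← MulOpposite.op_smul]
      congr 1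
      ext y
      simp [opK, opS_scale, angleUnit, smul_smul, mul_comm])
    (fun i j => by
      rw [← MulOpposite.op_mul, ← MulOpposite.op_mul, ← MulOpposite.op_smul]
      congr 1
      ext y
      simp [opJ, opS_scale, ξUnit, smul_smul, mul_comm])

/-- The bilinear form `φ(x, y) = ε(ρ⁺(x) y)`. -/
noncomputable def phi : P.FreePlus →ₗ[F] P.FreeMinus →ₗ[F] F :=
  LinearMap.mk₂ F (fun x y => Half.counit _ _ ((P.rhoPlus x).unop y))
    (by intros; simp) (by intros; simp) (by intros; simp) (by intros; simp)

end Form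

/-! ### The Serre relations and the quotients -/

/-- The `q`-number `[n]_c = (c^n - c^{-n}) / (c - c^{-1})`. -/
noncomputable def qNumber (c : F) (n : ℕ) : F := (c ^ n - (c ^ n)⁻¹) / (c - c⁻¹)

/-- The `q`-factorial `[n]_c^! = ∏_{k = 1}^n [k]_c`. -/
noncomputable def qFactorial (c : F) (n : ℕ) : F := ∏ k ∈ Finset.Icc 1 n, qNumber c k

/-- The divided power `x^{(n)} = x^n / [n]_{v_i}^!`. -/
noncomputable def divPow {A : Type*} [Ring A] [Algebra F A] (i : I) (x : A) (n : ℕ) : A :=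
  (qFactorial (P.vi i) n)⁻¹ • x ^ n

/-- `D_{ij} = ∑_{k + k' = 1 - a_{ij}} (-1)^k β(i, j)^{-k} θ_i^{(k)} θ_j θ_i^{(k')}`, an element
of the free algebra on the `θ_i`. -/
noncomputable def serreElement (i j : I) : FreeAlgebra F I :=
  ∑ k ∈ Finset.HasAntidiagonal.antidiagonal (P.serreOrder i j),
    ((-1) ^ k.1 * (P.β.at i j ^ k.1)⁻¹) •
      (P.divPow i (FreeAlgebra.ι F i) k.1 * FreeAlgebra.ι F j * P.divPow i (FreeAlgebra.ι F i) k.2)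

/-- The algebra homomorphism `ι⁺` with `θ_i ↦ E_i`. -/
noncomputable def iotaPlus : FreeAlgebra F I →ₐ[F] P.FreePlus :=
  FreeAlgebra.lift F fun i => P.genPlus (.X i)

/-- The algebra anti-homomorphism `ι⁻` with `θ_i ↦ F_i`. -/
noncomputable def iotaMinus : FreeAlgebra F I →ₐ[F] (P.FreeMinus)ᵐᵒᵖ :=
  FreeAlgebra.lift F fun i => MulOpposite.op (P.genMinus (.X i))

/-- The relations `ι⁺(D_{ij}) = 0`. -/
inductive SerrePlus : P.FreePlus → P.FreePlus → Prop
  | mk (i j : I) (h : i ≠ j) : SerrePlus (P.iotaPlus (P.serreElement i j)) 0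

/-- The relations `ι⁻(D_{ij}) = 0`. -/
inductive SerreMinus : P.FreeMinus → P.FreeMinus → Prop
  | mk (i j : I) (h : i ≠ j) : SerreMinus (P.iotaMinus (P.serreElement i j)).unop 0

/-- The quotient of `FreePlus` by the two-sided ideal generated by the `ι⁺(D_{ij})`, `i ≠ j`. -/
abbrev FPlus : Type (max u w) := RingQuot P.SerrePlus

/-- The quotient of `FreeMinus` by the two-sided ideal generated by the `ι⁻(D_{ij})`, `i ≠ j`. -/
abbrev FMinus : Type (max u w) := RingQuot P.SerreMinus

/-- The quotient map onto `FPlus`. -/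
noncomputable def toPlus : P.FreePlus →ₐ[F] P.FPlus := RingQuot.mkAlgHom F P.SerrePlus

/-- The quotient map onto `FMinus`. -/
noncomputable def toMinus : P.FreeMinus →ₐ[F] P.FMinus := RingQuot.mkAlgHom F P.SerreMinus

/-- The images in `FPlus` of the generators `E_i`, `K_i^{±1}`, `J_i^{±1}`. -/
noncomputable def plus (g : HalfGen I) : P.FPlus := P.toPlus (P.genPlus g)

/-- The images in `FMinus` of the generators `F_i`, `K'_i^{±1}`, `J'_i^{±1}`. -/
noncomputable def minus (g : HalfGen I) : P.FMinus := P.toMinus (P.genMinus g)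

/-! ### The algebra given by generators and relations -/

end DeformationDatum

/-- The generators `E_i`, `F_i`, `K_i^{±1}`, `J_i^{±1}` and `K'_i^{±1}`, `J'_i^{±1}`. -/
inductive UGen (I : Type u) : Type u
  | E (i : I) | F (i : I)
  | K (i : I) | Kinv (i : I) | J (i : I) | Jinv (i : I)
  | K' (i : I) | Kinv' (i : I) | J' (i : I) | Jinv' (i : I)

/-- The generators `K_i^{±1}`, `J_i^{±1}`, `K'_i^{±1}`, `J'_i^{±1}`. -/
inductive UGen.IsTorus {I : Type u} : UGen I → Prop
  | K (i : I) : IsTorus (.K i)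
  | Kinv (i : I) : IsTorus (.Kinv i)
  | J (i : I) : IsTorus (.J i)
  | Jinv (i : I) : IsTorus (.Jinv i)
  | K' (i : I) : IsTorus (.K' i)
  | Kinv' (i : I) : IsTorus (.Kinv' i)
  | J' (i : I) : IsTorus (.J' i)
  | Jinv' (i : I) : IsTorus (.Jinv' i)

/-- The generator of the presentation that corresponds to a generator of `FPlus`. -/
def HalfGen.toUPlus {I : Type u} : HalfGen I → UGen I
  | .X i => .E i
  | .T (.K i) => .K i
  | .T (.Kinv i) => .Kinv i
  | .T (.J i) => .J i
  | .T (.Jinv i) => .Jinv i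

/-- The generator of the presentation that corresponds to a generator of `FMinus`. -/
def HalfGen.toUMinus {I : Type u} : HalfGen I → UGen I
  | .X i => .F i
  | .T (.K i) => .K' i
  | .T (.Kinv i) => .Kinv' i
  | .T (.J i) => .J' i
  | .T (.Jinv i) => .Jinv' i

namespace DeformationDatum

variable {I : Type u} {F : Type w} [Field F] [Algebra (RatFunc ℚ) F] [DecidableEq I]
variable (P : DeformationDatum I F)

section Presentation

/-- A generator, as an element of the free algebra. -/
noncomputable abbrev letter (F : Type w) [Field F] (g : UGen I) : FreeAlgebra F (UGen I) :=
  FreeAlgebra.ι F g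

/-- The defining relations in the generators `UGen I`. -/
inductive URel : FreeAlgebra F (UGen I) → FreeAlgebra F (UGen I) → Prop
  -- the torus
  | comm (s t : UGen I) (hs : s.IsTorus) (ht : t.IsTorus) :
      URel (letter F s * letter F t) (letter F t * letter F s)
  | K_inv (i : I) : URel (letter F (.K i) * letter F (.Kinv i)) 1
  | J_inv (i : I) : URel (letter F (.J i) * letter F (.Jinv i)) 1
  | K'_inv (i : I) : URel (letter F (.K' i) * letter F (.Kinv' i)) 1
  | J'_inv (i : I) : URel (letter F (.J' i) * letter F (.Jinv' i)) 1
  -- the torus acting on `E_j` and `F_j`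
  | K_E (i j : I) : URel (letter F (.K i) * letter F (.E j))
      (P.angle i j • (letter F (.E j) * letter F (.K i)))
  | K'_E (i j : I) : URel (letter F (.K' i) * letter F (.E j))
      (((P.angle j i)⁻¹ * P.ξ.at i j) • (letter F (.E j) * letter F (.K' i)))
  | K_F (i j : I) : URel (letter F (.K i) * letter F (.F j))
      ((P.angle i j)⁻¹ • (letter F (.F j) * letter F (.K i)))
  | K'_F (i j : I) : URel (letter F (.K' i) * letter F (.F j))
      ((P.angle j i * (P.ξ.at i j)⁻¹) • (letter F (.F j) * letter F (.K' i)))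
  | J_E (i j : I) : URel (letter F (.J i) * letter F (.E j))
      (P.ξ.at j i • (letter F (.E j) * letter F (.J i)))
  | J'_E (i j : I) : URel (letter F (.J' i) * letter F (.E j))
      (letter F (.E j) * letter F (.J' i))
  | J_F (i j : I) : URel (letter F (.J i) * letter F (.F j))
      ((P.ξ.at j i)⁻¹ • (letter F (.F j) * letter F (.J i)))
  | J'_F (i j : I) : URel (letter F (.J' i) * letter F (.F j))
      (letter F (.F j) * letter F (.J' i))
  -- the commutation of `E_i` and `F_j`
  | E_F (i j : I) : URel
      (letter F (.E i) * letter F (.F j) - (P.ξ.at j i)⁻¹ • (letter F (.F j) * letter F (.E i)))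
      (if i = j then
        (P.vi i - (P.vi i)⁻¹)⁻¹ •
          (letter F (.K i) * letter F (.J' i) - letter F (.J i) * letter F (.K' i))
        else 0)
  -- the deformed Serre relations
  | serre_E (i j : I) (h : i ≠ j) : URel
      (∑ k ∈ Finset.HasAntidiagonal.antidiagonal (P.serreOrder i j),
        ((-1) ^ k.1 * (P.β.at i j ^ k.1)⁻¹) •
          (P.divPow i (letter F (.E i)) k.1 * letter F (.E j) *
            P.divPow i (letter F (.E i)) k.2)) 0
  | serre_F (i j : I) (h : i ≠ j) : URel
      (∑ k ∈ Finset.HasAntidiagonal.antidiagonal (P.serreOrder i j),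
        ((-1) ^ k.1 * (P.β.at i j ^ k.1)⁻¹) •
          (P.divPow i (letter F (.F i)) k.2 * letter F (.F j) *
            P.divPow i (letter F (.F i)) k.1)) 0

end Presentation

/-- The algebra presented by the generators `UGen I` and the relations `URel`. -/
abbrev PresentedU : Type (max u w) := RingQuot P.URel

/-- The image of a generator in `PresentedU`. -/
noncomputable def genU (g : UGen I) : P.PresentedU :=
  RingQuot.mkAlgHom F P.URel (FreeAlgebra.ι F g)

end DeformationDatum

/-! ### The formulas for the Hopf algebra structures on generators -/

/-- `Δ(E_i) = E_i ⊗ J_i + K_i ⊗ E_i`, `ε(E_i) = 0`, `S(E_i) = - K_i⁻¹ E_i J_i⁻¹`, and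
`K_i^{±1}`, `J_i^{±1}` are group-like with `S(K_i^{±1}) = K_i^{∓1}`, `S(J_i^{±1}) = J_i^{∓1}`;
`e` assigns to each generator an element of the Hopf algebra `A`. -/
structure IsPlusHopf {I : Type*} {R : Type u} {A : Type w} [CommRing R] [Ring A] [Algebra R A]
    (h : HopfStructure R A) (e : HalfGen I → A) : Prop where
  E : ∀ i, IsSkewPrimitive h (e (.X i)) (e (.T (.K i))) (e (.T (.Kinv i)))
    (e (.T (.J i))) (e (.T (.Jinv i)))
  K : ∀ i, IsGroupLikePair h (e (.T (.K i))) (e (.T (.Kinv i)))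
  J : ∀ i, IsGroupLikePair h (e (.T (.J i))) (e (.T (.Jinv i)))

/-- `Δ(F_i) = J'_i ⊗ F_i + F_i ⊗ K'_i`, `ε(F_i) = 0`, `S(F_i) = - J'_i⁻¹ F_i K'_i⁻¹`, and
`K'_i^{±1}`, `J'_i^{±1}` are group-like with `S(K'_i^{±1}) = K'_i^{∓1}`,
`S(J'_i^{±1}) = J'_i^{∓1}`. -/
structure IsMinusHopf {I : Type*} {R : Type u} {A : Type w} [CommRing R] [Ring A] [Algebra R A]
    (h : HopfStructure R A) (e : HalfGen I → A) : Prop where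
  F : ∀ i, IsSkewPrimitive h (e (.X i)) (e (.T (.J i))) (e (.T (.Jinv i)))
    (e (.T (.K i))) (e (.T (.Kinv i)))
  K : ∀ i, IsGroupLikePair h (e (.T (.K i))) (e (.T (.Kinv i)))
  J : ∀ i, IsGroupLikePair h (e (.T (.J i))) (e (.T (.Jinv i)))

/-! The smash products `FreePlus` and `FreeMinus` are Hopf algebras because the prescribed values on
generators respect their few relations. These structures pass to the Serre quotients since the Serre
elements are skew-primitive. By the q-binomial theorem (`iterAd_eq_sum`) a Serre element is, up to a
non-zero scalar, the result of applying N operators z ↦ z x - c_l x z to the other generator, with N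
= 1 - a_ij. Applying Δ replaces x by a sum of two q-commuting terms, and the coefficients c_l are
exactly those for which all mixed terms cancel (`iterAd_add_add`).

Multiplicativity of φ in the second variable is the twisted Leibniz rule for ρ⁺ (`rho_mul_apply`).
Multiplicativity in the first variable holds because ρ⁺(x) acts on the second leg of the coproduct
only, once the central elements J'_i are set to 1 (`comulJ_rho`, `phi_mul_left`). Pairing with a
skew-primitive element is a twisted derivation, and for a Serre element it vanishes on generators.
The Serre elements therefore lie in the radicals of φ (`phi_serrePlus`, `phi_serreMinus`), and φ
descends to ψ.

The double is not built by checking associativity on a tensor product. The algebra U given by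
generators and relations is the starting point, with its universal property `CrossRel.lift`: a
homomorphism out of U is a pair of homomorphisms out of the two halves that satisfies the mixed
relations. Comultiplication, counit and antipode of U arise from three such pairs (`CrossRel.comul`,
`crossRel_counit`, `CrossRel.antipode`). A fourth pair makes U act on 𝔣⁺ ⊗ 𝔣⁻, where 𝔣⁺ acts by left
multiplication and 𝔣⁻ by the cross formula of the double (`crossRel_double`). Evaluating this action
at 1 ⊗ 1 gives a left inverse of the multiplication map x ⊗ y ↦ x y, so that map is injective. It is
surjective because the relations move every 𝔣⁻-generator to the right (`incMinus_mul_mem_range`).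
Under the resulting linear isomorphism the product of U is that of the Drinfeld double. -/

section GeneralHopf

/-! ### Hopf structures from generators; group-like and skew-primitive elements. -/

variable {R : Type u} [CommRing R] {A B : Type w} [Ring A] [Algebra R A] [Ring B] [Algebra R B]

/-- The convolution `x ↦ ∑ S(x₁) x₂` of an algebra anti-endomorphism `S` with the identity is the
counit as soon as this holds on generators. -/
theorem antipode_left_of_generators (Δ : A →ₐ[R] A ⊗[R] A) (ε : A →ₐ[R] R) (S : A →ₐ[R] Aᵐᵒᵖ)
    {s : Set A} (hs : Algebra.adjoin R s = ⊤)
    (h : ∀ x ∈ s, LinearMap.mul' R A (((MulOpposite.opLinearEquiv R).symm.toLinearMap ∘ₗ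
      S.toLinearMap).rTensor A (Δ x)) = algebraMap R A (ε x)) (x : A) :
    LinearMap.mul' R A (((MulOpposite.opLinearEquiv R).symm.toLinearMap ∘ₗ
      S.toLinearMap).rTensor A (Δ x)) = algebraMap R A (ε x) := by
  -- Since S reverses products, m(S ⊗ 1) of z · (a ⊗ b) is S(a) · m(S ⊗ 1)(z) · b. If the middle
  -- factor is a scalar, it can be pulled out, which gives closure under products.
  have key : ∀ (c : R) (z z' : A ⊗[R] A),
      LinearMap.mul' R A (((MulOpposite.opLinearEquiv R).symm.toLinearMap ∘ₗ
        S.toLinearMap).rTensor A z) = algebraMap R A c →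
      LinearMap.mul' R A (((MulOpposite.opLinearEquiv R).symm.toLinearMap ∘ₗ
        S.toLinearMap).rTensor A (z * z')) =
      algebraMap R A c * LinearMap.mul' R A (((MulOpposite.opLinearEquiv R).symm.toLinearMap ∘ₗ
        S.toLinearMap).rTensor A z') := by
    intro c z z' hz
    induction z' with
    | zero => simp
    | add a b ha hb => simp only [mul_add, map_add, ha, hb]
    | tmul a b =>
      have : ∀ z : A ⊗[R] A, LinearMap.mul' R A (((MulOpposite.opLinearEquiv R).symm.toLinearMap ∘ₗ
          S.toLinearMap).rTensor A (z * a ⊗ₜ b)) = (S a).unop *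
          LinearMap.mul' R A (((MulOpposite.opLinearEquiv R).symm.toLinearMap ∘ₗ
          S.toLinearMap).rTensor A z) * b := by
        intro z
        induction z with
        | zero => simp
        | add a b ha hb => simp only [mul_add, add_mul, map_add, ha, hb]
        | tmul a b => simp [mul_assoc]
      rw [this, hz]
      simp [mul_assoc, Algebra.left_comm]
  have hx : x ∈ Algebra.adjoin R s := hs ▸ Algebra.mem_top
  induction hx using Algebra.adjoin_induction with
  | mem x hx => exact h x hx
  | algebraMap r => simp [Algebra.TensorProduct.algebraMap_apply]
  | add x y _ _ hx hy => simp only [map_add, hx, hy]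
  | mul x y _ _ hx hy => rw [map_mul, key _ _ _ hx, hy, map_mul, map_mul]

/-- Mirror image of the left case: now the second tensor z' of the product ends up in the middle, as
in a · m(1 ⊗ S)(z') · S(b), so the scalar hypothesis concerns z'. -/
theorem antipode_right_of_generators (Δ : A →ₐ[R] A ⊗[R] A) (ε : A →ₐ[R] R) (S : A →ₐ[R] Aᵐᵒᵖ)
    {s : Set A} (hs : Algebra.adjoin R s = ⊤)
    (h : ∀ x ∈ s, LinearMap.mul' R A (((MulOpposite.opLinearEquiv R).symm.toLinearMap ∘ₗ
      S.toLinearMap).lTensor A (Δ x)) = algebraMap R A (ε x)) (x : A) :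
    LinearMap.mul' R A (((MulOpposite.opLinearEquiv R).symm.toLinearMap ∘ₗ
      S.toLinearMap).lTensor A (Δ x)) = algebraMap R A (ε x) := by
  have key : ∀ (c : R) (z z' : A ⊗[R] A),
      LinearMap.mul' R A (((MulOpposite.opLinearEquiv R).symm.toLinearMap ∘ₗ
        S.toLinearMap).lTensor A z') = algebraMap R A c →
      LinearMap.mul' R A (((MulOpposite.opLinearEquiv R).symm.toLinearMap ∘ₗ
        S.toLinearMap).lTensor A (z * z')) =
      LinearMap.mul' R A (((MulOpposite.opLinearEquiv R).symm.toLinearMap ∘ₗ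
        S.toLinearMap).lTensor A z) * algebraMap R A c := by
    intro c z z' hz
    induction z with
    | zero => simp
    | add a b ha hb => simp only [add_mul, map_add, ha, hb]
    | tmul a b =>
      have : ∀ z : A ⊗[R] A, LinearMap.mul' R A (((MulOpposite.opLinearEquiv R).symm.toLinearMap ∘ₗ
          S.toLinearMap).lTensor A (a ⊗ₜ b * z)) = a *
          LinearMap.mul' R A (((MulOpposite.opLinearEquiv R).symm.toLinearMap ∘ₗ
          S.toLinearMap).lTensor A z) * (S b).unop := by
        intro z
        induction z with
        | zero => simp
        | add a b ha hb => simp only [mul_add, add_mul, map_add, ha, hb]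
        | tmul a b => simp [mul_assoc]
      rw [this, hz]
      simp [mul_assoc, Algebra.commutes]
  have hx : x ∈ Algebra.adjoin R s := hs ▸ Algebra.mem_top
  induction hx using Algebra.adjoin_induction with
  | mem x hx => exact h x hx
  | algebraMap r => simp [Algebra.TensorProduct.algebraMap_apply]
  | add x y _ _ hx hy => simp only [map_add, hx, hy]
  | mul x y _ _ hx hy => rw [map_mul, key _ _ _ hy, hx, map_mul, map_mul]

/-- A bialgebra with an algebra anti-endomorphism `S` that satisfies the antipode identities on
generators is a Hopf algebra. -/
@[simps] noncomputable def HopfStructure.ofGenerators (Δ : A →ₐ[R] A ⊗[R] A) (ε : A →ₐ[R] R)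
    (S : A →ₐ[R] Aᵐᵒᵖ) {s : Set A} (hs : Algebra.adjoin R s = ⊤)
    (coassoc : ∀ x ∈ s, Algebra.TensorProduct.assoc R R R A A A
      (Algebra.TensorProduct.map Δ (.id R A) (Δ x)) =
      Algebra.TensorProduct.map (.id R A) Δ (Δ x))
    (counit_left : ∀ x ∈ s, Algebra.TensorProduct.map ε (.id R A) (Δ x) = 1 ⊗ₜ x)
    (counit_right : ∀ x ∈ s, Algebra.TensorProduct.map (.id R A) ε (Δ x) = x ⊗ₜ 1)
    (left : ∀ x ∈ s, LinearMap.mul' R A (((MulOpposite.opLinearEquiv R).symm.toLinearMap ∘ₗ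
      S.toLinearMap).rTensor A (Δ x)) = algebraMap R A (ε x))
    (right : ∀ x ∈ s, LinearMap.mul' R A (((MulOpposite.opLinearEquiv R).symm.toLinearMap ∘ₗ
      S.toLinearMap).lTensor A (Δ x)) = algebraMap R A (ε x)) :
    HopfStructure R A where
  comul := Δ
  counit := ε
  antipode := (MulOpposite.opLinearEquiv R).symm.toLinearMap ∘ₗ S.toLinearMap
  coassoc := AlgHom.ext_of_adjoin_eq_top hs fun x hx => coassoc x hx
  counit_left := AlgHom.ext_of_adjoin_eq_top hs fun x hx => counit_left x hx
  counit_right := AlgHom.ext_of_adjoin_eq_top hs fun x hx => counit_right x hx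
  antipode_left := LinearMap.ext fun x => antipode_left_of_generators Δ ε S hs left x
  antipode_right := LinearMap.ext fun x => antipode_right_of_generators Δ ε S hs right x

namespace HopfStructure

variable (hA : HopfStructure R A) (hB : HopfStructure R B)

theorem antipode_mul (x y : A) : hA.antipode (x * y) = hA.antipode y * hA.antipode x :=
  letI := hA.toHopfAlgebra
  HopfAlgebra.antipode_mul_antidistrib (R := R) x y

theorem antipode_one : hA.antipode 1 = 1 :=
  letI := hA.toHopfAlgebra
  HopfAlgebra.antipode_one (R := R) (A := A)

/-- The antipode, as an algebra homomorphism to the opposite algebra. -/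
noncomputable def antipodeHom : A →ₐ[R] Aᵐᵒᵖ :=
  AlgHom.ofLinearMap ((MulOpposite.opLinearEquiv R).toLinearMap ∘ₗ hA.antipode)
    (by simp [antipode_one]) (by intro x y; simp [antipode_mul])

@[simp] theorem unop_antipodeHom (x : A) : (hA.antipodeHom x).unop = hA.antipode x := rfl

theorem antipode_left_apply (x : A) :
    LinearMap.mul' R A (hA.antipode.rTensor A (hA.comul x)) = algebraMap R A (hA.counit x) :=
  LinearMap.congr_fun hA.antipode_left x

theorem antipode_right_apply (x : A) :
    LinearMap.mul' R A (hA.antipode.lTensor A (hA.comul x)) = algebraMap R A (hA.counit x) :=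
  LinearMap.congr_fun hA.antipode_right x

theorem coassoc_apply (x : A) : TensorProduct.assoc R A A A
    (hA.comul.toLinearMap.rTensor A (hA.comul x)) =
      hA.comul.toLinearMap.lTensor A (hA.comul x) :=
  DFunLike.congr_fun hA.coassoc x

theorem counit_left_apply (x : A) :
    TensorProduct.map hA.counit.toLinearMap LinearMap.id (hA.comul x) = 1 ⊗ₜ x :=
  DFunLike.congr_fun hA.counit_left x

theorem counit_right_apply (x : A) :
    TensorProduct.map LinearMap.id hA.counit.toLinearMap (hA.comul x) = x ⊗ₜ 1 :=
  DFunLike.congr_fun hA.counit_right x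

end HopfStructure

/-- Algebra homomorphisms which preserve the Hopf algebra structures. -/
structure IsHopfMap (hA : HopfStructure R A) (hB : HopfStructure R B) (f : A →ₐ[R] B) : Prop where
  comul : ∀ x, hB.comul (f x) = TensorProduct.map f.toLinearMap f.toLinearMap (hA.comul x)
  counit : ∀ x, hB.counit (f x) = hA.counit x
  antipode : ∀ x, hB.antipode (f x) = f (hA.antipode x)

variable {hA : HopfStructure R A} {hB : HopfStructure R B} {f : A →ₐ[R] B}

theorem IsSkewPrimitive.map (hf : IsHopfMap hA hB f) {x a a' b b' : A}
    (h : IsSkewPrimitive hA x a a' b b') :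
    IsSkewPrimitive hB (f x) (f a) (f a') (f b) (f b') where
  comul := by rw [hf.comul, h.comul]; simp
  counit := by rw [hf.counit, h.counit]
  antipode := by rw [hf.antipode, h.antipode]; simp

theorem IsGroupLikePair.map (hf : IsHopfMap hA hB f) {a a' : A}
    (h : IsGroupLikePair hA a a') : IsGroupLikePair hB (f a) (f a') where
  comul := by rw [hf.comul, h.comul]; simp
  comul_inv := by rw [hf.comul, h.comul_inv]; simp
  counit := by rw [hf.counit, h.counit]
  counit_inv := by rw [hf.counit, h.counit_inv]
  antipode := by rw [hf.antipode, h.antipode]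
  antipode_inv := by rw [hf.antipode, h.antipode_inv]

theorem IsGroupLikePair.mul_eq_one {a a' : A} (h : IsGroupLikePair hA a a') : a * a' = 1 := by
  have := hA.antipode_right_apply a
  rw [h.comul, h.counit] at this
  simpa [h.antipode] using this

theorem IsGroupLikePair.mul_eq_one' {a a' : A} (h : IsGroupLikePair hA a a') : a' * a = 1 := by
  have := hA.antipode_left_apply a
  rw [h.comul, h.counit] at this
  simpa [h.antipode] using this

theorem IsGroupLikePair.mul {a a' b b' : A} (ha : IsGroupLikePair hA a a')
    (hb : IsGroupLikePair hA b b') : IsGroupLikePair hA (a * b) (b' * a') where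
  comul := by simp [ha.comul, hb.comul]
  comul_inv := by simp [ha.comul_inv, hb.comul_inv]
  counit := by simp [ha.counit, hb.counit]
  counit_inv := by simp [ha.counit_inv, hb.counit_inv]
  antipode := by simp [hA.antipode_mul, ha.antipode, hb.antipode]
  antipode_inv := by simp [hA.antipode_mul, ha.antipode_inv, hb.antipode_inv]

theorem IsGroupLikePair.one : IsGroupLikePair hA 1 1 where
  comul := by simp [Algebra.TensorProduct.one_def]
  comul_inv := by simp [Algebra.TensorProduct.one_def]
  counit := by simp
  counit_inv := by simp
  antipode := hA.antipode_one
  antipode_inv := hA.antipode_one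

theorem IsGroupLikePair.pow {a a' : A} (ha : IsGroupLikePair hA a a') (n : ℕ) :
    IsGroupLikePair hA (a ^ n) (a' ^ n) := by
  induction n with
  | zero => simpa using IsGroupLikePair.one
  | succ n ih => rw [pow_succ, pow_succ']; exact ih.mul ha

/-- The formula for the antipode of a skew-primitive element. -/
theorem IsSkewPrimitive.of_comul {x a a' b b' : A} (ha : IsGroupLikePair hA a a')
    (hb : IsGroupLikePair hA b b') (h : hA.comul x = x ⊗ₜ b + a ⊗ₜ x) (hε : hA.counit x = 0) :
    IsSkewPrimitive hA x a a' b b' where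
  comul := h
  counit := hε
  antipode := by
    -- The antipode identity reads S(x) b + a' x = 0; multiply by b' on the right.
    have := hA.antipode_left_apply x
    rw [h, hε] at this
    simp only [map_add, LinearMap.rTensor_tmul, LinearMap.mul'_apply, ha.antipode,
      map_zero] at this
    rw [add_eq_zero_iff_eq_neg] at this
    calc hA.antipode x = hA.antipode x * b * b' := by rw [mul_assoc, hb.mul_eq_one, mul_one]
      _ = _ := by rw [this]; simp

/-! ### Quotients by ideals generated by skew-primitive elements. -/

section Quotient

variable (hA) {r : A → A → Prop}
  (hr : ∀ x y, r x y → y = 0 ∧ ∃ a a' b b', IsSkewPrimitive hA x a a' b b')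

/-- The quotient of a Hopf algebra by an ideal generated by skew-primitive elements. -/
noncomputable def HopfStructure.quot : HopfStructure R (RingQuot r) :=
  HopfStructure.ofGenerators (A := RingQuot r)
    (RingQuot.liftAlgHom R ⟨(Algebra.TensorProduct.map (RingQuot.mkAlgHom R r)
      (RingQuot.mkAlgHom R r)).comp hA.comul, by
        rintro x y h
        obtain ⟨rfl, a, a', b, b', h'⟩ := hr x y h
        -- Each summand of x ⊗ b + a ⊗ x has x as a leg and dies in the tensor square of the
        -- quotient.
        have h0 := RingQuot.mkAlgHom_rel R h
        simp [h'.comul, h0]⟩)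
    (RingQuot.liftAlgHom R ⟨hA.counit, by
        rintro x y h
        obtain ⟨rfl, a, a', b, b', h'⟩ := hr x y h
        simp [h'.counit]⟩)
    (RingQuot.liftAlgHom R ⟨(AlgHom.op (RingQuot.mkAlgHom R r)).comp hA.antipodeHom, by
        rintro x y h
        obtain ⟨rfl, a, a', b, b', h'⟩ := hr x y h
        have h0 := RingQuot.mkAlgHom_rel R h
        apply MulOpposite.unop_injective
        simp [h'.antipode, h0]⟩)
    (s := Set.range (RingQuot.mkAlgHom R r))
    (by rw [Set.range_eq_univ.2 (RingQuot.mkAlgHom_surjective R r), Algebra.adjoin_univ])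
    (by
      rintro _ ⟨x, rfl⟩
      -- Coassociativity in A is pushed to the quotient. Both sides are then compared for an
      -- arbitrary tensor in place of Δ(x), so that induction on tensors applies; the remaining
      -- axioms follow the same pattern.
      have h := congrArg (TensorProduct.map (RingQuot.mkAlgHom R r).toLinearMap
        (TensorProduct.map (RingQuot.mkAlgHom R r).toLinearMap
          (RingQuot.mkAlgHom R r).toLinearMap)) (hA.coassoc_apply x)
      simp only [RingQuot.liftAlgHom_mkAlgHom_apply, AlgHom.comp_apply]
      generalize hA.comul x = z at h
      convert h using 1
      · clear h
        induction z with
        | zero => simp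
        | add a b ha hb => simp only [map_add, ha, hb]
        | tmul a b =>
          simp only [Algebra.TensorProduct.map_tmul, RingQuot.liftAlgHom_mkAlgHom_apply,
            AlgHom.comp_apply, LinearMap.rTensor_tmul, AlgHom.toLinearMap_apply, AlgHom.id_apply]
          generalize hA.comul a = z
          induction z with
          | zero => simp
          | add a b ha hb => simp only [map_add, TensorProduct.add_tmul, ha, hb]
          | tmul a b => simp
      · clear h
        induction z with
        | zero => simp
        | add a b ha hb => simp only [map_add, ha, hb]
        | tmul a b =>
          simp only [Algebra.TensorProduct.map_tmul, RingQuot.liftAlgHom_mkAlgHom_apply,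
            AlgHom.comp_apply, LinearMap.lTensor_tmul, AlgHom.toLinearMap_apply, AlgHom.id_apply]
          rfl)
    (by
      rintro _ ⟨x, rfl⟩
      have h := congrArg (TensorProduct.map LinearMap.id (RingQuot.mkAlgHom R r).toLinearMap)
        (hA.counit_left_apply x)
      simp only [RingQuot.liftAlgHom_mkAlgHom_apply, AlgHom.comp_apply]
      generalize hA.comul x = z at h
      convert h using 1
      · clear h
        induction z with
        | zero => simp
        | add a b ha hb => simp only [map_add, ha, hb]
        | tmul a b => simp
      · simp)
    (by
      rintro _ ⟨x, rfl⟩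
      have h := congrArg (TensorProduct.map (RingQuot.mkAlgHom R r).toLinearMap LinearMap.id)
        (hA.counit_right_apply x)
      simp only [RingQuot.liftAlgHom_mkAlgHom_apply, AlgHom.comp_apply]
      generalize hA.comul x = z at h
      convert h using 1
      · clear h
        induction z with
        | zero => simp
        | add a b ha hb => simp only [map_add, ha, hb]
        | tmul a b => simp
      · simp)
    (by
      rintro _ ⟨x, rfl⟩
      have h := congrArg (RingQuot.mkAlgHom R r) (hA.antipode_left_apply x)
      simp only [RingQuot.liftAlgHom_mkAlgHom_apply, AlgHom.comp_apply]
      rw [AlgHom.commutes] at h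
      rw [← h]
      generalize hA.comul x = z
      clear h
      induction z with
      | zero => simp
      | add a b ha hb => simp only [map_add, ha, hb]
      | tmul a b => simp)
    (by
      rintro _ ⟨x, rfl⟩
      have h := congrArg (RingQuot.mkAlgHom R r) (hA.antipode_right_apply x)
      simp only [RingQuot.liftAlgHom_mkAlgHom_apply, AlgHom.comp_apply]
      rw [AlgHom.commutes] at h
      rw [← h]
      generalize hA.comul x = z
      clear h
      induction z with
      | zero => simp
      | add a b ha hb => simp only [map_add, ha, hb]
      | tmul a b => simp)

theorem HopfStructure.isHopfMap_quot :
    IsHopfMap hA (hA.quot hr) (RingQuot.mkAlgHom R r) where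
  comul x := by
    simp only [quot, ofGenerators_comul, RingQuot.liftAlgHom_mkAlgHom_apply]
    rfl
  counit x := by simp [quot]
  antipode x := by simp [quot]

/-- If the antipode of a Hopf algebra is bijective, then so is the antipode of a quotient by
skew-primitive elements. -/
theorem HopfStructure.quot_antipode_bijective (h : Function.Bijective hA.antipode)
    (hinv : ∀ x, r x 0 → ∃ c c', hA.antipode (c * x * c') = x) :
    Function.Bijective (hA.quot hr).antipode := by
  let e := LinearEquiv.ofBijective hA.antipode h
  have he : ∀ x, hA.antipode (e.symm x) = x := fun x => e.apply_symm_apply x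
  have he' : ∀ x, e.symm (hA.antipode x) = x := fun x => e.symm_apply_apply x
  -- The inverse of an anti-automorphism is an anti-automorphism, so it is enough that S⁻¹ sends the
  -- relations into the ideal.
  let S' : A →ₐ[R] Aᵐᵒᵖ :=
    AlgHom.ofLinearMap ((MulOpposite.opLinearEquiv R).toLinearMap ∘ₗ e.symm.toLinearMap)
      (by
        apply MulOpposite.unop_injective
        apply h.1
        simp [he, hA.antipode_one])
      (by
        intro x y
        apply MulOpposite.unop_injective
        apply h.1
        simp [he, hA.antipode_mul])
  have hS' : ∀ x, S' x = MulOpposite.op (e.symm x) := fun x => rfl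
  let T : RingQuot r →ₐ[R] (RingQuot r)ᵐᵒᵖ :=
    RingQuot.liftAlgHom R ⟨(AlgHom.op (RingQuot.mkAlgHom R r)).comp S', by
      rintro x y hxy
      obtain ⟨rfl, -⟩ := hr x y hxy
      obtain ⟨c, c', hc⟩ := hinv x hxy
      have h0 := RingQuot.mkAlgHom_rel R hxy
      apply MulOpposite.unop_injective
      -- This is the role of `hinv`: S⁻¹(x) is a two-sided multiple of x, hence zero in the
      -- quotient.
      have : e.symm x = c * x * c' := by conv_lhs => rw [← hc, he']
      simp [hS', this, h0]⟩
  have hT : ∀ x, (T (RingQuot.mkAlgHom R r x)).unop = RingQuot.mkAlgHom R r (e.symm x) := by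
    intro x; simp [T, hS']
  refine Function.bijective_iff_has_inverse.2 ⟨fun x => (T x).unop, fun x => ?_, fun x => ?_⟩
  · obtain ⟨x, rfl⟩ := RingQuot.mkAlgHom_surjective R r x
    simp only [(hA.isHopfMap_quot hr).antipode, hT, he']
  · obtain ⟨x, rfl⟩ := RingQuot.mkAlgHom_surjective R r x
    simp only [hT, (hA.isHopfMap_quot hr).antipode, he]

end Quotient

end GeneralHopf

/-! ### The Hopf algebra `Half p q`. -/

/-- The inverse of a torus generator. -/
def TorusGen.inv {I : Type u} : TorusGen I → TorusGen I
  | .K i => .Kinv i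
  | .Kinv i => .K i
  | .J i => .Jinv i
  | .Jinv i => .J i

@[simp] theorem TorusGen.inv_inv {I : Type u} (s : TorusGen I) : s.inv.inv = s := by
  cases s <;> rfl

namespace Half

/-- The ring structure on `Half p q`, registered locally to help unification. -/
noncomputable abbrev ring {I : Type u} {F : Type w} [Field F] (p q : I → I → F) :
    Ring (Half p q) := inferInstance

attribute [local instance] Half.ring

variable {I : Type u} {F : Type w} [Field F] {p q : I → I → F}

theorem T_mul_T_inv (s : TorusGen I) : T p q s * T p q s.inv = 1 := by
  rcases s with i | i | i | i
  · exact K_inv i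
  · exact (comm _ _).trans (K_inv i)
  · exact J_inv i
  · exact (comm _ _).trans (J_inv i)

theorem T_inv_mul_T (s : TorusGen I) : T p q s.inv * T p q s = 1 :=
  (comm _ _).trans (T_mul_T_inv s)

/-- The scalars `χ(s, j)` with `s X_j = χ(s, j) X_j s` for torus generators `s`. -/
def char (p q : I → I → F) : TorusGen I → I → F
  | .K i, j => p i j
  | .Kinv i, j => (p i j)⁻¹
  | .J i, j => q i j
  | .Jinv i, j => (q i j)⁻¹

theorem adjoin_range_gen : Algebra.adjoin F (Set.range (gen p q)) = ⊤ := by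
  refine top_unique fun a _ => ?_
  induction a using Half.induction with
  | grade0 r => exact Subalgebra.algebraMap_mem _ r
  | grade1 g => exact Algebra.subset_adjoin ⟨g, rfl⟩
  | mul a b ha hb => exact mul_mem (ha trivial) (hb trivial)
  | add a b ha hb => exact add_mem (ha trivial) (hb trivial)

section

variable (hp : ∀ i j, p i j ≠ 0) (hq : ∀ i j, q i j ≠ 0)

include hp hq in
theorem char_ne_zero (s : TorusGen I) (j : I) : char p q s j ≠ 0 := by
  cases s <;> simp [char, hp, hq]

/-- Conjugation by an invertible k scales x by c, so conjugation by its inverse scales x by c⁻¹. -/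
theorem inv_mul_of_mul {A : Type*} [Ring A] [Algebra F A] {k k' x : A} {c : F} (hc : c ≠ 0)
    (h : k * k' = 1) (h' : k' * k = 1) (hx : k * x = c • (x * k)) :
    k' * x = c⁻¹ • (x * k') := by
  have : x * k' = c • (k' * x) := by
    calc x * k' = k' * (k * x) * k' := by rw [← mul_assoc k', h', one_mul]
      _ = c • (k' * x * (k * k')) := by rw [hx]; simp [mul_assoc]
      _ = c • (k' * x) := by rw [h, mul_one]
  rw [this, smul_smul, inv_mul_cancel₀ hc, one_smul]

include hp hq in
theorem T_mul_X (s : TorusGen I) (j : I) :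
    T p q s * X p q j = char p q s j • (X p q j * T p q s) := by
  rcases s with i | i | i | i
  · exact K_X i j
  · exact inv_mul_of_mul (hp i j) (K_inv i) (T_inv_mul_T (.K i)) (K_X i j)
  · exact J_X i j
  · exact inv_mul_of_mul (hq i j) (J_inv i) (T_inv_mul_T (.J i)) (J_X i j)

variable (a b : I → TorusGen I)

/-- The comultiplication with `X_i ↦ X_i ⊗ b_i + a_i ⊗ X_i` for which the torus is group-like. -/
noncomputable def comul (p q : I → I → F) (a b : I → TorusGen I) :
    Half p q →ₐ[F] Half p q ⊗[F] Half p q :=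
  lift (fun g => match g with
      | .X i => X p q i ⊗ₜ T p q (b i) + T p q (a i) ⊗ₜ X p q i
      | .T s => T p q s ⊗ₜ T p q s)
    (fun s t => by simp [comm s t])
    (fun i => by simp [K_inv, Algebra.TensorProduct.one_def])
    (fun i => by simp [J_inv, Algebra.TensorProduct.one_def])
    (fun i j => by
      simp only [mul_add, add_mul, Algebra.TensorProduct.tmul_mul_tmul, K_X,
        comm (.K i), TensorProduct.smul_tmul', TensorProduct.tmul_smul, smul_add])
    (fun i j => by
      simp only [mul_add, add_mul, Algebra.TensorProduct.tmul_mul_tmul, J_X,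
        comm (.J i), TensorProduct.smul_tmul', TensorProduct.tmul_smul, smul_add])

/-- The algebra anti-homomorphism with `X_i ↦ - a_i⁻¹ X_i b_i⁻¹` which inverts the torus. -/
noncomputable def antipode : Half p q →ₐ[F] (Half p q)ᵐᵒᵖ :=
  lift (fun g => MulOpposite.op (match g with
      | .X i => -(T p q (a i).inv * X p q i * T p q (b i).inv)
      | .T s => T p q s.inv))
    (fun s t => MulOpposite.unop_injective (by simp [comm t.inv s.inv]))
    (fun i => MulOpposite.unop_injective (T_mul_T_inv (TorusGen.K i)))
    (fun i => MulOpposite.unop_injective (T_mul_T_inv (TorusGen.J i)))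
    (fun i j => MulOpposite.unop_injective (by
      have h := T_mul_X hp hq (.Kinv i) j
      have h1 := comm (p := p) (q := q) (.Kinv i) (a j).inv
      have h2 := comm (p := p) (q := q) (.Kinv i) (b j).inv
      simp only [char] at h
      simp only [MulOpposite.unop_mul, MulOpposite.unop_op, MulOpposite.unop_smul]
      change _ * T p q (TorusGen.Kinv i) = _ • (T p q (TorusGen.Kinv i) * _)
      rw [mul_neg, neg_mul, smul_neg, ← mul_assoc, ← mul_assoc, h1, mul_assoc _ _ (X p q j), h,
        mul_assoc _ (T p q (b j).inv), ← h2]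
      simp [mul_assoc, smul_smul, hp]))
    (fun i j => MulOpposite.unop_injective (by
      have h := T_mul_X hp hq (.Jinv i) j
      have h1 := comm (p := p) (q := q) (.Jinv i) (a j).inv
      have h2 := comm (p := p) (q := q) (.Jinv i) (b j).inv
      simp only [char] at h
      simp only [MulOpposite.unop_mul, MulOpposite.unop_op, MulOpposite.unop_smul]
      change _ * T p q (TorusGen.Jinv i) = _ • (T p q (TorusGen.Jinv i) * _)
      rw [mul_neg, neg_mul, smul_neg, ← mul_assoc, ← mul_assoc, h1, mul_assoc _ _ (X p q j), h,
        mul_assoc _ (T p q (b j).inv), ← h2]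
      simp [mul_assoc, smul_smul, hq]))

@[simp] theorem comul_X (i : I) : comul p q a b (X p q i) =
    X p q i ⊗ₜ T p q (b i) + T p q (a i) ⊗ₜ X p q i := by
  simp [comul, lift, gen]

@[simp] theorem comul_T (s : TorusGen I) :
    comul p q a b (T p q s) = T p q s ⊗ₜ T p q s := by
  simp [comul, lift, gen]

@[simp] theorem counit_X (i : I) : counit p q (X p q i) = 0 := by simp [counit]

@[simp] theorem counit_T (s : TorusGen I) : counit p q (T p q s) = 1 := by simp [counit]

@[simp] theorem antipode_X (i : I) : antipode hp hq a b (X p q i) =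
    MulOpposite.op (-(T p q (a i).inv * X p q i * T p q (b i).inv)) := by simp [antipode]

@[simp] theorem antipode_T (s : TorusGen I) :
    antipode hp hq a b (T p q s) = MulOpposite.op (T p q s.inv) := by simp [antipode]

/-- The Hopf algebra structure on `Half p q`. -/
noncomputable def hopf : HopfStructure F (Half p q) :=
  HopfStructure.ofGenerators (comul p q a b) (counit p q) (antipode hp hq a b) adjoin_range_gen
    (by
      rintro _ ⟨i | s, rfl⟩
      · simp [TensorProduct.add_tmul, TensorProduct.tmul_add, add_assoc]
      · simp)
    (by rintro _ ⟨i | s, rfl⟩ <;> simp)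
    (by rintro _ ⟨i | s, rfl⟩ <;> simp)
    (by
      rintro _ ⟨i | s, rfl⟩
      · simp [mul_assoc, T_inv_mul_T]
      · simp [T_inv_mul_T])
    (by
      rintro _ ⟨i | s, rfl⟩
      · simp [← mul_assoc, T_mul_T_inv]
      · simp [T_mul_T_inv])

@[simp] theorem hopf_comul : (hopf hp hq a b).comul = comul p q a b := rfl

@[simp] theorem hopf_counit : (hopf hp hq a b).counit = counit p q := rfl

theorem hopf_antipode (x : Half p q) :
    (hopf hp hq a b).antipode x = (antipode hp hq a b x).unop := rfl

theorem isGroupLikePair_T (s : TorusGen I) :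
    IsGroupLikePair (hopf hp hq a b) (T p q s) (T p q s.inv) where
  comul := by simp
  comul_inv := by simp
  counit := by simp
  counit_inv := by simp
  antipode := by simp [hopf_antipode]
  antipode_inv := by simp [hopf_antipode]

theorem isSkewPrimitive_X (i : I) :
    IsSkewPrimitive (hopf hp hq a b) (X p q i) (T p q (a i)) (T p q (a i).inv)
      (T p q (b i)) (T p q (b i).inv) where
  comul := by simp [add_comm]
  counit := by simp
  antipode := by simp [hopf_antipode]

/-- The inverse is the antipode of the structure in which `a` and `b` are exchanged, that is, of the
co-opposite structure. -/
theorem antipode_bijective : Function.Bijective (hopf hp hq a b).antipode := by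
  have h : ∀ (a b : I → TorusGen I) (x : Half p q),
      (hopf hp hq b a).antipode ((hopf hp hq a b).antipode x) = x := by
    intro a b x
    induction x using Half.induction with
    | grade0 r => simp [hopf_antipode]
    | grade1 g =>
      rcases g with i | s
      · simp only [hopf_antipode, antipode_X, MulOpposite.unop_op, map_neg, map_mul, antipode_T,
          MulOpposite.unop_mul, TorusGen.inv_inv]
        simp only [mul_neg, neg_mul, neg_neg, mul_assoc, T_inv_mul_T, mul_one]
        rw [← mul_assoc, T_mul_T_inv, one_mul]
      · simp [hopf_antipode]
    | mul x y hx hy => rw [HopfStructure.antipode_mul, HopfStructure.antipode_mul, hx, hy]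
    | add x y hx hy => rw [map_add, map_add, hx, hy]
  exact Function.bijective_iff_has_inverse.2 ⟨_, h a b, h b a⟩

end

end Half

/-! ### Iterated twisted commutators and cancellation of mixed terms. -/

section Serre

variable {F : Type*} [Field F] {A : Type*} [Ring A] [Algebra F A]

/-- The operator `z ↦ z x - c x z`. -/
noncomputable def twistedAd (x : A) (c : F) : Module.End F A :=
  LinearMap.mulRight F x - c • LinearMap.mulLeft F x

@[simp] theorem twistedAd_apply (x : A) (c : F) (z : A) :
    twistedAd x c z = z * x - c • (x * z) := rfl

/-- Both operators are combinations of left and right multiplication by the same x, and those two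
commute. -/
theorem twistedAd_commute (x : A) (c d : F) : Commute (twistedAd x c) (twistedAd x d) := by
  ext z
  simp only [Module.End.mul_apply, twistedAd_apply, sub_mul, mul_sub, smul_mul_assoc,
    mul_smul_comm, smul_sub, mul_assoc, smul_smul, mul_comm d c]
  abel

/-- The iterated operator `T_{n - 1} ⋯ T_0` for `T_l z = z x - c_l x z`. -/
noncomputable def iterAd (x : A) (c : ℕ → F) : ℕ → Module.End F A
  | 0 => 1
  | n + 1 => twistedAd x (c n) * iterAd x c n

theorem iterAd_succ (x : A) (c : ℕ → F) (n : ℕ) (z : A) :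
    iterAd x c (n + 1) z = iterAd x c n z * x - c n • (x * iterAd x c n z) := rfl

theorem commute_iterAd (x : A) (c : ℕ → F) (d : F) (n : ℕ) :
    Commute (twistedAd x d) (iterAd x c n) := by
  induction n with
  | zero => exact Commute.one_right _
  | succ n ih => exact (twistedAd_commute x d _).mul_right ih

theorem iterAd_succ' (x : A) (c : ℕ → F) (n : ℕ) :
    iterAd x c (n + 1) = iterAd x (fun l => c (l + 1)) n * twistedAd x (c 0) := by
  induction n with
  | zero => simp [iterAd]
  | succ n ih => rw [iterAd, ih, ← mul_assoc]; rfl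

theorem iterAd_congr (x : A) {c d : ℕ → F} {n : ℕ} (h : ∀ l < n, c l = d l) :
    iterAd x c n = iterAd x d n := by
  induction n with
  | zero => rfl
  | succ n ih => rw [iterAd, iterAd, h n n.lt_succ_self, ih fun l hl => h l (hl.trans n.lt_succ_self)]

/-- The factors commute, so the order of the coefficients is irrelevant. This lets one list of
coefficients be read increasingly for one summand and decreasingly for the other. -/
theorem iterAd_reverse (x : A) (c : ℕ → F) (n : ℕ) :
    iterAd x (fun l => c (n - 1 - l)) n = iterAd x c n := by
  induction n with
  | zero => rfl
  | succ n ih =>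
    rw [iterAd_succ', iterAd, (commute_iterAd x c (c n) n).eq, ← ih]
    congr 1
    refine iterAd_congr x fun l hl => ?_
    congr 1
    omega

/-- The n-th iterate t picks up one factor k per step when moved past y, so t y = r k^n y t. The
next coefficient is r k^n, hence t y - c_n y t = 0 and the summand y never contributes. Both facts
have to be carried in the induction. -/
theorem iterAd_add_of_right {x y z : A} {k r : F} (hxy : x * y = k • (y * x))
    (hzy : z * y = r • (y * z)) (n : ℕ) :
    iterAd (x + y) (fun l => r * k ^ l) n z = iterAd x (fun l => r * k ^ l) n z ∧
      iterAd x (fun l => r * k ^ l) n z * y =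
        (r * k ^ n) • (y * iterAd x (fun l => r * k ^ l) n z) := by
  induction n with
  | zero => simpa [iterAd] using hzy
  | succ n ih =>
    obtain ⟨h1, h2⟩ := ih
    rw [iterAd_succ, iterAd_succ, h1]
    set t := iterAd x (fun l => r * k ^ l) n z
    constructor
    · rw [mul_add, add_mul, h2, smul_add]; abel
    · rw [sub_mul, mul_assoc, hxy, smul_mul_assoc, mul_assoc, h2, mul_smul_comm, ← mul_assoc t,
        mul_smul_comm, ← mul_assoc x, hxy, h2, mul_sub]
      simp only [smul_mul_assoc, mul_smul_comm, smul_sub, smul_smul, mul_assoc]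
      congr 2 <;> ring

/-- Here the summand x drops out: x t = r k^n t x, and the coefficient is the inverse of this
scalar, so t x - c_n x t = 0. -/
theorem iterAd_add_of_left {x y z : A} {k r : F} (hr : r ≠ 0) (hk : k ≠ 0)
    (hxy : x * y = k • (y * x)) (hxz : x * z = r • (z * x)) (n : ℕ) :
    iterAd (x + y) (fun l => (r * k ^ l)⁻¹) n z = iterAd y (fun l => (r * k ^ l)⁻¹) n z ∧
      x * iterAd y (fun l => (r * k ^ l)⁻¹) n z =
        (r * k ^ n) • (iterAd y (fun l => (r * k ^ l)⁻¹) n z * x) := by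
  induction n with
  | zero => simpa [iterAd] using hxz
  | succ n ih =>
    obtain ⟨h1, h2⟩ := ih
    rw [iterAd_succ, iterAd_succ, h1]
    set t := iterAd y (fun l => (r * k ^ l)⁻¹) n z
    constructor
    · rw [mul_add, add_mul, h2, smul_add, smul_smul,
        inv_mul_cancel₀ (mul_ne_zero hr (pow_ne_zero _ hk)), one_smul]; abel
    · rw [mul_sub, ← mul_assoc, h2, mul_smul_comm, ← mul_assoc x, hxy, smul_mul_assoc,
        smul_mul_assoc, mul_assoc, mul_assoc, hxy, h2, sub_mul]
      simp only [smul_mul_assoc, mul_smul_comm, smul_sub, smul_smul, mul_assoc]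
      congr 2 <;> ring

/-- The mixed terms in the expansion of `iterAd (x + y) c N (z + t)` cancel. -/
theorem iterAd_add_add {x y z t : A} {k r r' : F} {N : ℕ} (hk : k ≠ 0)
    (hrr : r * r' * k ^ (N - 1) = 1) (hxy : x * y = k • (y * x))
    (hxt : x * t = r • (t * x)) (hzy : z * y = r' • (y * z)) :
    iterAd (x + y) (fun l => r' * k ^ l) N (z + t) =
      iterAd x (fun l => r' * k ^ l) N z + iterAd y (fun l => r' * k ^ l) N t := by
  have hr : r ≠ 0 := left_ne_zero_of_mul (left_ne_zero_of_mul (hrr ▸ one_ne_zero))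
  rw [map_add, (iterAd_add_of_right hxy hzy N).1]
  congr 1
  -- By `hrr`, r' k^(N-1-l) and r k^l are inverse to each other. Reversing the coefficients suited
  -- to the first summand thus yields those suited to the second.
  have h : ∀ x : A, iterAd x (fun l => r' * k ^ l) N = iterAd x (fun l => (r * k ^ l)⁻¹) N := by
    intro x
    rw [← iterAd_reverse]
    refine iterAd_congr x fun l hl => eq_inv_of_mul_eq_one_left ?_
    rw [← hrr, show N - 1 = (N - 1 - l) + l by omega, pow_add]
    simp only [Nat.add_sub_cancel]
    ring
  rw [h, h, (iterAd_add_of_left hr hk hxy hxt N).1]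

/-- The second legs commute, so each step acts as a twisted commutator on the first leg and only
adds a factor g to the second. -/
theorem iterAd_tmul {B : Type*} [Ring B] [Algebra F B] {x z : A} {g g' : B} (hg : Commute g' g)
    (c : ℕ → F) (n : ℕ) :
    iterAd (x ⊗ₜ[F] g) c n (z ⊗ₜ g') = iterAd x c n z ⊗ₜ (g' * g ^ n) := by
  induction n with
  | zero => simp [iterAd]
  | succ n ih =>
    rw [iterAd_succ, ih, iterAd_succ, Algebra.TensorProduct.tmul_mul_tmul,
      Algebra.TensorProduct.tmul_mul_tmul,
      show g * (g' * g ^ n) = g' * g ^ n * g from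
        ((hg.mul_left (Commute.refl g |>.pow_left n)).eq).symm,
      mul_assoc, ← pow_succ, TensorProduct.sub_tmul, TensorProduct.smul_tmul']

theorem iterAd_tmul' {B : Type*} [Ring B] [Algebra F B] {x z : A} {g g' : B} (hg : Commute g' g)
    (c : ℕ → F) (n : ℕ) :
    iterAd (g ⊗ₜ[F] x) c n (g' ⊗ₜ z) = (g' * g ^ n) ⊗ₜ iterAd x c n z := by
  induction n with
  | zero => simp [iterAd]
  | succ n ih =>
    rw [iterAd_succ, ih, iterAd_succ, Algebra.TensorProduct.tmul_mul_tmul,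
      Algebra.TensorProduct.tmul_mul_tmul,
      show g * (g' * g ^ n) = g' * g ^ n * g from
        ((hg.mul_left (Commute.refl g |>.pow_left n)).eq).symm,
      mul_assoc, ← pow_succ, TensorProduct.tmul_sub, TensorProduct.tmul_smul]

end Serre

namespace DeformationDatum

/-! ### q-numbers and the q-binomial expansion. -/

section QNumbers

variable {F : Type w} [Field F]

theorem qNumber_inv (c : F) (n : ℕ) : qNumber c⁻¹ n = qNumber c n := by
  unfold qNumber
  rw [inv_pow, inv_inv, inv_inv, ← neg_sub, ← neg_sub c, neg_div_neg_eq]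

theorem qFactorial_inv (c : F) (n : ℕ) : qFactorial c⁻¹ n = qFactorial c n := by
  simp only [qFactorial, qNumber_inv]

theorem qFactorial_succ (c : F) (n : ℕ) :
    qFactorial c (n + 1) = qFactorial c n * qNumber c (n + 1) := by
  rw [qFactorial, Finset.prod_Icc_succ_top (by omega), qFactorial]

/-- The source of the q-Pascal rule: a telescoping of c^(k+l) - c^(-k-l) through c^(l-k). -/
theorem qNumber_add {c : F} (hc : c ≠ 0) (k l : ℕ) :
    qNumber c (k + l) = (c ^ k)⁻¹ * qNumber c l + c ^ l * qNumber c k := by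
  unfold qNumber
  rw [mul_div_assoc', mul_div_assoc', ← add_div]
  congr 1
  field_simp
  ring

/-- If c^n = c^(-n), then c^(2n) = 1, which is excluded; the case n = 1 takes care of the
denominator. -/
theorem qNumber_ne_zero {c : F} (hc : c ≠ 0) (h : ∀ n : ℕ, 0 < n → c ^ n ≠ 1) {n : ℕ}
    (hn : 0 < n) : qNumber c n ≠ 0 := by
  have key : ∀ n : ℕ, 0 < n → c ^ n - (c ^ n)⁻¹ ≠ 0 := by
    intro n hn h0
    refine h (n + n) (by omega) ?_
    rw [sub_eq_zero] at h0
    rw [pow_add]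
    nth_rewrite 2 [h0]
    exact mul_inv_cancel₀ (pow_ne_zero _ hc)
  exact div_ne_zero (key n hn) (by simpa using key 1 one_pos)

theorem qFactorial_ne_zero {c : F} (hc : c ≠ 0) (h : ∀ n : ℕ, 0 < n → c ^ n ≠ 1) (n : ℕ) :
    qFactorial c n ≠ 0 :=
  Finset.prod_ne_zero_iff.2 fun _ hk => qNumber_ne_zero hc h (Finset.mem_Icc.1 hk).1

/-- The `q`-binomial theorem, in the form of an expansion of `iterAd`. -/
theorem iterAd_eq_sum {A : Type*} [Ring A] [Algebra F A] {c : F} (hc : c ≠ 0)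
    (h : ∀ n : ℕ, 0 < n → c ^ n ≠ 1) (x y : A) (n : ℕ) (b : F) (hb : b ≠ 0) :
    iterAd x (fun l => b⁻¹ * c * (c ^ n)⁻¹ * (c ^ 2) ^ l) n y =
      qFactorial c n • ∑ k ∈ Finset.HasAntidiagonal.antidiagonal n, ((-1) ^ k.1 * (b ^ k.1)⁻¹) •
        (((qFactorial c k.1)⁻¹ • x ^ k.1) * y * ((qFactorial c k.2)⁻¹ • x ^ k.2)) := by
  induction n generalizing b with
  | zero => simp [iterAd, qFactorial]
  | succ n ih =>
    have hf := qFactorial_ne_zero hc h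
    have hq := fun n => qNumber_ne_zero hc h (Nat.succ_pos n)
    -- Passing from n + 1 to n is absorbed by replacing b with b c; for this reason the induction
    -- runs over all b.
    have e : iterAd x (fun l => b⁻¹ * c * (c ^ (n + 1))⁻¹ * (c ^ 2) ^ l) n y =
        iterAd x (fun l => (b * c)⁻¹ * c * (c ^ n)⁻¹ * (c ^ 2) ^ l) n y := by
      congr 2
      funext l
      field_simp
      ring
    rw [iterAd_succ, e, ih (b * c) (mul_ne_zero hb hc)]
    -- [n+1] = c^(-k) [k'] + c^(k') [k] splits the sum in two. The first part will match t x and the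
    -- second -c_n x t, for the previous iterate t.
    have split : qFactorial c (n + 1) • ∑ k ∈ Finset.HasAntidiagonal.antidiagonal (n + 1),
        ((-1) ^ k.1 * (b ^ k.1)⁻¹) •
          (((qFactorial c k.1)⁻¹ • x ^ k.1) * y * ((qFactorial c k.2)⁻¹ • x ^ k.2)) =
        qFactorial c n • (∑ k ∈ Finset.HasAntidiagonal.antidiagonal (n + 1), ((c ^ k.1)⁻¹ * qNumber c k.2 *
          ((-1) ^ k.1 * (b ^ k.1)⁻¹ * (qFactorial c k.1)⁻¹ * (qFactorial c k.2)⁻¹)) •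
          (x ^ k.1 * y * x ^ k.2) +
        ∑ k ∈ Finset.HasAntidiagonal.antidiagonal (n + 1), (c ^ k.2 * qNumber c k.1 *
          ((-1) ^ k.1 * (b ^ k.1)⁻¹ * (qFactorial c k.1)⁻¹ * (qFactorial c k.2)⁻¹)) •
          (x ^ k.1 * y * x ^ k.2)) := by
      rw [← Finset.sum_add_distrib, qFactorial_succ, mul_smul, Finset.smul_sum]
      congr 1
      refine Finset.sum_congr rfl fun k hk => ?_
      rw [← Finset.HasAntidiagonal.mem_antidiagonal.1 hk, qNumber_add hc]
      simp only [smul_mul_assoc, mul_smul_comm, smul_smul, ← add_smul]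
      congr 1
      ring
    rw [split, Finset.Nat.sum_antidiagonal_succ', Finset.Nat.sum_antidiagonal_succ]
    -- The boundary terms k' = 0 of the first sum and k = 0 of the second contain [0] = 0, so both
    -- sums are reindexed over pairs with sum n.
    simp only [show qNumber c 0 = 0 by simp [qNumber], mul_zero, zero_mul, zero_smul, zero_add]
    rw [smul_mul_assoc, mul_smul_comm, smul_comm _ (qFactorial c n), ← smul_sub, Finset.sum_mul,
      Finset.mul_sum, sub_eq_add_neg, Finset.smul_sum, ← Finset.sum_neg_distrib]
    congr 2
    · refine Finset.sum_congr rfl fun k hk => ?_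
      simp only [smul_mul_assoc, mul_smul_comm, smul_smul, mul_assoc, ← pow_succ]
      congr 1
      rw [qFactorial_succ]
      have := hf k.1; have := hf k.2; have := hq k.2
      field_simp
      ring
    · refine Finset.sum_congr rfl fun k hk => ?_
      simp only [smul_mul_assoc, mul_smul_comm, smul_smul, ← mul_assoc, ← pow_succ', ← neg_smul]
      congr 1
      rw [qFactorial_succ, ← Finset.HasAntidiagonal.mem_antidiagonal.1 hk]
      have := hf k.1; have := hf k.2; have := hq k.1
      field_simp
      ring

end QNumbers

end DeformationDatum

theorem map_iterAd {F A B : Type*} [Field F] [Ring A] [Algebra F A] [Ring B] [Algebra F B]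
    (f : A →ₐ[F] B) (x y : A) (c : ℕ → F) (n : ℕ) :
    f (iterAd x c n y) = iterAd (f x) c n (f y) := by
  induction n with
  | zero => rfl
  | succ n ih => simp [iterAd_succ, ih]

/-! ### Skew-primitivity of iterated twisted commutators of generators. -/

namespace Half

attribute [local instance] Half.ring

variable {I : Type u} {F : Type w} [Field F] {p q : I → I → F}
variable (hp : ∀ i j, p i j ≠ 0) (hq : ∀ i j, q i j ≠ 0) (a b : I → TorusGen I)

include hp hq in
-- Supplies all the commutation scalars k, r, r' between the summands of Δ(X_i) and Δ(X_j): the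
-- torus element t moves past X_i in the first leg and s past X_j in the second.
theorem X_tmul_T_mul (i j : I) (s t : TorusGen I) :
    (X p q i ⊗ₜ[F] T p q s) * (T p q t ⊗ₜ[F] X p q j) =
      ((char p q t i)⁻¹ * char p q s j) • ((T p q t ⊗ₜ[F] X p q j) * (X p q i ⊗ₜ[F] T p q s)) := by
  rw [Algebra.TensorProduct.tmul_mul_tmul, Algebra.TensorProduct.tmul_mul_tmul,
    T_mul_X hp hq t i, T_mul_X hp hq s j, TensorProduct.tmul_smul, ← TensorProduct.smul_tmul',
    smul_smul, mul_right_comm, inv_mul_cancel₀ (char_ne_zero hp hq t i), one_mul]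

/-- The quantum Serre elements are skew-primitive. -/
theorem isSkewPrimitive_iterAd (i j : I) (N : ℕ) {k r' : F}
    (hk : k = (char p q (a i) i)⁻¹ * char p q (b i) i)
    (hr' : r' = (char p q (a i) j)⁻¹ * char p q (b j) i)
    (h : (char p q (a j) i)⁻¹ * char p q (b i) j * r' * k ^ (N - 1) = 1) :
    IsSkewPrimitive (hopf hp hq a b) (iterAd (X p q i) (fun l => r' * k ^ l) N (X p q j))
      (T p q (a j) * T p q (a i) ^ N) (T p q (a i).inv ^ N * T p q (a j).inv)
      (T p q (b j) * T p q (b i) ^ N) (T p q (b i).inv ^ N * T p q (b j).inv) := by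
  refine IsSkewPrimitive.of_comul ((isGroupLikePair_T hp hq a b _).mul
    ((isGroupLikePair_T hp hq a b _).pow N)) ((isGroupLikePair_T hp hq a b _).mul
    ((isGroupLikePair_T hp hq a b _).pow N)) ?_ ?_
  -- `iterAd_add_add` is applied with x = X_i ⊗ b_i, y = a_i ⊗ X_i, z = X_j ⊗ b_j, t = a_j ⊗ X_j.
  · rw [hopf_comul, map_iterAd, comul_X, comul_X, iterAd_add_add _ h, iterAd_tmul (comm _ _),
      iterAd_tmul' (comm _ _)]
    · rw [hk]; exact X_tmul_T_mul hp hq _ _ _ _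
    · exact X_tmul_T_mul hp hq _ _ _ _
    · rw [hr']; exact X_tmul_T_mul hp hq _ _ _ _
    · rw [hk]
      exact mul_ne_zero (inv_ne_zero (char_ne_zero hp hq _ _)) (char_ne_zero hp hq _ _)
  · rw [hopf_counit, map_iterAd, counit_X, counit_X, map_zero]

end Half

theorem IsSkewPrimitive.smul {R : Type u} [CommRing R] {A : Type w} [Ring A] [Algebra R A]
    {h : HopfStructure R A} {x a a' b b' : A} (hx : IsSkewPrimitive h x a a' b b') (c : R) :
    IsSkewPrimitive h (c • x) a a' b b' where
  comul := by rw [map_smul, hx.comul, smul_add, TensorProduct.smul_tmul', TensorProduct.tmul_smul]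
  counit := by rw [map_smul, hx.counit, smul_zero]
  antipode := by rw [map_smul, hx.antipode]; simp

/-- The antipode turns -b' x a' into a (a' x b') b, so S⁻¹(x) is a two-sided multiple of x. This is
the input that `HopfStructure.quot_antipode_bijective` needs. -/
theorem IsSkewPrimitive.antipode_neg_mul {R : Type u} [CommRing R] {A : Type w} [Ring A]
    [Algebra R A] {h : HopfStructure R A} {x a a' b b' : A} (hx : IsSkewPrimitive h x a a' b b')
    (ha : IsGroupLikePair h a a') (hb : IsGroupLikePair h b b') :
    h.antipode (-b' * x * a') = x := by
  rw [h.antipode_mul, h.antipode_mul, hx.antipode, map_neg, ha.antipode_inv, hb.antipode_inv]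
  simp only [mul_neg, neg_mul, neg_neg]
  rw [mul_assoc _ b', hb.mul_eq_one', mul_one, ← mul_assoc, ha.mul_eq_one, one_mul]

set_option linter.unusedSectionVars false

/-! ### The Serre elements of a deformation datum and the Hopf algebras `FPlus`, `FMinus`. -/

namespace DeformationDatum

attribute [local instance] Half.ring

variable {I : Type u} {F : Type w} [Field F] [Algebra (RatFunc ℚ) F]

/-- Field homomorphisms are injective, so it suffices to compare the degrees of X^m and 1 in ℚ[X].
-/
theorem v_zpow_ne_one {n : ℤ} (hn : n ≠ 0) : v F ^ n ≠ 1 := by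
  intro h
  have hv : (RatFunc.X : RatFunc ℚ) ^ n = 1 := by
    apply (algebraMap (RatFunc ℚ) F).injective
    rw [map_zpow₀, map_one]; exact h
  have key : ∀ m : ℕ, m ≠ 0 → (RatFunc.X : RatFunc ℚ) ^ m ≠ 1 := by
    intro m hm h
    rw [← RatFunc.algebraMap_X, ← map_pow, ← map_one (algebraMap (Polynomial ℚ) (RatFunc ℚ))] at h
    have := congrArg Polynomial.natDegree (RatFunc.algebraMap_injective ℚ h)
    simp at this
    exact hm this
  obtain ⟨m, rfl | rfl⟩ := n.eq_nat_or_neg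
  · exact key m (by simpa using hn) (by simpa using hv)
  · exact key m (by simpa using hn) (by simpa using hv)

variable (P : DeformationDatum I F)

theorem vi_ne_zero (i : I) : P.vi i ≠ 0 := zpow_ne_zero _ v_ne_zero

theorem vi_pow_ne_one (i : I) (n : ℕ) (hn : 0 < n) : P.vi i ^ n ≠ 1 := by
  rw [vi, ← zpow_natCast, ← zpow_mul]
  refine v_zpow_ne_one (mul_ne_zero ?_ (by omega))
  obtain ⟨m, hm⟩ := P.cartan.even i
  have := P.cartan.pos i
  omega

theorem vi_inv_pow_ne_one (i : I) (n : ℕ) (hn : 0 < n) : (P.vi i)⁻¹ ^ n ≠ 1 := by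
  rw [inv_pow]
  exact fun h => P.vi_pow_ne_one i n hn (inv_eq_one.1 h)

theorem vi_sq (i : I) : P.vi i ^ 2 = v F ^ P.cartan.dot i i := by
  rw [vi, ← zpow_natCast, ← zpow_mul]
  congr 1
  obtain ⟨m, hm⟩ := P.cartan.even i
  omega

/-- With i · i = 2d, divisibility makes the integer division exact with quotient m = a_ij. The sign
condition gives m ≤ 0, so passing to ℕ in 1 - m loses nothing, and i · j = d m. -/
theorem serreOrder_spec {i j : I} (h : i ≠ j) :
    0 < P.serreOrder i j ∧
      P.cartan.dot i j = P.cartan.dot i i / 2 * (1 - (P.serreOrder i j : ℤ)) := by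
  obtain ⟨d, hd⟩ := P.cartan.even i
  obtain ⟨m, hm⟩ := P.cartan.dvd i j h
  have hpos := P.cartan.pos i
  have hnp := P.cartan.nonpos i j h
  have hdiv : 2 * P.cartan.dot i j / P.cartan.dot i i = m := by
    rw [hm, Int.mul_ediv_cancel_left _ hpos.ne']
  have hm0 : m ≤ 0 := by nlinarith
  have hN : (P.serreOrder i j : ℤ) = 1 - m := by
    rw [serreOrder, hdiv]; omega
  refine ⟨by omega, ?_⟩
  rw [hN, hd] at *
  rw [show (d + d) / 2 = d by omega]
  linarith

theorem v_zpow_dot {i j : I} (h : i ≠ j) :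
    v F ^ P.cartan.dot i j = P.vi i * (P.vi i ^ P.serreOrder i j)⁻¹ := by
  rw [(P.serreOrder_spec h).2, vi, zpow_mul, zpow_sub₀, zpow_one, zpow_natCast, div_eq_mul_inv]
  exact zpow_ne_zero _ v_ne_zero

theorem β_ne_zero (i j : I) : P.β.at i j ≠ 0 := left_ne_zero_of_mul_eq_one (P.β_mul i j)

theorem β_inv (i j : I) : (P.β.at i j)⁻¹ = P.β.at j i := inv_eq_of_mul_eq_one_right (P.β_mul i j)

theorem ξ_at_symm (i j : I) : P.ξ.at i j = P.ξ.at j i := P.ξ_symm _ _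

/-- By symmetry of ξ its contributions cancel: the scalars that govern the Serre elements depend on
v and β alone. -/
theorem angle_inv_mul_ξ (i j : I) :
    (P.angle i j)⁻¹ * P.ξ.at i j = v F ^ P.cartan.dot i j * P.β.at j i := by
  have := P.ξ_ne_zero j i
  have := P.β_ne_zero i j
  rw [angle, P.ξ_at_symm i j, ← β_inv, zpow_neg]
  have : v F ^ P.cartan.dot i j ≠ 0 := zpow_ne_zero _ v_ne_zero
  field_simp

theorem angle_mul_ξ_inv (i j : I) :
    P.angle j i * (P.ξ.at i j)⁻¹ = (v F ^ P.cartan.dot i j)⁻¹ * P.β.at j i := by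
  have := P.ξ_ne_zero i j
  rw [angle, P.cartan.symm j i, zpow_neg]
  field_simp

/-- The q-binomial expansion with c = v_i and b = β(i, j), divided by the q-factorial of the order;
v_i is not a root of unity, so this factorial is invertible. -/
theorem serreElement_map {A : Type*} [Ring A] [Algebra F A] (f : FreeAlgebra F I →ₐ[F] A)
    (i j : I) : f (P.serreElement i j) = (qFactorial (P.vi i) (P.serreOrder i j))⁻¹ •
      iterAd (f (FreeAlgebra.ι F i)) (fun l => (P.β.at i j)⁻¹ * P.vi i *
        (P.vi i ^ P.serreOrder i j)⁻¹ * (P.vi i ^ 2) ^ l) (P.serreOrder i j)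
        (f (FreeAlgebra.ι F j)) := by
  rw [iterAd_eq_sum (P.vi_ne_zero i) (P.vi_pow_ne_one i) _ _ _ _ (P.β_ne_zero i j), smul_smul,
    inv_mul_cancel₀ (qFactorial_ne_zero (P.vi_ne_zero i) (P.vi_pow_ne_one i) _), one_smul]
  simp [serreElement, divPow]

/-- Reversing products exchanges k and k', which costs the factor (-1)^N β^(-N) and inverts β. Since
q-factorials are invariant under c ↦ c⁻¹, the expansion may be taken at c = v_i⁻¹, the choice that
fits the commutation scalars of `FreeMinus`. -/
theorem serreElement_map_op {A : Type*} [Ring A] [Algebra F A] (f : FreeAlgebra F I →ₐ[F] Aᵐᵒᵖ)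
    (i j : I) : (f (P.serreElement i j)).unop =
      ((-1) ^ P.serreOrder i j * (P.β.at i j ^ P.serreOrder i j)⁻¹ *
        (qFactorial (P.vi i) (P.serreOrder i j))⁻¹) •
      iterAd (f (FreeAlgebra.ι F i)).unop (fun l => (P.β.at i j)⁻¹⁻¹ * (P.vi i)⁻¹ *
        ((P.vi i)⁻¹ ^ P.serreOrder i j)⁻¹ * ((P.vi i)⁻¹ ^ 2) ^ l) (P.serreOrder i j)
        (f (FreeAlgebra.ι F j)).unop := by
  rw [iterAd_eq_sum (inv_ne_zero (P.vi_ne_zero i)) (P.vi_inv_pow_ne_one i) _ _ _ _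
    (inv_ne_zero (P.β_ne_zero i j)), smul_smul, qFactorial_inv, mul_assoc,
    inv_mul_cancel₀ (qFactorial_ne_zero (P.vi_ne_zero i) (P.vi_pow_ne_one i) _), mul_one,
    ← Finset.Nat.sum_antidiagonal_swap, serreElement, map_sum, Finset.unop_sum,
    Finset.smul_sum]
  refine Finset.sum_congr rfl fun k hk => ?_
  rw [← Finset.HasAntidiagonal.mem_antidiagonal.1 hk]
  simp only [divPow, map_smul, map_mul, map_pow, MulOpposite.unop_smul, MulOpposite.unop_mul,
    MulOpposite.unop_pow, Prod.fst_swap, Prod.snd_swap, qFactorial_inv, smul_smul, mul_assoc]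
  congr 1
  have hb := P.β_ne_zero i j
  have h1 : ((-1 : F) ^ k.2) * (-1) ^ k.2 = 1 := by rw [← mul_pow]; simp
  rw [pow_add, pow_add, inv_pow, inv_inv]
  field_simp
  rw [pow_two, h1]

/-- The Hopf algebra structure on the free algebra with the torus, positive part. -/
noncomputable abbrev hopfFreePlus : HopfStructure F P.FreePlus :=
  Half.hopf P.angle_ne_zero (fun i j => P.ξ_ne_zero j i) .K .J

/-- The Hopf algebra structure on the free algebra with the torus, negative part. -/
noncomputable abbrev hopfFreeMinus : HopfStructure F P.FreeMinus :=
  Half.hopf (fun i j => mul_ne_zero (P.angle_ne_zero j i) (inv_ne_zero (P.ξ_ne_zero i j)))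
    (fun _ _ => one_ne_zero) .J .K

/-- The scalars are k = v_i², r = v^(i·j) β(i, j) and r' = v^(i·j) β(j, i). The cancellation
condition r r' k^(N-1) = 1 holds because β(i, j) β(j, i) = 1 and v^(i·j) = v_i^(1-N), which is what
fixes the order of the Serre relation. -/
theorem isSkewPrimitive_serrePlus {i j : I} (h : i ≠ j) :
    IsSkewPrimitive P.hopfFreePlus (P.iotaPlus (P.serreElement i j))
      (P.genPlus (.T (.K j)) * P.genPlus (.T (.K i)) ^ P.serreOrder i j)
      (P.genPlus (.T (.Kinv i)) ^ P.serreOrder i j * P.genPlus (.T (.Kinv j)))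
      (P.genPlus (.T (.J j)) * P.genPlus (.T (.J i)) ^ P.serreOrder i j)
      (P.genPlus (.T (.Jinv i)) ^ P.serreOrder i j * P.genPlus (.T (.Jinv j))) := by
  rw [serreElement_map]
  refine IsSkewPrimitive.smul ?_ _
  have h1 : P.iotaPlus (FreeAlgebra.ι F i) = P.genPlus (.X i) := by simp [iotaPlus]
  have h2 : P.iotaPlus (FreeAlgebra.ι F j) = P.genPlus (.X j) := by simp [iotaPlus]
  rw [h1, h2]
  refine Half.isSkewPrimitive_iterAd _ _ .K .J i j _ ?_ ?_ ?_
  · simp only [Half.char]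
    rw [angle_inv_mul_ξ, P.β_diag, mul_one, vi_sq]
  · simp only [Half.char]
    rw [angle_inv_mul_ξ, v_zpow_dot P h, β_inv]
    ring
  · simp only [Half.char]
    rw [angle_inv_mul_ξ, P.cartan.symm j i, v_zpow_dot P h, β_inv]
    have hv := P.vi_ne_zero i
    calc _ = (P.vi i * (P.vi i ^ P.serreOrder i j)⁻¹ *
          P.vi i ^ (P.serreOrder i j - 1)) ^ 2 * (P.β.at i j * P.β.at j i) := by ring
      _ = 1 := by
        rw [mul_right_comm, P.β_mul, mul_one, ← pow_succ',
          Nat.sub_add_cancel (P.serreOrder_spec h).1, mul_inv_cancel₀ (pow_ne_zero _ hv), one_pow]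

/-- Since J'_i is central, only K'_i contributes: k = v_i^(-2), r = v^(-i·j) β(j, i), r' = v^(-i·j)
β(i, j), and the condition is the inverse of the one for the positive half. -/
theorem isSkewPrimitive_serreMinus {i j : I} (h : i ≠ j) :
    IsSkewPrimitive P.hopfFreeMinus (P.iotaMinus (P.serreElement i j)).unop
      (P.genMinus (.T (.J j)) * P.genMinus (.T (.J i)) ^ P.serreOrder i j)
      (P.genMinus (.T (.Jinv i)) ^ P.serreOrder i j * P.genMinus (.T (.Jinv j)))
      (P.genMinus (.T (.K j)) * P.genMinus (.T (.K i)) ^ P.serreOrder i j)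
      (P.genMinus (.T (.Kinv i)) ^ P.serreOrder i j * P.genMinus (.T (.Kinv j))) := by
  rw [serreElement_map_op]
  refine IsSkewPrimitive.smul ?_ _
  have h1 : (P.iotaMinus (FreeAlgebra.ι F i)).unop = P.genMinus (.X i) := by simp [iotaMinus]
  have h2 : (P.iotaMinus (FreeAlgebra.ι F j)).unop = P.genMinus (.X j) := by simp [iotaMinus]
  rw [h1, h2]
  refine Half.isSkewPrimitive_iterAd _ _ .J .K i j _ ?_ ?_ ?_
  · simp only [Half.char, inv_one, one_mul]
    rw [angle_mul_ξ_inv, P.β_diag, mul_one, inv_pow, vi_sq]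
  · simp only [Half.char, inv_one, one_mul]
    rw [angle_mul_ξ_inv, P.cartan.symm j i, v_zpow_dot P h, inv_inv]
    simp only [mul_inv, inv_inv, inv_pow]
    ring
  · simp only [Half.char, inv_one, one_mul]
    rw [angle_mul_ξ_inv, v_zpow_dot P h, inv_inv]
    have hv := P.vi_ne_zero i
    calc _ = ((P.vi i * (P.vi i ^ P.serreOrder i j)⁻¹ *
          P.vi i ^ (P.serreOrder i j - 1)) ^ 2)⁻¹ * (P.β.at i j * P.β.at j i) := by
          simp only [mul_inv, inv_inv, inv_pow, mul_pow]; ring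
      _ = 1 := by
        rw [mul_right_comm, P.β_mul, mul_one, ← pow_succ',
          Nat.sub_add_cancel (P.serreOrder_spec h).1, mul_inv_cancel₀ (pow_ne_zero _ hv), one_pow,
          inv_one]

theorem serrePlus_isSkewPrimitive (x y : P.FreePlus) (h : P.SerrePlus x y) :
    y = 0 ∧ ∃ a a' b b', IsSkewPrimitive P.hopfFreePlus x a a' b b' := by
  cases h with
  | mk i j h => exact ⟨rfl, _, _, _, _, P.isSkewPrimitive_serrePlus h⟩

theorem serreMinus_isSkewPrimitive (x y : P.FreeMinus) (h : P.SerreMinus x y) :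
    y = 0 ∧ ∃ a a' b b', IsSkewPrimitive P.hopfFreeMinus x a a' b b' := by
  cases h with
  | mk i j h => exact ⟨rfl, _, _, _, _, P.isSkewPrimitive_serreMinus h⟩

/-- The Hopf algebra structure on `FPlus`. -/
noncomputable def hopfPlus : HopfStructure F P.FPlus :=
  P.hopfFreePlus.quot P.serrePlus_isSkewPrimitive

/-- The Hopf algebra structure on `FMinus`. -/
noncomputable def hopfMinus : HopfStructure F P.FMinus :=
  P.hopfFreeMinus.quot P.serreMinus_isSkewPrimitive

theorem isHopfMap_toPlus : IsHopfMap P.hopfFreePlus P.hopfPlus P.toPlus :=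
  P.hopfFreePlus.isHopfMap_quot _

theorem isHopfMap_toMinus : IsHopfMap P.hopfFreeMinus P.hopfMinus P.toMinus :=
  P.hopfFreeMinus.isHopfMap_quot _

theorem isPlusHopf_hopfPlus : IsPlusHopf P.hopfPlus P.plus where
  E i := (Half.isSkewPrimitive_X _ _ _ _ i).map P.isHopfMap_toPlus
  K i := (Half.isGroupLikePair_T _ _ _ _ (.K i)).map P.isHopfMap_toPlus
  J i := (Half.isGroupLikePair_T _ _ _ _ (.J i)).map P.isHopfMap_toPlus

theorem isMinusHopf_hopfMinus : IsMinusHopf P.hopfMinus P.minus where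
  F i := (Half.isSkewPrimitive_X _ _ _ _ i).map P.isHopfMap_toMinus
  K i := (Half.isGroupLikePair_T _ _ _ _ (.K i)).map P.isHopfMap_toMinus
  J i := (Half.isGroupLikePair_T _ _ _ _ (.J i)).map P.isHopfMap_toMinus

theorem hopfMinus_antipode_bijective : Function.Bijective P.hopfMinus.antipode := by
  refine HopfStructure.quot_antipode_bijective _ _ (Half.antipode_bijective _ _ _ _) ?_
  intro x hx
  -- The right-hand index must be a variable for the case analysis on `SerreMinus`.
  generalize h0 : (0 : P.FreeMinus) = z at hx
  cases hx with
  | mk i j h =>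
    have hs := P.isSkewPrimitive_serreMinus h
    have ha := (Half.isGroupLikePair_T _ _ _ _ (.J j)).mul
      ((Half.isGroupLikePair_T _ _ _ _ (.J i)).pow (P.serreOrder i j)) (hA := P.hopfFreeMinus)
    have hb := (Half.isGroupLikePair_T _ _ _ _ (.K j)).mul
      ((Half.isGroupLikePair_T _ _ _ _ (.K i)).pow (P.serreOrder i j)) (hA := P.hopfFreeMinus)
    exact ⟨_, _, hs.antipode_neg_mul ha hb⟩

end DeformationDatum

/-! ### Vanishing criteria for twisted derivations. -/

namespace Half

attribute [local instance] Half.ring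

variable {I : Type u} {F : Type w} [Field F] {p q : I → I → F}

/-- Used for the functionals given by pairing with a skew-primitive element: vanishing on two
factors forces vanishing on the product, whatever the twists are. -/
theorem eq_zero_of_twistedDerivation (f : Half p q →ₗ[F] F) (g h : Half p q → F) (h1 : f 1 = 0)
    (hmul : ∀ y y', f (y * y') = f y * g y' + h y * f y') (hgen : ∀ x, f (gen p q x) = 0)
    (y : Half p q) : f y = 0 := by
  induction y using Half.induction with
  | grade0 r => rw [Algebra.algebraMap_eq_smul_one, map_smul, h1, smul_zero]
  | grade1 x => exact hgen x
  | mul a b ha hb => simp [hmul, ha, hb]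
  | add a b ha hb => simp [ha, hb]

/-- The antipode is an anti-homomorphism of coalgebras. -/
theorem comul_antipode (hp : ∀ i j, p i j ≠ 0) (hq : ∀ i j, q i j ≠ 0) (a b : I → TorusGen I)
    (y : Half p q) : comul p q a b ((hopf hp hq a b).antipode y) =
      TensorProduct.map (hopf hp hq a b).antipode (hopf hp hq a b).antipode
        (TensorProduct.comm F _ _ (comul p q a b y)) := by
  induction y using Half.induction with
  | grade0 r =>
    rw [Algebra.algebraMap_eq_smul_one]
    simp [HopfStructure.antipode_one, Algebra.TensorProduct.one_def]
  | grade1 g =>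
    rcases g with i | s
    · simp [hopf_antipode, mul_assoc, mul_add, add_mul, TensorProduct.neg_tmul,
        TensorProduct.tmul_neg]
      rw [← mul_assoc (T p q (a i).inv), T_inv_mul_T, one_mul, T_mul_T_inv, mul_one]
    · simp [hopf_antipode]
  | add x y hx hy => simp only [map_add, hx, hy]
  | mul x y hx hy =>
    rw [HopfStructure.antipode_mul, map_mul, hx, hy, map_mul]
    generalize comul p q a b x = z
    generalize comul p q a b y = z'
    induction z with
    | zero => simp
    | add c d hc hd => simp only [map_add, mul_add, add_mul, hc, hd]
    | tmul c d =>
      induction z' with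
      | zero => simp
      | add c d hc hd => simp only [map_add, mul_add, add_mul, hc, hd]
      | tmul e f => simp [HopfStructure.antipode_mul]

end Half

theorem iterAd_mem_ker {F A : Type*} [Field F] [Ring A] [Algebra F A] {τ : A →ₗ[F] F}
    (hτ : ∀ x y, τ (x * y) = τ x * τ y) {x y : A} (hx : τ x = 0) (hy : τ y = 0) (c : ℕ → F)
    (n : ℕ) : τ (iterAd x c n y) = 0 := by
  cases n with
  | zero => exact hy
  | succ n => simp [iterAd_succ, hτ, hx]

/-- After at least one step every term is a product with one factor x and one previous iterate. Both
twists kill x and the iterate, so each Leibniz term vanishes; the coefficients play no role. -/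
theorem iterAd_mem_ker_of_twistedDerivation {F A : Type*} [Field F] [Ring A] [Algebra F A]
    {f τ τ' : A →ₗ[F] F} (hτ : ∀ x y, τ (x * y) = τ x * τ y)
    (hτ' : ∀ x y, τ' (x * y) = τ' x * τ' y)
    (hf : ∀ x y, f (x * y) = f x * τ y + τ' x * f y) {x y : A} (hx : τ x = 0) (hy : τ y = 0)
    (hx' : τ' x = 0) (hy' : τ' y = 0) (c : ℕ → F) {n : ℕ} (hn : 0 < n) :
    f (iterAd x c n y) = 0 := by
  obtain ⟨n, rfl⟩ := Nat.exists_eq_succ_of_ne_zero hn.ne'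
  simp [iterAd_succ, hf, hx, hx', iterAd_mem_ker hτ hx hy, iterAd_mem_ker hτ' hx' hy']

/-! ### The form φ: compatibility with products, coproducts and antipodes. -/

namespace DeformationDatum

attribute [local instance] Half.ring

variable {I : Type u} {F : Type w} [Field F] [Algebra (RatFunc ℚ) F] [DecidableEq I]
variable (P : DeformationDatum I F)

/-- The operator `ρ⁺(x)`. -/
noncomputable def rho (x : P.FreePlus) : Module.End F P.FreeMinus := (P.rhoPlus x).unop

theorem phi_apply (x : P.FreePlus) (y : P.FreeMinus) :
    P.phi x y = Half.counit _ _ (P.rho x y) := rfl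

theorem rho_mul (x x' : P.FreePlus) (y : P.FreeMinus) :
    P.rho (x * x') y = P.rho x' (P.rho x y) := by simp [rho]

theorem rho_algebraMap (r : F) (y : P.FreeMinus) :
    P.rho (algebraMap F _ r) y = r • y := by simp [rho, Algebra.smul_def]

theorem rho_one (y : P.FreeMinus) : P.rho 1 y = y := by simp [rho]

theorem rho_add (x x' : P.FreePlus) : P.rho (x + x') = P.rho x + P.rho x' := by simp [rho]

theorem rho_X (j : I) : P.rho (P.genPlus (.X j)) = ((P.vi j)⁻¹ - P.vi j)⁻¹ • P.opS j := by
  simp [rho, rhoPlus]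

/-- The scalars by which the torus of `FreePlus` acts on `FreeMinus`. -/
noncomputable def torusUnit : TorusGen I → I → Fˣ
  | .K j => P.angleUnit j
  | .Kinv j => (P.angleUnit j)⁻¹
  | .J j => P.ξUnit j
  | .Jinv j => (P.ξUnit j)⁻¹

theorem torusUnit_inv (s : TorusGen I) : P.torusUnit s.inv = (P.torusUnit s)⁻¹ := by
  cases s <;> simp [torusUnit, TorusGen.inv]

theorem rho_T (s : TorusGen I) (y : P.FreeMinus) :
    P.rho (P.genPlus (.T s)) y = Half.scale (P.torusUnit s) y := by
  cases s <;> simp [rho, rhoPlus, opK, opKinv, opJ, opJinv, torusUnit]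

/-- The action of `FreePlus ⊗ FreePlus` on `FreeMinus ⊗ FreeMinus`. -/
noncomputable def rhoTensor :
    P.FreePlus ⊗[F] P.FreePlus →ₗ[F] Module.End F (P.FreeMinus ⊗[F] P.FreeMinus) :=
  TensorProduct.homTensorHomMap (.id F) _ _ _ _ ∘ₗ
    TensorProduct.map
      ((MulOpposite.opLinearEquiv F).symm.toLinearMap ∘ₗ P.rhoPlus.toLinearMap)
      ((MulOpposite.opLinearEquiv F).symm.toLinearMap ∘ₗ P.rhoPlus.toLinearMap)

@[simp] theorem rhoTensor_tmul (x x' : P.FreePlus) :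
    P.rhoTensor (x ⊗ₜ x') = TensorProduct.map (P.rho x) (P.rho x') := rfl

theorem rhoTensor_mul (z z' : P.FreePlus ⊗[F] P.FreePlus) (w : P.FreeMinus ⊗[F] P.FreeMinus) :
    P.rhoTensor (z * z') w = P.rhoTensor z' (P.rhoTensor z w) := by
  induction z with
  | zero => simp
  | add a b ha hb => simp only [add_mul, map_add, LinearMap.add_apply, ha, hb]
  | tmul a b =>
    induction z' with
    | zero => simp
    | add a b ha hb => simp only [mul_add, map_add, LinearMap.add_apply, ha, hb]
    | tmul c d =>
      induction w with
      | zero => simp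
      | add a b ha hb => simp only [map_add, ha, hb]
      | tmul e f => simp [rho_mul]

/-- For E_j this is the twisted Leibniz rule of 𝒮_j, which mirrors E_j ⊗ J_j + K_j ⊗ E_j; for the
torus it says that `Half.scale` is multiplicative. Both sides reverse products in x, so generators
suffice. -/
theorem rho_mul_apply (x : P.FreePlus) (w : P.FreeMinus ⊗[F] P.FreeMinus) :
    P.rho x (LinearMap.mul' F _ w) =
      LinearMap.mul' F _ (P.rhoTensor (P.hopfFreePlus.comul x) w) := by
  induction x using Half.induction generalizing w with
  | grade0 r =>
    rw [rho_algebraMap, Algebra.algebraMap_eq_smul_one, map_smul, map_one,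
      Algebra.TensorProduct.one_def, map_smul, rhoTensor_tmul]
    induction w with
    | zero => simp
    | add a b ha hb => simp only [map_add, smul_add, ha, hb]
    | tmul a b => simp [rho_one]
  | grade1 g =>
    rcases g with i | s
    · rw [Half.hopf_comul, Half.comul_X, map_add, rhoTensor_tmul, rhoTensor_tmul]
      induction w with
      | zero => simp
      | add a b ha hb => simp only [map_add, ha, hb]
      | tmul a b => simp [rho_X, rho_T, opS_mul, torusUnit, opK, opJ]
    · rw [Half.hopf_comul, Half.comul_T, rhoTensor_tmul]
      induction w with
      | zero => simp
      | add a b ha hb => simp only [map_add, ha, hb]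
      | tmul a b => simp [rho_T]
  | add a b ha hb => simp [rho_add, ha, hb]
  | mul a b ha hb => rw [rho_mul, ha, hb, map_mul, rhoTensor_mul]

theorem phi_mul_right (x : P.FreePlus) (y y' : P.FreeMinus) : P.phi x (y * y') =
    tensorPairing P.phi (P.hopfFreePlus.comul x ⊗ₜ[F] (y ⊗ₜ[F] y')) := by
  have h := P.rho_mul_apply x (y ⊗ₜ y')
  rw [LinearMap.mul'_apply] at h
  rw [phi_apply, h]
  generalize P.hopfFreePlus.comul x = z
  clear h
  induction z with
  | zero => simp
  | add a b ha hb => simp only [map_add, TensorProduct.add_tmul, LinearMap.add_apply, ha, hb]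
  | tmul a b => simp [tensorPairing, phi_apply]

/-- The projection of `FreeMinus` which sends the central elements `J'_i` to `1`. -/
noncomputable def projJ : P.FreeMinus →ₐ[F] P.FreeMinus :=
  Half.lift (fun g => match g with
      | .X i => P.genMinus (.X i)
      | .T (.K i) => P.genMinus (.T (.K i))
      | .T (.Kinv i) => P.genMinus (.T (.Kinv i))
      | .T (.J _) => 1
      | .T (.Jinv _) => 1)
    (fun s t => by
      rcases s with i | i | i | i <;> rcases t with j | j | j | j <;> simp [Half.comm])
    (fun i => by simp [Half.K_inv]) (by simp) (fun i j => Half.K_X i j) (by simp)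

theorem counit_projJ (y : P.FreeMinus) : Half.counit _ _ (P.projJ y) = Half.counit _ _ y := by
  have : (Half.counit _ _).comp P.projJ = Half.counit _ _ := by
    refine Half.algHom_ext fun g => ?_
    rcases g with i | (i | i | i | i) <;> simp [projJ]
  exact DFunLike.congr_fun this y

theorem projJ_scale (c : I → Fˣ) (y : P.FreeMinus) :
    P.projJ (Half.scale c y) = Half.scale c (P.projJ y) := by
  have : P.projJ.comp (Half.scale c) = (Half.scale c).comp P.projJ := by
    refine Half.algHom_ext fun g => ?_
    rcases g with i | (i | i | i | i) <;> simp [projJ, Half.weight]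
  exact DFunLike.congr_fun this y

theorem projJ_opS (j : I) (y : P.FreeMinus) : P.projJ (P.opS j y) = P.opS j (P.projJ y) := by
  induction y using Half.induction with
  | grade0 r => simp [opS_algebraMap]
  | grade1 g =>
    have h1 : P.opS j 1 = 0 := by simpa using P.opS_algebraMap j 1
    rcases g with i | (i | i | i | i)
    · simp only [projJ, Half.lift_gen, opS_F]
      split_ifs <;> simp
    all_goals simp [projJ, opS_T, h1]
  | mul a b ha hb => simp only [opS_mul, map_add, map_mul, ha, hb, opK, opJ, projJ_scale]
  | add a b ha hb => simp [ha, hb]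

theorem projJ_rho (x : P.FreePlus) (y : P.FreeMinus) :
    P.projJ (P.rho x y) = P.rho x (P.projJ y) := by
  induction x using Half.induction generalizing y with
  | grade0 r => simp [rho_algebraMap]
  | grade1 g =>
    rcases g with i | s
    · simp [rho_X, projJ_opS]
    · simp [rho_T, projJ_scale]
  | mul a b ha hb => simp [rho_mul, ha, hb]
  | add a b ha hb => simp [rho_add, ha, hb]

/-- The map `(π ⊗ 1) ∘ Δ`, where `π` is `projJ`. -/
noncomputable def comulJ : P.FreeMinus →ₐ[F] P.FreeMinus ⊗[F] P.FreeMinus :=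
  (Algebra.TensorProduct.map P.projJ (AlgHom.id F _)).comp P.hopfFreeMinus.comul

/-- In each term of Δ on a generator the second leg carries the full weight. This is why
`Half.scale` rescales K'_i together with F_i and leaves J'_i alone. -/
theorem comulJ_scale (c : I → Fˣ) (y : P.FreeMinus) : P.comulJ (Half.scale c y) =
    TensorProduct.map LinearMap.id (Half.scale c).toLinearMap (P.comulJ y) := by
  have : P.comulJ.comp (Half.scale c) =
      (Algebra.TensorProduct.map (AlgHom.id F _) (Half.scale c)).comp P.comulJ := by
    refine Half.algHom_ext fun g => ?_
    rcases g with i | (i | i | i | i) <;>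
      simp [comulJ, Half.weight, projJ, TensorProduct.tmul_smul]
  exact DFunLike.congr_fun this y

/-- On F_j the operator 1 ⊗ 𝒮_j produces J'_j ⊗ ξ(j, j), whereas Δ(𝒮_j F_j) is ξ(j, j) 1 ⊗ 1. The
two agree only after J'_j is set to 1 in the first leg, which is the reason for `projJ`. -/
theorem comulJ_opS (j : I) (y : P.FreeMinus) : P.comulJ (P.opS j y) =
    TensorProduct.map LinearMap.id (P.opS j) (P.comulJ y) := by
  induction y using Half.induction with
  | grade0 r => simp [opS_algebraMap, Algebra.TensorProduct.algebraMap_apply,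
      show P.opS j 1 = 0 by simpa using P.opS_algebraMap j 1]
  | grade1 g =>
    rcases g with i | s
    · simp only [comulJ, opS_F, AlgHom.comp_apply, Half.hopf_comul, Half.comul_X, map_add,
        Algebra.TensorProduct.map_tmul, AlgHom.id_apply, TensorProduct.map_tmul, LinearMap.id_apply,
        opS_T, TensorProduct.tmul_zero, zero_add]
      split_ifs
      · have hJ : P.projJ (Half.T _ _ (.J i)) = 1 := by simp [projJ]
        rw [hJ, ← AlgHom.comp_apply, AlgHom.commutes, Algebra.TensorProduct.algebraMap_apply,
          Algebra.algebraMap_eq_smul_one, TensorProduct.tmul_smul,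
          TensorProduct.smul_tmul']
      · simp
    · simp [comulJ, opS_T]
  | add a b ha hb => simp [ha, hb]
  | mul a b ha hb =>
    rw [opS_mul, map_add, map_mul, map_mul, ha, hb, opJ, opK, comulJ_scale, comulJ_scale, map_mul]
    generalize P.comulJ a = z
    generalize P.comulJ b = z'
    induction z with
    | zero => simp
    | add c d hc hd =>
      simp only [map_add, add_mul] at hc hd ⊢
      rw [← hc, ← hd]; abel
    | tmul c d =>
      induction z' with
      | zero => simp
      | add c d hc hd =>
        simp only [map_add, mul_add] at hc hd ⊢
        rw [← hc, ← hd]; abel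
      | tmul e f => simp [opS_mul, TensorProduct.tmul_add, opK, opJ]

theorem comulJ_rho (x : P.FreePlus) (y : P.FreeMinus) : P.comulJ (P.rho x y) =
    TensorProduct.map LinearMap.id (P.rho x) (P.comulJ y) := by
  have hadd : ∀ (f g : Module.End F P.FreeMinus) (z : P.FreeMinus ⊗[F] P.FreeMinus),
      TensorProduct.map LinearMap.id (f + g) z =
        TensorProduct.map LinearMap.id f z + TensorProduct.map LinearMap.id g z := by
    intro f g z; rw [TensorProduct.map_add_right]; rfl
  induction x using Half.induction generalizing y with
  | grade0 r =>
    have : P.rho (algebraMap F _ r) = r • LinearMap.id := by ext y; simp [rho_algebraMap]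
    simp [this, TensorProduct.map_smul_right]
  | grade1 g =>
    rcases g with i | s
    · simp [rho_X, comulJ_opS, TensorProduct.map_smul_right]
    · have : P.rho (P.genPlus (.T s)) = (Half.scale (P.torusUnit s)).toLinearMap := by
        ext y; simp [rho_T]
      rw [this, AlgHom.toLinearMap_apply, comulJ_scale]
  | mul a b ha hb =>
    have : P.rho (a * b) = P.rho b ∘ₗ P.rho a := by ext y; simp [rho_mul]
    rw [rho_mul, hb, ha, this, ← LinearMap.id_comp (LinearMap.id (R := F) (M := P.FreeMinus)),
      TensorProduct.map_comp]
    rfl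
  | add a b ha hb => simp [rho_add, ha, hb, hadd]

/-- φ(x x', y) = φ(x', ρ(x) y). Up to `projJ`, ρ(x) y is recovered by applying 1 ⊗ ε to its
coproduct, where ρ(x) acts on the second leg. This yields ∑ φ(x', y₁) φ(x, y₂), with the legs of y
exchanged. -/
theorem phi_mul_left (x x' : P.FreePlus) (y : P.FreeMinus) : P.phi (x * x') y =
    tensorPairing P.phi ((x ⊗ₜ[F] x') ⊗ₜ[F]
      TensorProduct.comm F _ _ (P.hopfFreeMinus.comul y)) := by
  -- The form does not see the J'_i, so the projection used in `comulJ` is harmless.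
  have hπ : ∀ x y, P.phi x (P.projJ y) = P.phi x y := by
    intro x y; rw [phi_apply, ← projJ_rho, counit_projJ, phi_apply]
  have key : ∀ z : P.FreeMinus, TensorProduct.map LinearMap.id (Half.counit _ _).toLinearMap
      (P.comulJ z) = P.projJ z ⊗ₜ 1 := by
    intro z
    have := congrArg (TensorProduct.map P.projJ.toLinearMap LinearMap.id)
      (P.hopfFreeMinus.counit_right_apply z)
    rw [comulJ, AlgHom.comp_apply]
    generalize P.hopfFreeMinus.comul z = w at this
    convert this using 1
    · clear this
      induction w with
      | zero => simp
      | add a b ha hb => simp only [map_add, ha, hb]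
      | tmul a b => simp
    · simp
  have h1 := congrArg (LinearMap.mul' F F ∘ₗ TensorProduct.map (P.phi x') LinearMap.id)
    (key (P.rho x y))
  rw [phi_apply, rho_mul, ← phi_apply, ← hπ]
  rw [comulJ_rho, comulJ, AlgHom.comp_apply] at h1
  simp only [LinearMap.comp_apply, TensorProduct.map_tmul, LinearMap.mul'_apply,
    LinearMap.id_apply, mul_one] at h1
  rw [← h1]
  generalize P.hopfFreeMinus.comul y = z
  clear h1
  induction z with
  | zero => simp
  | add a b ha hb => simp only [map_add, TensorProduct.tmul_add, ha, hb]
  | tmul a b => simp [tensorPairing, hπ, ← phi_apply, mul_comm]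

theorem phi_one_left (y : P.FreeMinus) : P.phi 1 y = Half.counit _ _ y := by
  rw [phi_apply, rho_one]

theorem phi_one_right (x : P.FreePlus) : P.phi x 1 = Half.counit _ _ x := by
  have hS : ∀ j, P.opS j 1 = 0 := fun j => by simpa using P.opS_algebraMap j 1
  have hmul : ∀ x x' : P.FreePlus, P.phi (x * x') 1 = P.phi x 1 * P.phi x' 1 := by
    intro x x'
    rw [phi_mul_left, map_one, Algebra.TensorProduct.one_def]
    simp [tensorPairing]
  induction x using Half.induction with
  | grade0 r => rw [Algebra.algebraMap_eq_smul_one]; simp [phi_one_left]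
  | grade1 g =>
    rcases g with i | s
    · simp [phi_apply, rho_X, hS]
    · simp [phi_apply, rho_T]
  | mul a b ha hb => rw [hmul, ha, hb, map_mul]
  | add a b ha hb => simp [ha, hb]

theorem phi_T_T (s t : TorusGen I) : P.phi (P.genPlus (.T s)) (P.genMinus (.T t)) =
    Half.weight (P.torusUnit s) (.T t) := by
  simp [phi_apply, rho_T]

theorem phi_T_F (s : TorusGen I) (i : I) :
    P.phi (P.genPlus (.T s)) (P.genMinus (.X i)) = 0 := by
  simp [phi_apply, rho_T]

theorem phi_E_T (i : I) (s : TorusGen I) :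
    P.phi (P.genPlus (.X i)) (P.genMinus (.T s)) = 0 := by
  simp [phi_apply, rho_X, opS_T]

theorem phi_E_F (i j : I) : P.phi (P.genPlus (.X i)) (P.genMinus (.X j)) =
    if j = i then ((P.vi i)⁻¹ - P.vi i)⁻¹ * P.ξ.at j i else 0 := by
  simp only [phi_apply, rho_X, LinearMap.smul_apply, opS_F]
  split_ifs <;> simp

theorem phi_T_mul (s : TorusGen I) (y y' : P.FreeMinus) : P.phi (P.genPlus (.T s)) (y * y') =
    P.phi (P.genPlus (.T s)) y * P.phi (P.genPlus (.T s)) y' := by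
  simp [phi_mul_right, tensorPairing]

theorem phi_E_mul (i : I) (y y' : P.FreeMinus) : P.phi (P.genPlus (.X i)) (y * y') =
    P.phi (P.genPlus (.X i)) y * P.phi (P.genPlus (.T (.J i))) y' +
      P.phi (P.genPlus (.T (.K i))) y * P.phi (P.genPlus (.X i)) y' := by
  simp [phi_mul_right, tensorPairing, TensorProduct.add_tmul]

theorem phi_mul_T (s : TorusGen I) (x x' : P.FreePlus) : P.phi (x * x') (P.genMinus (.T s)) =
    P.phi x (P.genMinus (.T s)) * P.phi x' (P.genMinus (.T s)) := by
  simp [phi_mul_left, tensorPairing]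

theorem phi_mul_F (i : I) (x x' : P.FreePlus) : P.phi (x * x') (P.genMinus (.X i)) =
    P.phi x (P.genMinus (.X i)) * P.phi x' (P.genMinus (.T (.J i))) +
      P.phi x (P.genMinus (.T (.K i))) * P.phi x' (P.genMinus (.X i)) := by
  rw [add_comm]
  simp [phi_mul_left, tensorPairing, TensorProduct.tmul_add]

/-- Skew-primitivity makes the pairing a twisted derivation in y, so y may be a generator. Pairing
with a torus element is multiplicative in x and kills every E_l. Pairing with F_l is a twisted
derivation whose twists kill every E_l, so it vanishes on an iterated commutator with at least one
step. -/
theorem phi_serrePlus {i j : I} (h : i ≠ j) (y : P.FreeMinus) :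
    P.phi (P.iotaPlus (P.serreElement i j)) y = 0 := by
  have hs := P.isSkewPrimitive_serrePlus h
  refine Half.eq_zero_of_twistedDerivation (P.phi _)
    (P.phi (P.genPlus (.T (.J j)) * P.genPlus (.T (.J i)) ^ P.serreOrder i j))
    (P.phi (P.genPlus (.T (.K j)) * P.genPlus (.T (.K i)) ^ P.serreOrder i j)) ?_ ?_ ?_ y
  · rw [phi_one_right]; exact hs.counit
  · intro y y'
    rw [phi_mul_right, hs.comul]
    simp [tensorPairing, TensorProduct.add_tmul]
  · intro g
    rw [serreElement_map, map_smul, LinearMap.smul_apply, smul_eq_zero]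
    right
    rw [show P.iotaPlus (FreeAlgebra.ι F i) = P.genPlus (.X i) by simp [iotaPlus],
      show P.iotaPlus (FreeAlgebra.ι F j) = P.genPlus (.X j) by simp [iotaPlus]]
    rcases g with l | s
    · exact iterAd_mem_ker_of_twistedDerivation (f := P.phi.flip (P.genMinus (.X l)))
        (τ := P.phi.flip (P.genMinus (.T (.J l)))) (τ' := P.phi.flip (P.genMinus (.T (.K l))))
        (P.phi_mul_T _) (P.phi_mul_T _) (P.phi_mul_F l) (P.phi_E_T _ _) (P.phi_E_T _ _)
        (P.phi_E_T _ _) (P.phi_E_T _ _) _ (P.serreOrder_spec h).1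
    · exact iterAd_mem_ker (τ := P.phi.flip (P.genMinus (.T s))) (P.phi_mul_T s) (P.phi_E_T _ _)
        (P.phi_E_T _ _) _ _

theorem phi_serreMinus {i j : I} (h : i ≠ j) (x : P.FreePlus) :
    P.phi x (P.iotaMinus (P.serreElement i j)).unop = 0 := by
  have hs := P.isSkewPrimitive_serreMinus h
  refine Half.eq_zero_of_twistedDerivation (P.phi.flip _)
    (P.phi.flip (P.genMinus (.T (.J j)) * P.genMinus (.T (.J i)) ^ P.serreOrder i j))
    (P.phi.flip (P.genMinus (.T (.K j)) * P.genMinus (.T (.K i)) ^ P.serreOrder i j)) ?_ ?_ ?_ x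
  · rw [LinearMap.flip_apply, phi_one_left]; exact hs.counit
  · intro x x'
    rw [LinearMap.flip_apply, phi_mul_left, hs.comul]
    rw [add_comm]
    simp only [tensorPairing, TensorProduct.tmul_add, LinearMap.comp_apply, map_add,
      TensorProduct.comm_tmul, LinearEquiv.coe_coe, TensorProduct.tensorTensorTensorComm_tmul,
      TensorProduct.map_tmul, TensorProduct.lift.tmul, LinearMap.mul'_apply, LinearMap.flip_apply]
  · intro g
    rw [LinearMap.flip_apply, serreElement_map_op, map_smul, smul_eq_zero]
    right
    rw [show (P.iotaMinus (FreeAlgebra.ι F i)).unop = P.genMinus (.X i) by simp [iotaMinus],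
      show (P.iotaMinus (FreeAlgebra.ι F j)).unop = P.genMinus (.X j) by simp [iotaMinus]]
    rcases g with l | s
    · exact iterAd_mem_ker_of_twistedDerivation (f := P.phi (P.genPlus (.X l)))
        (τ := P.phi (P.genPlus (.T (.J l)))) (τ' := P.phi (P.genPlus (.T (.K l))))
        (P.phi_T_mul _) (P.phi_T_mul _) (P.phi_E_mul l) (P.phi_T_F _ _) (P.phi_T_F _ _)
        (P.phi_T_F _ _) (P.phi_T_F _ _) _ (P.serreOrder_spec h).1
    · exact iterAd_mem_ker (τ := P.phi (P.genPlus (.T s))) (P.phi_T_mul s) (P.phi_T_F _ _)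
        (P.phi_T_F _ _) _ _

/-- Unless both arguments are E, F or both are torus elements, each side is zero. Two torus elements
are both inverted, which leaves the bicharacter unchanged. -/
theorem phi_antipode_gen (g h : HalfGen I) : P.phi (P.hopfFreePlus.antipode (P.genPlus g))
    (P.hopfFreeMinus.antipode (P.genMinus h)) = P.phi (P.genPlus g) (P.genMinus h) := by
  simp only [Half.hopf_antipode]
  rcases g with i | s <;> rcases h with j | t
  -- K_i⁻¹ rescales F_i and K_i'⁻¹ by inverse factors. The factor ξ⁻¹ that 𝒥_i puts on K_i'⁻¹ is
  -- undone by J_i⁻¹.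
  · simp [phi_apply, rho_mul, rho_X, rho_T, opS_mul, opS_T, opS_F, opJ, opK]
    split_ifs with h
    · subst h
      have h1 := P.ξ_ne_zero j j
      have h2 := P.angle_ne_zero j j
      simp [TorusGen.inv, torusUnit, Half.weight, angleUnit, ξUnit]
      left
      field_simp
    · simp
  · simp [phi_mul_T, phi_E_T]
  · simp [phi_T_mul, phi_T_F]
  · simp only [Half.antipode_T, MulOpposite.unop_op, phi_T_T, torusUnit_inv]
    rcases t with j | j | j | j <;> simp [Half.weight, TorusGen.inv]

/-- Both antipodes reverse products and coproducts, so the two reversals match in the expansions of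
φ on products and the identity spreads from generators, in y and in x. -/
theorem phi_antipode (x : P.FreePlus) (y : P.FreeMinus) :
    P.phi (P.hopfFreePlus.antipode x) (P.hopfFreeMinus.antipode y) = P.phi x y := by
  induction x using Half.induction generalizing y with
  | grade0 r =>
    rw [Algebra.algebraMap_eq_smul_one, map_smul, HopfStructure.antipode_one, map_smul,
      LinearMap.smul_apply, LinearMap.smul_apply, phi_one_left, phi_one_left]
    -- What remains for scalar x is ε ∘ S = ε.
    congr 1
    induction y using Half.induction with
    | grade0 r =>
      rw [Algebra.algebraMap_eq_smul_one, map_smul, HopfStructure.antipode_one]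
    | grade1 g => rcases g with i | s <;> simp [Half.hopf_antipode]
    | mul a b ha hb => rw [HopfStructure.antipode_mul, map_mul, ha, hb, map_mul, mul_comm]
    | add a b ha hb => simp only [map_add, ha, hb]
  | grade1 g =>
    induction y using Half.induction generalizing g with
    | grade0 r =>
      rw [Algebra.algebraMap_eq_smul_one, map_smul, HopfStructure.antipode_one, map_smul, map_smul,
        phi_one_right, phi_one_right]
      rcases g with i | s <;> simp [Half.hopf_antipode]
    | grade1 h => exact P.phi_antipode_gen g h
    | add a b ha hb => simp only [map_add, ha, hb]
    | mul a b ha hb =>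
      rw [HopfStructure.antipode_mul, phi_mul_right, Half.hopf_comul, Half.comul_antipode]
      rcases g with i | s
      · simp [tensorPairing, TensorProduct.add_tmul, ha, hb, phi_E_mul]
        ring
      · simp [tensorPairing, ha, hb, phi_T_mul, mul_comm]
  | add a b ha hb => simp only [map_add, LinearMap.add_apply, ha, hb]
  | mul a b ha hb =>
    rw [HopfStructure.antipode_mul, phi_mul_left, Half.hopf_comul, Half.comul_antipode,
      phi_mul_left, Half.hopf_comul]
    generalize Half.comul _ _ _ _ y = z
    induction z with
    | zero => simp
    | add c d hc hd => simp only [map_add, TensorProduct.tmul_add, hc, hd]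
    | tmul c d => simp [tensorPairing, ha, hb, mul_comm]

end DeformationDatum

/-! ### Descent of φ to the pairing ψ. -/

/-- The kernel of the quotient map onto `RingQuot r` is the two-sided ideal generated by `r`. -/
theorem RingQuot.mem_of_mkAlgHom_eq_zero {R A : Type*} [CommRing R] [Ring A] [Algebra R A]
    (r : A → A → Prop) (M : AddSubgroup A) (hl : ∀ a, ∀ m ∈ M, a * m ∈ M)
    (hr : ∀ a, ∀ m ∈ M, m * a ∈ M) (h : ∀ x y, r x y → x - y ∈ M) {x : A}
    (hx : RingQuot.mkAlgHom R r x = 0) : x ∈ M := by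
  let J : TwoSidedIdeal A := TwoSidedIdeal.mk' M M.zero_mem M.add_mem M.neg_mem
    (fun {a m} hm => hl a m hm) (fun {m a} hm => hr a m hm)
  have hJ : ∀ x, x ∈ J ↔ x ∈ M := fun x => TwoSidedIdeal.mem_mk' _ _ _ _ _ _ _
  let g : RingQuot r →+* J.ringCon.Quotient := RingQuot.lift ⟨J.ringCon.mk', fun x y hxy =>
    J.ringCon.eq.2 ((J.rel_iff x y).2 ((hJ _).2 (h x y hxy)))⟩
  have hg : g (RingQuot.mkAlgHom R r x) = J.ringCon.mk' x := by
    rw [← AlgHom.coe_toRingHom, RingQuot.mkAlgHom_coe]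
    exact RingQuot.lift_mkRingHom_apply _ _ _
  rw [hx, map_zero] at hg
  exact (hJ x).1 (J.ringCon.eq.1 hg.symm)

/-- Over a field the surjections have linear sections; the kernel conditions make the value
independent of the section. -/
theorem exists_descent {F A B A' B' : Type*} [Field F] [AddCommGroup A] [Module F A]
    [AddCommGroup B] [Module F B] [AddCommGroup A'] [Module F A'] [AddCommGroup B'] [Module F B']
    (f : A →ₗ[F] B →ₗ[F] F) (p : A →ₗ[F] A') (q : B →ₗ[F] B') (hp : Function.Surjective p)
    (hq : Function.Surjective q) (hl : ∀ x, p x = 0 → ∀ y, f x y = 0)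
    (hr : ∀ y, q y = 0 → ∀ x, f x y = 0) :
    ∃ g : A' →ₗ[F] B' →ₗ[F] F, ∀ x y, g (p x) (q y) = f x y := by
  obtain ⟨s, hs⟩ := p.exists_rightInverse_of_surjective (LinearMap.range_eq_top.2 hp)
  obtain ⟨t, ht⟩ := q.exists_rightInverse_of_surjective (LinearMap.range_eq_top.2 hq)
  refine ⟨f.compl₁₂ s t, fun x y => ?_⟩
  have hs' : p (s (p x) - x) = 0 := by
    rw [map_sub, ← LinearMap.comp_apply, hs, LinearMap.id_apply, sub_self]
  have ht' : q (t (q y) - y) = 0 := by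
    rw [map_sub, ← LinearMap.comp_apply, ht, LinearMap.id_apply, sub_self]
  have h1 := hl _ hs' (t (q y))
  have h2 := hr _ ht' x
  rw [map_sub, LinearMap.sub_apply, sub_eq_zero] at h1
  rw [map_sub, sub_eq_zero] at h2
  rw [LinearMap.compl₁₂_apply, h1, h2]

namespace DeformationDatum

attribute [local instance] Half.ring

variable {I : Type u} {F : Type w} [Field F] [Algebra (RatFunc ℚ) F] [DecidableEq I]
variable (P : DeformationDatum I F)

theorem toPlus_surjective : Function.Surjective P.toPlus := RingQuot.mkAlgHom_surjective _ _

theorem toMinus_surjective : Function.Surjective P.toMinus := RingQuot.mkAlgHom_surjective _ _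

/-- By `phi_mul_left` the left radical of φ is a two-sided ideal, and it contains the Serre
elements. -/
theorem phi_eq_zero_of_toPlus {x : P.FreePlus} (hx : P.toPlus x = 0) (y : P.FreeMinus) :
    P.phi x y = 0 := by
  have hl : ∀ a m : P.FreePlus, (∀ y, P.phi m y = 0) → ∀ y, P.phi (a * m) y = 0 := by
    intro a m hm y
    rw [phi_mul_left]
    generalize P.hopfFreeMinus.comul y = z
    induction z with
    | zero => simp
    | add c d hc hd => simp only [map_add, TensorProduct.tmul_add, hc, hd, add_zero]
    | tmul c d => simp [tensorPairing, hm]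
  have hr : ∀ a m : P.FreePlus, (∀ y, P.phi m y = 0) → ∀ y, P.phi (m * a) y = 0 := by
    intro a m hm y
    rw [phi_mul_left]
    generalize P.hopfFreeMinus.comul y = z
    induction z with
    | zero => simp
    | add c d hc hd => simp only [map_add, TensorProduct.tmul_add, hc, hd, add_zero]
    | tmul c d => simp [tensorPairing, hm]
  refine LinearMap.congr_fun (f := P.phi x) (g := 0) ?_ y
  refine RingQuot.mem_of_mkAlgHom_eq_zero (R := F) P.SerrePlus
    (LinearMap.ker P.phi).toAddSubgroup (fun a m hm => ?_) (fun a m hm => ?_) ?_ hx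
  · exact LinearMap.ext fun y => hl a m (fun y => LinearMap.congr_fun hm y) y
  · exact LinearMap.ext fun y => hr a m (fun y => LinearMap.congr_fun hm y) y
  · rintro _ _ ⟨i, j, h⟩
    rw [sub_zero]
    exact LinearMap.ext fun y => P.phi_serrePlus h y

theorem phi_eq_zero_of_toMinus {y : P.FreeMinus} (hy : P.toMinus y = 0) (x : P.FreePlus) :
    P.phi x y = 0 := by
  have hl : ∀ a m : P.FreeMinus, (∀ x, P.phi x m = 0) → ∀ x, P.phi x (a * m) = 0 := by
    intro a m hm x
    rw [phi_mul_right]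
    generalize P.hopfFreePlus.comul x = z
    induction z with
    | zero => simp
    | add c d hc hd => simp only [map_add, TensorProduct.add_tmul, hc, hd, add_zero]
    | tmul c d => simp [tensorPairing, hm]
  have hr : ∀ a m : P.FreeMinus, (∀ x, P.phi x m = 0) → ∀ x, P.phi x (m * a) = 0 := by
    intro a m hm x
    rw [phi_mul_right]
    generalize P.hopfFreePlus.comul x = z
    induction z with
    | zero => simp
    | add c d hc hd => simp only [map_add, TensorProduct.add_tmul, hc, hd, add_zero]
    | tmul c d => simp [tensorPairing, hm]
  refine LinearMap.congr_fun (f := P.phi.flip y) (g := 0) ?_ x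
  refine RingQuot.mem_of_mkAlgHom_eq_zero (R := F) P.SerreMinus
    (LinearMap.ker P.phi.flip).toAddSubgroup (fun a m hm => ?_) (fun a m hm => ?_) ?_ hy
  · exact LinearMap.ext fun y => hl a m (fun y => LinearMap.congr_fun hm y) y
  · exact LinearMap.ext fun y => hr a m (fun y => LinearMap.congr_fun hm y) y
  · rintro _ _ ⟨i, j, h⟩
    rw [sub_zero]
    exact LinearMap.ext fun y => P.phi_serreMinus h y

theorem exists_psi : ∃ ψ : P.FPlus →ₗ[F] P.FMinus →ₗ[F] F,
    ∀ x y, ψ (P.toPlus x) (P.toMinus y) = P.phi x y :=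
  exists_descent P.phi P.toPlus.toLinearMap P.toMinus.toLinearMap P.toPlus_surjective
    P.toMinus_surjective (fun _ hx => P.phi_eq_zero_of_toPlus hx)
    (fun _ hy => P.phi_eq_zero_of_toMinus hy)

/-- The form induced by `φ` on the quotients by the Serre relations. -/
noncomputable def psi : P.FPlus →ₗ[F] P.FMinus →ₗ[F] F := P.exists_psi.choose

theorem psi_apply (x : P.FreePlus) (y : P.FreeMinus) :
    P.psi (P.toPlus x) (P.toMinus y) = P.phi x y := P.exists_psi.choose_spec x y

theorem tensorPairing_psi (z : P.FreePlus ⊗[F] P.FreePlus) (w : P.FreeMinus ⊗[F] P.FreeMinus) :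
    tensorPairing P.psi (TensorProduct.map P.toPlus.toLinearMap P.toPlus.toLinearMap z ⊗ₜ[F]
      TensorProduct.map P.toMinus.toLinearMap P.toMinus.toLinearMap w) =
    tensorPairing P.phi (z ⊗ₜ[F] w) := by
  induction z with
  | zero => simp
  | add a b ha hb => simp only [map_add, TensorProduct.add_tmul, ha, hb]
  | tmul a b =>
    induction w with
    | zero => simp
    | add c d hc hd => simp only [map_add, TensorProduct.tmul_add, hc, hd]
    | tmul c d => simp [tensorPairing, psi_apply]

theorem psi_antipode (x : P.FPlus) (y : P.FMinus) :
    P.psi (P.hopfPlus.antipode x) (P.hopfMinus.antipode y) = P.psi x y := by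
  obtain ⟨x, rfl⟩ := P.toPlus_surjective x
  obtain ⟨y, rfl⟩ := P.toMinus_surjective y
  rw [P.isHopfMap_toPlus.antipode, P.isHopfMap_toMinus.antipode, psi_apply, phi_antipode, psi_apply]

theorem isSkewHopfPairing_psi : IsSkewHopfPairing P.hopfPlus P.hopfMinus P.psi where
  one_left y := by
    obtain ⟨y, rfl⟩ := P.toMinus_surjective y
    rw [P.isHopfMap_toMinus.counit, ← map_one P.toPlus, psi_apply, phi_one_left]
    rfl
  one_right x := by
    obtain ⟨x, rfl⟩ := P.toPlus_surjective x
    rw [P.isHopfMap_toPlus.counit, ← map_one P.toMinus, psi_apply, phi_one_right]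
    rfl
  mul_right x y y' := by
    obtain ⟨x, rfl⟩ := P.toPlus_surjective x
    obtain ⟨y, rfl⟩ := P.toMinus_surjective y
    obtain ⟨y', rfl⟩ := P.toMinus_surjective y'
    rw [P.isHopfMap_toPlus.comul, ← map_mul, psi_apply, phi_mul_right, ← tensorPairing_psi]
    rfl
  mul_left x x' y := by
    obtain ⟨x, rfl⟩ := P.toPlus_surjective x
    obtain ⟨x', rfl⟩ := P.toPlus_surjective x'
    obtain ⟨y, rfl⟩ := P.toMinus_surjective y
    rw [P.isHopfMap_toMinus.comul, ← map_mul, psi_apply, phi_mul_left, ← tensorPairing_psi,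
      ← TensorProduct.map_comm]
    rfl
  antipode_bijective := P.hopfMinus_antipode_bijective
  antipode x y := by
    set e := LinearEquiv.ofBijective P.hopfMinus.antipode P.hopfMinus_antipode_bijective
    have : P.hopfMinus.antipode (e.symm y) = y := e.apply_symm_apply y
    -- With y = S(S⁻¹ y) the axiom becomes invariance of ψ under the pair of antipodes.
    conv_lhs => rw [← this]
    exact P.psi_antipode _ _

end DeformationDatum

/-! ### Coregular actions and the action of B on A ⊗ B that underlies the double. -/

section Hit

variable {R : Type u} [CommRing R] {A B : Type w} [Ring A] [Algebra R A] [Ring B] [Algebra R B]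

namespace HopfStructure

variable (hA : HopfStructure R A)

/-- The operator `x ↦ ∑ x₁ f(x₂)`. -/
noncomputable def hitRight : (A →ₗ[R] R) →ₗ[R] Module.End R A where
  toFun f := (TensorProduct.rid R A).toLinearMap ∘ₗ f.lTensor A ∘ₗ hA.comul.toLinearMap
  map_add' f g := by ext x; simp [LinearMap.lTensor_add]
  map_smul' c f := by ext x; simp [LinearMap.lTensor_smul]

/-- The operator `x ↦ ∑ f(x₁) x₂`. -/
noncomputable def hitLeft : (A →ₗ[R] R) →ₗ[R] Module.End R A where
  toFun f := (TensorProduct.lid R A).toLinearMap ∘ₗ f.rTensor A ∘ₗ hA.comul.toLinearMap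
  map_add' f g := by ext x; simp [LinearMap.rTensor_add]
  map_smul' c f := by ext x; simp [LinearMap.rTensor_smul]

/-- The convolution product of linear forms. -/
noncomputable def conv (f g : A →ₗ[R] R) : A →ₗ[R] R :=
  LinearMap.mul' R R ∘ₗ TensorProduct.map f g ∘ₗ hA.comul.toLinearMap

theorem hitRight_apply (f : A →ₗ[R] R) (x : A) :
    hA.hitRight f x = TensorProduct.rid R A (f.lTensor A (hA.comul x)) := rfl

theorem hitLeft_apply (f : A →ₗ[R] R) (x : A) :
    hA.hitLeft f x = TensorProduct.lid R A (f.rTensor A (hA.comul x)) := rfl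

theorem conv_apply (f g : A →ₗ[R] R) (x : A) :
    hA.conv f g x = LinearMap.mul' R R (TensorProduct.map f g (hA.comul x)) := rfl

/-- By coassociativity both sides are ∑ x₁ f(x₂) g(x₃). -/
theorem hitRight_conv (f g : A →ₗ[R] R) :
    hA.hitRight (hA.conv f g) = hA.hitRight f * hA.hitRight g := by
  ext x
  have h := congrArg ((TensorProduct.rid R A).toLinearMap ∘ₗ
    (LinearMap.mul' R R ∘ₗ TensorProduct.map f g).lTensor A) (hA.coassoc_apply x)
  rw [Module.End.mul_apply, hA.hitRight_apply g, hA.hitRight_apply (hA.conv f g)]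
  generalize hA.comul x = z at h
  transitivity ((TensorProduct.rid R A).toLinearMap ∘ₗ
    (LinearMap.mul' R R ∘ₗ TensorProduct.map f g).lTensor A) (hA.comul.toLinearMap.lTensor A z)
  · clear h
    induction z with
    | zero => simp
    | add a b ha hb => simp only [map_add, ha, hb]
    | tmul a b => simp [conv_apply]
  · rw [← h]
    clear h
    induction z with
    | zero => simp
    | add a b ha hb => simp only [map_add, ha, hb]
    | tmul a b =>
      simp only [LinearMap.lTensor_tmul, LinearMap.rTensor_tmul, TensorProduct.rid_tmul, map_smul,
        hitRight_apply, AlgHom.toLinearMap_apply]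
      generalize hA.comul a = z
      induction z with
      | zero => simp
      | add a b ha hb => simp only [map_add, TensorProduct.add_tmul, smul_add, ha, hb]
      | tmul a b => simp [smul_smul, mul_comm]

/-- Both sides are ∑ f(x₁) g(x₂) x₃; f consumes the outermost leg and must act before g, hence the
reversed order. -/
theorem hitLeft_conv (f g : A →ₗ[R] R) :
    hA.hitLeft (hA.conv f g) = hA.hitLeft g * hA.hitLeft f := by
  ext x
  have h := congrArg ((TensorProduct.lid R A).toLinearMap ∘ₗ
    (LinearMap.mul' R R ∘ₗ TensorProduct.map f g).rTensor A ∘ₗ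
      (TensorProduct.assoc R A A A).symm.toLinearMap) (hA.coassoc_apply x)
  rw [Module.End.mul_apply, hA.hitLeft_apply f, hA.hitLeft_apply (hA.conv f g)]
  generalize hA.comul x = z at h
  transitivity ((TensorProduct.lid R A).toLinearMap ∘ₗ
    (LinearMap.mul' R R ∘ₗ TensorProduct.map f g).rTensor A ∘ₗ
      (TensorProduct.assoc R A A A).symm.toLinearMap)
        (TensorProduct.assoc R A A A (hA.comul.toLinearMap.rTensor A z))
  · clear h
    induction z with
    | zero => simp
    | add a b ha hb => simp only [map_add, ha, hb]
    | tmul a b => simp [conv_apply]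
  · rw [h]
    clear h
    induction z with
    | zero => simp
    | add a b ha hb => simp only [map_add, ha, hb]
    | tmul a b =>
      simp only [LinearMap.lTensor_tmul, LinearMap.rTensor_tmul, TensorProduct.lid_tmul, map_smul,
        hitLeft_apply, AlgHom.toLinearMap_apply]
      generalize hA.comul b = z
      induction z with
      | zero => simp
      | add a b ha hb => simp only [map_add, TensorProduct.tmul_add, smul_add, ha, hb]
      | tmul a b => simp [smul_smul]

theorem hitLeft_hitRight (f g : A →ₗ[R] R) (x : A) : hA.hitLeft f (hA.hitRight g x) =
    TensorProduct.lid R A (TensorProduct.map f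
      ((TensorProduct.rid R A).toLinearMap ∘ₗ g.lTensor A) (hA.comul₂ x)) := by
  rw [hA.hitRight_apply]
  transitivity TensorProduct.lid R A (TensorProduct.map f
      ((TensorProduct.rid R A).toLinearMap ∘ₗ g.lTensor A)
      (TensorProduct.assoc R A A A (hA.comul.toLinearMap.rTensor A (hA.comul x))))
  · generalize hA.comul x = z
    induction z with
    | zero => simp
    | add a b ha hb => simp only [map_add, ha, hb]
    | tmul a b =>
      simp only [LinearMap.lTensor_tmul, LinearMap.rTensor_tmul, TensorProduct.rid_tmul, map_smul,
        hitLeft_apply, AlgHom.toLinearMap_apply]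
      generalize hA.comul a = z
      induction z with
      | zero => simp
      | add a b ha hb => simp only [map_add, TensorProduct.add_tmul, smul_add, ha, hb]
      | tmul a b => simp [smul_smul, mul_comm]
  · rw [hA.coassoc_apply]; rfl

theorem hitRight_hitLeft (f g : A →ₗ[R] R) (x : A) : hA.hitRight g (hA.hitLeft f x) =
    TensorProduct.lid R A (TensorProduct.map f
      ((TensorProduct.rid R A).toLinearMap ∘ₗ g.lTensor A) (hA.comul₂ x)) := by
  rw [hA.hitLeft_apply, comul₂, LinearMap.comp_apply, AlgHom.toLinearMap_apply]
  generalize hA.comul x = z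
  induction z with
  | zero => simp
  | add a b ha hb => simp only [map_add, ha, hb]
  | tmul a b =>
    simp only [LinearMap.lTensor_tmul, LinearMap.rTensor_tmul, TensorProduct.lid_tmul, map_smul,
      hitRight_apply, AlgHom.toLinearMap_apply, TensorProduct.map_tmul, LinearMap.comp_apply,
      LinearEquiv.coe_coe]

/-- The operators consume opposite ends of the iterated coproduct: either order gives ∑ f(x₁) x₂
g(x₃). -/
theorem hitLeft_commute_hitRight (f g : A →ₗ[R] R) :
    Commute (hA.hitLeft f) (hA.hitRight g) :=
  LinearMap.ext fun x => (hA.hitLeft_hitRight f g x).trans (hA.hitRight_hitLeft f g x).symm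

theorem hitRight_counit : hA.hitRight hA.counit.toLinearMap = 1 := by
  ext x
  have := congrArg (TensorProduct.rid R A) (hA.counit_right_apply x)
  rw [TensorProduct.rid_tmul, one_smul] at this
  exact this

theorem hitLeft_counit : hA.hitLeft hA.counit.toLinearMap = 1 := by
  ext x
  have := congrArg (TensorProduct.lid R A) (hA.counit_left_apply x)
  rw [TensorProduct.lid_tmul, one_smul] at this
  exact this

theorem hitRight_one (f : A →ₗ[R] R) : hA.hitRight f 1 = f 1 • 1 := by
  simp [hitRight_apply, Algebra.TensorProduct.one_def]

theorem hitLeft_one (f : A →ₗ[R] R) : hA.hitLeft f 1 = f 1 • 1 := by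
  simp [hitLeft_apply, Algebra.TensorProduct.one_def]

theorem counit_antipode (x : A) : hA.counit (hA.antipode x) = hA.counit x :=
  letI := hA.toHopfAlgebra
  HopfAlgebra.counit_antipode (R := R) x

end HopfStructure

namespace IsSkewHopfPairing

variable {hA : HopfStructure R A} {hB : HopfStructure R B} {ψ : A →ₗ[R] B →ₗ[R] R}

/-- The second argument of the pairing maps B multiplicatively into the convolution algebra of A;
this turns the two hit operators into actions of B. -/
theorem flip_mul (h : IsSkewHopfPairing hA hB ψ) (y y' : B) :
    ψ.flip (y * y') = hA.conv (ψ.flip y) (ψ.flip y') := by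
  ext x
  rw [LinearMap.flip_apply, h.mul_right, hA.conv_apply]
  generalize hA.comul x = z
  induction z with
  | zero => simp
  | add a b ha hb => simp only [map_add, TensorProduct.add_tmul, ha, hb]
  | tmul a b => simp [tensorPairing]

theorem flip_one (h : IsSkewHopfPairing hA hB ψ) : ψ.flip 1 = hA.counit.toLinearMap :=
  LinearMap.ext fun x => h.one_right x

/-- The algebra homomorphism `y ↦ (x ↦ ∑ x₁ ψ(x₂, y))`. -/
noncomputable def rightHom (h : IsSkewHopfPairing hA hB ψ) : B →ₐ[R] Module.End R A :=
  AlgHom.ofLinearMap (hA.hitRight ∘ₗ ψ.flip)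
    (by rw [LinearMap.comp_apply, h.flip_one, hA.hitRight_counit])
    (fun y y' => by
      rw [LinearMap.comp_apply, h.flip_mul, hA.hitRight_conv]; rfl)

/-- The algebra homomorphism `y ↦ (x ↦ ∑ ψ(x₁, S(y)) x₂)`. -/
noncomputable def leftHom (h : IsSkewHopfPairing hA hB ψ) : B →ₐ[R] Module.End R A :=
  AlgHom.ofLinearMap (hA.hitLeft ∘ₗ ψ.flip ∘ₗ hB.antipode)
    (by rw [LinearMap.comp_apply, LinearMap.comp_apply, hB.antipode_one, h.flip_one,
      hA.hitLeft_counit])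
    -- The reversal in `hitLeft_conv` cancels against that of the antipode.
    (fun y y' => by
      rw [LinearMap.comp_apply, LinearMap.comp_apply, hB.antipode_mul, h.flip_mul,
        hA.hitLeft_conv]; rfl)

theorem rightHom_apply (h : IsSkewHopfPairing hA hB ψ) (y : B) :
    h.rightHom y = hA.hitRight (ψ.flip y) := rfl

theorem leftHom_apply (h : IsSkewHopfPairing hA hB ψ) (y : B) :
    h.leftHom y = hA.hitLeft (ψ.flip (hB.antipode y)) := rfl

theorem leftHom_commute_rightHom (h : IsSkewHopfPairing hA hB ψ) (y y' : B) :
    Commute (h.leftHom y) (h.rightHom y') := hA.hitLeft_commute_hitRight _ _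

theorem commute_lmul_rightHom (h : IsSkewHopfPairing hA hB ψ) (y y' : B) :
    Commute ((Module.End.lTensorAlgHom R B A).comp (Algebra.lmul R B) y)
      ((Module.End.rTensorAlgHom R A B).comp h.rightHom y') :=
  TensorProduct.ext' fun x z =>
    show h.rightHom y' x ⊗ₜ[R] (y * z) = h.rightHom y' x ⊗ₜ[R] (y * z) from rfl

/-- The action of `B ⊗ B` on `A ⊗ B` by `y₂ ⊗ y₃ ↦ (x ⊗ z ↦ ∑ x₁ ψ(x₂, y₃) ⊗ y₂ z)`. -/
noncomputable def pairHom (h : IsSkewHopfPairing hA hB ψ) :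
    B ⊗[R] B →ₐ[R] Module.End R (A ⊗[R] B) :=
  Algebra.TensorProduct.lift ((Module.End.lTensorAlgHom R B A).comp (Algebra.lmul R B))
    ((Module.End.rTensorAlgHom R A B).comp h.rightHom) h.commute_lmul_rightHom

theorem pairHom_tmul (h : IsSkewHopfPairing hA hB ψ) (b c : B) (x : A) (z : B) :
    h.pairHom (b ⊗ₜ c) (x ⊗ₜ z) = h.rightHom c x ⊗ₜ (b * z) := by
  rw [pairHom, Algebra.TensorProduct.lift_tmul]
  rfl

theorem commute_leftHom_pairHom (h : IsSkewHopfPairing hA hB ψ) (y : B) (w : B ⊗[R] B) :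
    Commute ((Module.End.rTensorAlgHom R A B).comp h.leftHom y) (h.pairHom w) := by
  induction w with
  | zero => rw [map_zero]; exact Commute.zero_right _
  | add a b ha hb => rw [map_add]; exact ha.add_right hb
  | tmul a b =>
    refine TensorProduct.ext' fun x z => ?_
    have := LinearMap.congr_fun (h.leftHom_commute_rightHom y b).eq x
    rw [Module.End.mul_apply, Module.End.mul_apply, pairHom_tmul]
    exact (congrArg (· ⊗ₜ[R] (a * z)) this).trans (h.pairHom_tmul a b _ z).symm

/-- The action of `B ⊗ (B ⊗ B)` on `A ⊗ B` by
`y₁ ⊗ (y₂ ⊗ y₃) ↦ (x ⊗ z ↦ ∑ ψ(x₁, S(y₁)) x₂ ψ(x₃, y₃) ⊗ y₂ z)`. -/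
noncomputable def tripleHom (h : IsSkewHopfPairing hA hB ψ) :
    B ⊗[R] (B ⊗[R] B) →ₐ[R] Module.End R (A ⊗[R] B) :=
  Algebra.TensorProduct.lift ((Module.End.rTensorAlgHom R A B).comp h.leftHom) h.pairHom
    h.commute_leftHom_pairHom

@[simp] theorem tripleHom_tmul (h : IsSkewHopfPairing hA hB ψ) (a b c : B) (x : A) (z : B) :
    h.tripleHom (a ⊗ₜ (b ⊗ₜ c)) (x ⊗ₜ z) =
      h.leftHom a (h.rightHom c x) ⊗ₜ (b * z) := by
  rw [tripleHom, Algebra.TensorProduct.lift_tmul, Module.End.mul_apply, pairHom_tmul]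
  rfl

/-- The action of `B` on `A ⊗ B` by left multiplication in the Drinfeld double. -/
noncomputable def doubleHom (h : IsSkewHopfPairing hA hB ψ) :
    B →ₐ[R] Module.End R (A ⊗[R] B) :=
  h.tripleHom.comp ((Algebra.TensorProduct.map (AlgHom.id R B) hB.comul).comp hB.comul)

theorem doubleHom_apply (h : IsSkewHopfPairing hA hB ψ) (y : B) :
    h.doubleHom y = h.tripleHom (hB.comul₂ y) := rfl

theorem doubleHom_tmul_one (h : IsSkewHopfPairing hA hB ψ) (x : A) (y : B) :
    h.doubleHom y (x ⊗ₜ 1) = doubleCross hA hB ψ x y := by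
  rw [doubleHom_apply, doubleCross]
  generalize hB.comul₂ y = w
  induction w with
  | zero => simp
  | add a b ha hb => simp only [map_add, LinearMap.add_apply, TensorProduct.tmul_add, ha, hb]
  | tmul a w =>
    induction w with
    | zero => simp
    | add c b ha hb => simp only [map_add, LinearMap.add_apply, TensorProduct.tmul_add, ha, hb]
    | tmul b c =>
      rw [tripleHom_tmul, leftHom_apply, rightHom_apply, hA.hitLeft_hitRight, mul_one]
      generalize hA.comul₂ x = z
      induction z with
      | zero => simp
      | add a b ha hb => simp only [map_add, TensorProduct.add_tmul, ha, hb]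
      | tmul d z =>
        induction z with
        | zero => simp
        | add a b ha hb => simp only [map_add, TensorProduct.add_tmul, TensorProduct.tmul_add, ha, hb]
        | tmul e f => simp [doubleContraction, TensorProduct.smul_tmul', smul_smul, mul_comm]

/-- At x = 1 both pairings become counits, using ε ∘ S = ε, and these contract the outer legs of the
iterated coproduct of y. -/
theorem doubleHom_one_tmul_one (h : IsSkewHopfPairing hA hB ψ) (y : B) :
    h.doubleHom y (1 ⊗ₜ 1) = 1 ⊗ₜ y := by
  have key : ∀ w : B ⊗[R] (B ⊗[R] B), h.tripleHom w (1 ⊗ₜ 1) =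
      1 ⊗ₜ (TensorProduct.lid R B (TensorProduct.map hB.counit.toLinearMap
        ((TensorProduct.rid R B).toLinearMap ∘ₗ TensorProduct.map LinearMap.id
          hB.counit.toLinearMap) w)) := by
    intro w
    induction w with
    | zero => simp
    | add a b ha hb => simp only [map_add, LinearMap.add_apply, TensorProduct.tmul_add, ha, hb]
    | tmul a w =>
      induction w with
      | zero => simp
      | add c b ha hb => simp only [map_add, LinearMap.add_apply, TensorProduct.tmul_add, ha, hb]
      | tmul b c =>
        simp [leftHom_apply, rightHom_apply, HopfStructure.hitRight_one,
          HopfStructure.hitLeft_one, h.one_left, hB.counit_antipode, TensorProduct.smul_tmul,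
          smul_smul]
  rw [doubleHom_apply, key]
  congr 1
  have h1 := congrArg (TensorProduct.lid R B) (hB.counit_left_apply y)
  rw [TensorProduct.lid_tmul, one_smul] at h1
  rw [HopfStructure.comul₂, LinearMap.comp_apply, AlgHom.toLinearMap_apply]
  conv_rhs => rw [← h1]
  generalize hB.comul y = w
  clear h1
  induction w with
  | zero => simp
  | add a b ha hb => simp only [map_add, ha, hb]
  | tmul a b =>
    have h2 := congrArg (TensorProduct.rid R B) (hB.counit_right_apply b)
    rw [TensorProduct.rid_tmul, one_smul] at h2
    simp [h2]

theorem rightHom_mul (h : IsSkewHopfPairing hA hB ψ) (y : B) (x x' : A) :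
    h.rightHom y (x * x') = LinearMap.mul' R A (TensorProduct.map
      (h.rightHom.toLinearMap.flip x) (h.rightHom.toLinearMap.flip x')
      (TensorProduct.comm R B B (hB.comul y))) := by
  -- G contracts one leg of a tensor with y. Replacing Δ(x) and Δ(x') by arbitrary tensors reduces
  -- the claim to pure ones, where it is the rule for ψ on products in A.
  let G : A ⊗[R] A →ₗ[R] B →ₗ[R] A := (((TensorProduct.rid R A).toLinearMap.compRight R) ∘ₗ
    LinearMap.lTensorHom A ∘ₗ ψ.flip).flip
  have hG : ∀ a b y, G (a ⊗ₜ b) y = ψ b y • a := fun a b y => rfl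
  have key : ∀ z z', G (z * z') y =
      LinearMap.mul' R A (TensorProduct.map (G z) (G z') (TensorProduct.comm R B B (hB.comul y))) := by
    intro z z'
    induction z with
    | zero => simp
    | add a b ha hb =>
      rw [add_mul, map_add, map_add, LinearMap.add_apply, ha, hb, TensorProduct.map_add_left,
        LinearMap.add_apply, map_add]
    | tmul a b =>
      induction z' with
      | zero => simp
      | add a b ha hb =>
        rw [mul_add, map_add, map_add, LinearMap.add_apply, ha, hb, TensorProduct.map_add_right,
          LinearMap.add_apply, map_add]
      | tmul c d =>
        rw [Algebra.TensorProduct.tmul_mul_tmul, hG, h.mul_left]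
        generalize TensorProduct.comm R B B (hB.comul y) = w
        induction w with
        | zero => simp
        | add a b ha hb => simp only [TensorProduct.tmul_add, map_add, add_smul, ha, hb]
        | tmul e f => simp [tensorPairing, hG, smul_smul, mul_comm]
  have := key (hA.comul x) (hA.comul x')
  rw [← map_mul] at this
  exact this

theorem hitLeft_mul (h : IsSkewHopfPairing hA hB ψ) (y : B) (x x' : A) :
    hA.hitLeft (ψ.flip y) (x * x') = LinearMap.mul' R A (TensorProduct.map
      ((hA.hitLeft ∘ₗ ψ.flip).flip x) ((hA.hitLeft ∘ₗ ψ.flip).flip x')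
      (TensorProduct.comm R B B (hB.comul y))) := by
  let G : A ⊗[R] A →ₗ[R] B →ₗ[R] A := (((TensorProduct.lid R A).toLinearMap.compRight R) ∘ₗ
    LinearMap.rTensorHom A ∘ₗ ψ.flip).flip
  have hG : ∀ a b y, G (a ⊗ₜ b) y = ψ a y • b := fun a b y => rfl
  have key : ∀ z z', G (z * z') y =
      LinearMap.mul' R A (TensorProduct.map (G z) (G z') (TensorProduct.comm R B B (hB.comul y))) := by
    intro z z'
    induction z with
    | zero => simp
    | add a b ha hb =>
      rw [add_mul, map_add, map_add, LinearMap.add_apply, ha, hb, TensorProduct.map_add_left,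
        LinearMap.add_apply, map_add]
    | tmul a b =>
      induction z' with
      | zero => simp
      | add a b ha hb =>
        rw [mul_add, map_add, map_add, LinearMap.add_apply, ha, hb, TensorProduct.map_add_right,
          LinearMap.add_apply, map_add]
      | tmul c d =>
        rw [Algebra.TensorProduct.tmul_mul_tmul, hG, h.mul_left]
        generalize TensorProduct.comm R B B (hB.comul y) = w
        induction w with
        | zero => simp
        | add a b ha hb => simp only [TensorProduct.tmul_add, map_add, add_smul, ha, hb]
        | tmul e f => simp [tensorPairing, hG, smul_smul, mul_comm]
  have := key (hA.comul x) (hA.comul x')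
  rw [← map_mul] at this
  exact this

end IsSkewHopfPairing

end Hit

/-! ### The universal property of the presented algebra. -/

namespace DeformationDatum

attribute [local instance] Half.ring

variable {I : Type u} {F : Type w} [Field F] [Algebra (RatFunc ℚ) F]
variable (P : DeformationDatum I F)

/-- The ring structure on `FPlus`, registered locally to help unification. -/
noncomputable abbrev ringPlus : Ring P.FPlus := inferInstance

/-- The ring structure on `FMinus`, registered locally to help unification. -/
noncomputable abbrev ringMinus : Ring P.FMinus := inferInstance

attribute [local instance] ringPlus ringMinus

theorem plus_comm (s t : TorusGen I) :
    P.plus (.T s) * P.plus (.T t) = P.plus (.T t) * P.plus (.T s) := by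
  simp only [plus, ← map_mul, Half.comm]

theorem minus_comm (s t : TorusGen I) :
    P.minus (.T s) * P.minus (.T t) = P.minus (.T t) * P.minus (.T s) := by
  simp only [minus, ← map_mul, Half.comm]

theorem plus_mul_inv (s : TorusGen I) : P.plus (.T s) * P.plus (.T s.inv) = 1 := by
  simp only [plus, ← map_mul, Half.T_mul_T_inv, map_one]

theorem minus_mul_inv (s : TorusGen I) : P.minus (.T s) * P.minus (.T s.inv) = 1 := by
  simp only [minus, ← map_mul, Half.T_mul_T_inv, map_one]

theorem plus_inv_mul (s : TorusGen I) : P.plus (.T s.inv) * P.plus (.T s) = 1 := by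
  simp only [plus, ← map_mul, Half.T_inv_mul_T, map_one]

theorem minus_inv_mul (s : TorusGen I) : P.minus (.T s.inv) * P.minus (.T s) = 1 := by
  simp only [minus, ← map_mul, Half.T_inv_mul_T, map_one]

theorem plus_T_mul_X (s : TorusGen I) (j : I) : P.plus (.T s) * P.plus (.X j) =
    Half.char P.angle (fun i j => P.ξ.at j i) s j • (P.plus (.X j) * P.plus (.T s)) := by
  simp only [plus, ← map_mul, ← map_smul]
  rw [Half.T_mul_X P.angle_ne_zero (fun i j => P.ξ_ne_zero j i)]

theorem minus_T_mul_X (s : TorusGen I) (j : I) : P.minus (.T s) * P.minus (.X j) =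
    Half.char (fun i j => P.angle j i * (P.ξ.at i j)⁻¹) (fun _ _ => 1) s j •
      (P.minus (.X j) * P.minus (.T s)) := by
  simp only [minus, ← map_mul, ← map_smul]
  rw [Half.T_mul_X (fun i j => mul_ne_zero (P.angle_ne_zero j i) (inv_ne_zero (P.ξ_ne_zero i j)))
    (fun _ _ => one_ne_zero)]

/-- Induction on words read from the left, which suits moving a generator of the other half past a
word one letter at a time. -/
theorem FPlus_induction {motive : P.FPlus → Prop} (one : motive 1)
    (smul : ∀ (r : F) x, motive x → motive (r • x))
    (mul : ∀ g x, motive x → motive (P.plus g * x))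
    (add : ∀ a b, motive a → motive b → motive (a + b)) (x : P.FPlus) : motive x := by
  have key : ∀ a : P.FreePlus, ∀ x, motive x → motive (P.toPlus a * x) := by
    intro a
    induction a using Half.induction with
    | grade0 r =>
      intro x hx
      rw [AlgHom.commutes, ← Algebra.smul_def]
      exact smul r x hx
    | grade1 g => exact fun x hx => mul g x hx
    | mul a b ha hb => exact fun x hx => by rw [map_mul, mul_assoc]; exact ha _ (hb x hx)
    | add a b ha hb => exact fun x hx => by rw [map_add, add_mul]; exact add _ _ (ha x hx) (hb x hx)
  obtain ⟨a, rfl⟩ := RingQuot.mkAlgHom_surjective F P.SerrePlus x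
  simpa [toPlus] using key a 1 one

theorem FPlus_algHom_ext {A : Type*} [Ring A] [Algebra F A] {f g : P.FPlus →ₐ[F] A}
    (h : ∀ x, f (P.plus x) = g (P.plus x)) : f = g :=
  RingQuot.ringQuot_ext' _ _ _ (Half.algHom_ext h)

theorem FMinus_algHom_ext {A : Type*} [Ring A] [Algebra F A] {f g : P.FMinus →ₐ[F] A}
    (h : ∀ x, f (P.minus x) = g (P.minus x)) : f = g :=
  RingQuot.ringQuot_ext' _ _ _ (Half.algHom_ext h)

/-! ### The universal property of the presented algebra -/

/-- The homomorphism `θ_i ↦ E_i` into the free algebra. -/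
noncomputable def letterE : FreeAlgebra F I →ₐ[F] FreeAlgebra F (UGen I) :=
  FreeAlgebra.lift F fun i => letter F (.E i)

/-- The anti-homomorphism `θ_i ↦ F_i` into the free algebra. -/
noncomputable def letterF : FreeAlgebra F I →ₐ[F] (FreeAlgebra F (UGen I))ᵐᵒᵖ :=
  FreeAlgebra.lift F fun i => MulOpposite.op (letter F (.F i))

theorem letterE_serreElement (i j : I) : letterE (P.serreElement i j) =
    ∑ k ∈ Finset.HasAntidiagonal.antidiagonal (P.serreOrder i j),
      ((-1) ^ k.1 * (P.β.at i j ^ k.1)⁻¹) •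
        (P.divPow i (letter F (.E i)) k.1 * letter F (.E j) *
          P.divPow i (letter F (.E i)) k.2) := by
  simp [serreElement, divPow, letterE]

theorem unop_letterF_serreElement (i j : I) : (letterF (P.serreElement i j)).unop =
    ∑ k ∈ Finset.HasAntidiagonal.antidiagonal (P.serreOrder i j),
      ((-1) ^ k.1 * (P.β.at i j ^ k.1)⁻¹) •
        (P.divPow i (letter F (.F i)) k.2 * letter F (.F j) *
          P.divPow i (letter F (.F i)) k.1) := by
  simp only [serreElement, divPow, letterF, map_sum, map_smul, map_mul, map_pow,
    FreeAlgebra.lift_ι_apply, Finset.unop_sum, MulOpposite.unop_smul, MulOpposite.unop_mul,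
    MulOpposite.unop_pow, MulOpposite.unop_op, mul_assoc]

variable [DecidableEq I]

/-- The relations of the presented algebra that involve both `f (FPlus)` and `g (FMinus)`. -/
structure CrossRel {H : Type*} [Ring H] [Algebra F H] (f : P.FPlus →ₐ[F] H)
    (g : P.FMinus →ₐ[F] H) : Prop where
  comm (s t : TorusGen I) :
    f (P.plus (.T s)) * g (P.minus (.T t)) = g (P.minus (.T t)) * f (P.plus (.T s))
  K'_E (i j : I) : g (P.minus (.T (.K i))) * f (P.plus (.X j)) =
    ((P.angle j i)⁻¹ * P.ξ.at i j) • (f (P.plus (.X j)) * g (P.minus (.T (.K i))))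
  J'_E (i j : I) : g (P.minus (.T (.J i))) * f (P.plus (.X j)) =
    f (P.plus (.X j)) * g (P.minus (.T (.J i)))
  K_F (i j : I) : f (P.plus (.T (.K i))) * g (P.minus (.X j)) =
    (P.angle i j)⁻¹ • (g (P.minus (.X j)) * f (P.plus (.T (.K i))))
  J_F (i j : I) : f (P.plus (.T (.J i))) * g (P.minus (.X j)) =
    (P.ξ.at j i)⁻¹ • (g (P.minus (.X j)) * f (P.plus (.T (.J i))))
  E_F (i j : I) : f (P.plus (.X i)) * g (P.minus (.X j)) -
      (P.ξ.at j i)⁻¹ • (g (P.minus (.X j)) * f (P.plus (.X i))) =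
    if i = j then (P.vi i - (P.vi i)⁻¹)⁻¹ •
      (f (P.plus (.T (.K i))) * g (P.minus (.T (.J i))) -
        f (P.plus (.T (.J i))) * g (P.minus (.T (.K i))))
    else 0

/-- A common extension of a function on the generators of `FPlus` and a function on the generators
of `FMinus`. -/
def joinGen {H : Type*} (a b : HalfGen I → H) : UGen I → H
  | .E i => a (.X i)
  | .F i => b (.X i)
  | .K i => a (.T (.K i))
  | .Kinv i => a (.T (.Kinv i))
  | .J i => a (.T (.J i))
  | .Jinv i => a (.T (.Jinv i))
  | .K' i => b (.T (.K i))
  | .Kinv' i => b (.T (.Kinv i))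
  | .J' i => b (.T (.J i))
  | .Jinv' i => b (.T (.Jinv i))

theorem joinGen_toUPlus {H : Type*} (a b : HalfGen I → H) (g : HalfGen I) :
    joinGen a b g.toUPlus = a g := by
  rcases g with i | (i | i | i | i) <;> rfl

theorem joinGen_toUMinus {H : Type*} (a b : HalfGen I → H) (g : HalfGen I) :
    joinGen a b g.toUMinus = b g := by
  rcases g with i | (i | i | i | i) <;> rfl

theorem exists_of_isTorus {s : UGen I} (h : s.IsTorus) :
    ∃ t : TorusGen I, s = (HalfGen.T t).toUPlus ∨ s = (HalfGen.T t).toUMinus := by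
  cases h with
  | K i => exact ⟨.K i, .inl rfl⟩
  | Kinv i => exact ⟨.Kinv i, .inl rfl⟩
  | J i => exact ⟨.J i, .inl rfl⟩
  | Jinv i => exact ⟨.Jinv i, .inl rfl⟩
  | K' i => exact ⟨.K i, .inr rfl⟩
  | Kinv' i => exact ⟨.Kinv i, .inr rfl⟩
  | J' i => exact ⟨.J i, .inr rfl⟩
  | Jinv' i => exact ⟨.Jinv i, .inr rfl⟩

section Lift

variable {P} {H : Type*} [Ring H] [Algebra F H] {f : P.FPlus →ₐ[F] H} {g : P.FMinus →ₐ[F] H}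

/-- The homomorphism from the free algebra that underlies `CrossRel.lift`. -/
noncomputable abbrev freeLift (f : P.FPlus →ₐ[F] H) (g : P.FMinus →ₐ[F] H) :
    FreeAlgebra F (UGen I) →ₐ[F] H :=
  FreeAlgebra.lift F (joinGen (fun x => f (P.plus x)) (fun x => g (P.minus x)))

/-- On the subalgebra generated by the letters E_i the map factors through `FPlus`, where the Serre
element is zero. -/
theorem freeLift_serreE {i j : I} (h : i ≠ j) :
    freeLift f g (letterE (P.serreElement i j)) = 0 := by
  have h1 : (freeLift f g).comp letterE = f.comp (P.toPlus.comp P.iotaPlus) := by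
    ext i
    simp [letterE, iotaPlus, joinGen, plus]
  have h2 := DFunLike.congr_fun h1 (P.serreElement i j)
  have h3 : P.toPlus (P.iotaPlus (P.serreElement i j)) = 0 := by
    have := RingQuot.mkAlgHom_rel F (SerrePlus.mk (P := P) i j h)
    rwa [map_zero] at this
  simp only [AlgHom.comp_apply, h3, map_zero] at h2
  exact h2

theorem freeLift_serreF {i j : I} (h : i ≠ j) :
    freeLift f g (letterF (P.serreElement i j)).unop = 0 := by
  have h1 : (AlgHom.op (freeLift f g)).comp letterF =
      (AlgHom.op (g.comp P.toMinus)).comp P.iotaMinus := by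
    ext i
    simp [letterF, iotaMinus, joinGen, minus]
  have h2 := congrArg MulOpposite.unop (DFunLike.congr_fun h1 (P.serreElement i j))
  have h3 : P.toMinus (P.iotaMinus (P.serreElement i j)).unop = 0 := by
    have := RingQuot.mkAlgHom_rel F (SerreMinus.mk (P := P) i j h)
    rwa [map_zero] at this
  simp only [AlgHom.comp_apply, AlgHom.op_apply_apply, MulOpposite.unop_op, h3, map_zero] at h2
  exact h2

/-- The universal property of `PresentedU`. -/
noncomputable def CrossRel.lift (h : P.CrossRel f g) : P.PresentedU →ₐ[F] H :=
  RingQuot.liftAlgHom F ⟨freeLift f g, by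
    intro x y hxy
    cases hxy with
    | comm s t hs ht =>
      obtain ⟨s, rfl | rfl⟩ := exists_of_isTorus hs <;>
      obtain ⟨t, rfl | rfl⟩ := exists_of_isTorus ht <;>
      simp only [letter, map_mul, FreeAlgebra.lift_ι_apply, joinGen_toUPlus, joinGen_toUMinus]
      · rw [← map_mul, plus_comm, map_mul]
      · exact h.comm _ _
      · exact (h.comm _ _).symm
      · rw [← map_mul, minus_comm, map_mul]
    | K_inv i =>
      rw [map_mul, map_one, FreeAlgebra.lift_ι_apply, FreeAlgebra.lift_ι_apply]
      exact (map_mul f _ _).symm.trans ((congrArg f (P.plus_mul_inv (.K i))).trans (map_one f))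
    | J_inv i =>
      rw [map_mul, map_one, FreeAlgebra.lift_ι_apply, FreeAlgebra.lift_ι_apply]
      exact (map_mul f _ _).symm.trans ((congrArg f (P.plus_mul_inv (.J i))).trans (map_one f))
    | K'_inv i =>
      rw [map_mul, map_one, FreeAlgebra.lift_ι_apply, FreeAlgebra.lift_ι_apply]
      exact (map_mul g _ _).symm.trans ((congrArg g (P.minus_mul_inv (.K i))).trans (map_one g))
    | J'_inv i =>
      rw [map_mul, map_one, FreeAlgebra.lift_ι_apply, FreeAlgebra.lift_ι_apply]
      exact (map_mul g _ _).symm.trans ((congrArg g (P.minus_mul_inv (.J i))).trans (map_one g))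
    | K_E i j => simpa [joinGen, Half.char] using congrArg f (P.plus_T_mul_X (.K i) j)
    | K'_E i j => simpa [joinGen] using h.K'_E i j
    | K_F i j => simpa [joinGen] using h.K_F i j
    | K'_F i j => simpa [joinGen, Half.char] using congrArg g (P.minus_T_mul_X (.K i) j)
    | J_E i j => simpa [joinGen, Half.char] using congrArg f (P.plus_T_mul_X (.J i) j)
    | J'_E i j => simpa [joinGen] using h.J'_E i j
    | J_F i j => simpa [joinGen] using h.J_F i j
    | J'_F i j => simpa [joinGen, Half.char] using congrArg g (P.minus_T_mul_X (.J i) j)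
    | E_F i j =>
      have := h.E_F i j
      split_ifs at this ⊢ <;> simpa [joinGen] using this
    | serre_E i j hij =>
      rw [← letterE_serreElement, freeLift_serreE hij, map_zero]
    | serre_F i j hij =>
      rw [← unop_letterF_serreElement, freeLift_serreF hij, map_zero]⟩

theorem CrossRel.lift_plus (h : P.CrossRel f g) (x : HalfGen I) :
    h.lift (P.genU x.toUPlus) = f (P.plus x) := by
  rw [lift, genU, RingQuot.liftAlgHom_mkAlgHom_apply, FreeAlgebra.lift_ι_apply, joinGen_toUPlus]

theorem CrossRel.lift_minus (h : P.CrossRel f g) (x : HalfGen I) :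
    h.lift (P.genU x.toUMinus) = g (P.minus x) := by
  rw [lift, genU, RingQuot.liftAlgHom_mkAlgHom_apply, FreeAlgebra.lift_ι_apply, joinGen_toUMinus]

end Lift

/-- The ring structure on `PresentedU`, registered locally to help unification. -/
noncomputable abbrev ringU : Ring P.PresentedU := inferInstance

attribute [local instance] ringU

theorem exists_half (x : UGen I) : ∃ g : HalfGen I, x = g.toUPlus ∨ x = g.toUMinus := by
  cases x with
  | E i => exact ⟨.X i, .inl rfl⟩
  | F i => exact ⟨.X i, .inr rfl⟩
  | K i => exact ⟨.T (.K i), .inl rfl⟩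
  | Kinv i => exact ⟨.T (.Kinv i), .inl rfl⟩
  | J i => exact ⟨.T (.J i), .inl rfl⟩
  | Jinv i => exact ⟨.T (.Jinv i), .inl rfl⟩
  | K' i => exact ⟨.T (.K i), .inr rfl⟩
  | Kinv' i => exact ⟨.T (.Kinv i), .inr rfl⟩
  | J' i => exact ⟨.T (.J i), .inr rfl⟩
  | Jinv' i => exact ⟨.T (.Jinv i), .inr rfl⟩

theorem isTorus_toUPlus (s : TorusGen I) : (HalfGen.T s).toUPlus.IsTorus := by
  cases s <;> constructor

theorem isTorus_toUMinus (s : TorusGen I) : (HalfGen.T s).toUMinus.IsTorus := by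
  cases s <;> constructor

theorem genU_comm {s t : UGen I} (hs : s.IsTorus) (ht : t.IsTorus) :
    P.genU s * P.genU t = P.genU t * P.genU s := by
  simpa [genU] using RingQuot.mkAlgHom_rel F (URel.comm (P := P) s t hs ht)

/-- The homomorphism `FreePlus → PresentedU` given by the generators. -/
noncomputable def freeIncPlus : P.FreePlus →ₐ[F] P.PresentedU :=
  Half.lift (fun g => P.genU g.toUPlus)
    (fun s t => P.genU_comm (isTorus_toUPlus s) (isTorus_toUPlus t))
    (fun i => by simpa [genU, HalfGen.toUPlus] using RingQuot.mkAlgHom_rel F (URel.K_inv (P := P) i))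
    (fun i => by simpa [genU, HalfGen.toUPlus] using RingQuot.mkAlgHom_rel F (URel.J_inv (P := P) i))
    (fun i j => by simpa [genU, HalfGen.toUPlus] using RingQuot.mkAlgHom_rel F (URel.K_E (P := P) i j))
    (fun i j => by simpa [genU, HalfGen.toUPlus] using RingQuot.mkAlgHom_rel F (URel.J_E (P := P) i j))

/-- The homomorphism `FreeMinus → PresentedU` given by the generators. -/
noncomputable def freeIncMinus : P.FreeMinus →ₐ[F] P.PresentedU :=
  Half.lift (fun g => P.genU g.toUMinus)
    (fun s t => P.genU_comm (isTorus_toUMinus s) (isTorus_toUMinus t))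
    (fun i => by simpa [genU, HalfGen.toUMinus] using RingQuot.mkAlgHom_rel F (URel.K'_inv (P := P) i))
    (fun i => by simpa [genU, HalfGen.toUMinus] using RingQuot.mkAlgHom_rel F (URel.J'_inv (P := P) i))
    (fun i j => by simpa [genU, HalfGen.toUMinus] using RingQuot.mkAlgHom_rel F (URel.K'_F (P := P) i j))
    (fun i j => by simpa [genU, HalfGen.toUMinus] using RingQuot.mkAlgHom_rel F (URel.J'_F (P := P) i j))

theorem freeIncPlus_gen (g : HalfGen I) : P.freeIncPlus (P.genPlus g) = P.genU g.toUPlus := by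
  simp [freeIncPlus]

theorem freeIncMinus_gen (g : HalfGen I) : P.freeIncMinus (P.genMinus g) = P.genU g.toUMinus := by
  simp [freeIncMinus]

/-- The homomorphism `FPlus → PresentedU` given by the generators. -/
noncomputable def incPlus : P.FPlus →ₐ[F] P.PresentedU :=
  RingQuot.liftAlgHom F ⟨P.freeIncPlus, by
    rintro _ _ ⟨i, j, h⟩
    have h1 : P.freeIncPlus.comp P.iotaPlus = (RingQuot.mkAlgHom F P.URel).comp letterE := by
      ext i
      simp [letterE, iotaPlus, freeIncPlus_gen, HalfGen.toUPlus, genU]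
    have h2 := DFunLike.congr_fun h1 (P.serreElement i j)
    rw [AlgHom.comp_apply, AlgHom.comp_apply, letterE_serreElement,
      RingQuot.mkAlgHom_rel F (URel.serre_E (P := P) i j h), map_zero] at h2
    rw [h2, map_zero]⟩

/-- The homomorphism `FMinus → PresentedU` given by the generators. -/
noncomputable def incMinus : P.FMinus →ₐ[F] P.PresentedU :=
  RingQuot.liftAlgHom F ⟨P.freeIncMinus, by
    rintro _ _ ⟨i, j, h⟩
    have h1 : (AlgHom.op P.freeIncMinus).comp P.iotaMinus =
        (AlgHom.op (RingQuot.mkAlgHom F P.URel)).comp letterF := by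
      ext i
      simp [letterF, iotaMinus, freeIncMinus_gen, HalfGen.toUMinus, genU]
    have h2 := congrArg MulOpposite.unop (DFunLike.congr_fun h1 (P.serreElement i j))
    simp only [AlgHom.comp_apply, AlgHom.op_apply_apply, MulOpposite.unop_op] at h2
    rw [unop_letterF_serreElement,
      RingQuot.mkAlgHom_rel F (URel.serre_F (P := P) i j h), map_zero] at h2
    rw [h2, map_zero]⟩

theorem incPlus_plus (g : HalfGen I) : P.incPlus (P.plus g) = P.genU g.toUPlus := by
  rw [incPlus, plus, toPlus, RingQuot.liftAlgHom_mkAlgHom_apply, freeIncPlus_gen]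

theorem incMinus_minus (g : HalfGen I) : P.incMinus (P.minus g) = P.genU g.toUMinus := by
  rw [incMinus, minus, toMinus, RingQuot.liftAlgHom_mkAlgHom_apply, freeIncMinus_gen]

theorem crossRel_inc : P.CrossRel P.incPlus P.incMinus where
  comm s t := by
    simpa only [incPlus_plus, incMinus_minus] using
      P.genU_comm (isTorus_toUPlus s) (isTorus_toUMinus t)
  K'_E i j := by
    simpa [incPlus_plus, incMinus_minus, HalfGen.toUPlus, HalfGen.toUMinus, genU] using
      RingQuot.mkAlgHom_rel F (URel.K'_E (P := P) i j)
  J'_E i j := by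
    simpa [incPlus_plus, incMinus_minus, HalfGen.toUPlus, HalfGen.toUMinus, genU] using
      RingQuot.mkAlgHom_rel F (URel.J'_E (P := P) i j)
  K_F i j := by
    simpa [incPlus_plus, incMinus_minus, HalfGen.toUPlus, HalfGen.toUMinus, genU] using
      RingQuot.mkAlgHom_rel F (URel.K_F (P := P) i j)
  J_F i j := by
    simpa [incPlus_plus, incMinus_minus, HalfGen.toUPlus, HalfGen.toUMinus, genU] using
      RingQuot.mkAlgHom_rel F (URel.J_F (P := P) i j)
  E_F i j := by
    have := RingQuot.mkAlgHom_rel F (URel.E_F (P := P) i j)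
    split_ifs at this ⊢ <;>
    simpa [incPlus_plus, incMinus_minus, HalfGen.toUPlus, HalfGen.toUMinus, genU] using this

theorem adjoin_range_genU : Algebra.adjoin F (Set.range P.genU) = ⊤ := by
  refine top_unique fun a _ => ?_
  obtain ⟨x, rfl⟩ := RingQuot.mkAlgHom_surjective F P.URel a
  induction x using FreeAlgebra.induction with
  | grade0 r => rw [AlgHom.commutes]; exact Subalgebra.algebraMap_mem _ r
  | grade1 g => exact Algebra.subset_adjoin ⟨g, rfl⟩
  | mul a b ha hb => rw [map_mul]; exact mul_mem (ha trivial) (hb trivial)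
  | add a b ha hb => rw [map_add]; exact add_mem (ha trivial) (hb trivial)

section Lift

variable {P} {H : Type*} [Ring H] [Algebra F H] {f : P.FPlus →ₐ[F] H} {g : P.FMinus →ₐ[F] H}

theorem CrossRel.lift_incPlus (h : P.CrossRel f g) (x : P.FPlus) : h.lift (P.incPlus x) = f x :=
  DFunLike.congr_fun (P.FPlus_algHom_ext (f := h.lift.comp P.incPlus) (g := f) fun x => by
    rw [AlgHom.comp_apply, incPlus_plus, h.lift_plus]) x

theorem CrossRel.lift_incMinus (h : P.CrossRel f g) (x : P.FMinus) : h.lift (P.incMinus x) = g x :=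
  DFunLike.congr_fun (P.FMinus_algHom_ext (f := h.lift.comp P.incMinus) (g := g) fun x => by
    rw [AlgHom.comp_apply, incMinus_minus, h.lift_minus]) x

theorem CrossRel.plus_T_mul_F (h : P.CrossRel f g) (s : TorusGen I) (j : I) :
    f (P.plus (.T s)) * g (P.minus (.X j)) =
      Half.char (fun i j => (P.angle i j)⁻¹) (fun i j => (P.ξ.at j i)⁻¹) s j •
        (g (P.minus (.X j)) * f (P.plus (.T s))) := by
  have h1 : ∀ s, f (P.plus (.T s)) * f (P.plus (.T s.inv)) = 1 := fun s => by
    rw [← map_mul, plus_mul_inv, map_one]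
  have h2 : ∀ s, f (P.plus (.T s.inv)) * f (P.plus (.T s)) = 1 := fun s => by
    rw [← map_mul, plus_inv_mul, map_one]
  rcases s with i | i | i | i
  · exact h.K_F i j
  · exact Half.inv_mul_of_mul (inv_ne_zero (P.angle_ne_zero i j)) (h1 (.K i)) (h2 (.K i)) (h.K_F i j)
  · exact h.J_F i j
  · exact Half.inv_mul_of_mul (inv_ne_zero (P.ξ_ne_zero j i)) (h1 (.J i)) (h2 (.J i)) (h.J_F i j)

theorem CrossRel.minus_T_mul_E (h : P.CrossRel f g) (s : TorusGen I) (j : I) :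
    g (P.minus (.T s)) * f (P.plus (.X j)) =
      Half.char (fun i j => (P.angle j i)⁻¹ * P.ξ.at i j) (fun _ _ => 1) s j •
        (f (P.plus (.X j)) * g (P.minus (.T s))) := by
  have h1 : ∀ s, g (P.minus (.T s)) * g (P.minus (.T s.inv)) = 1 := fun s => by
    rw [← map_mul, minus_mul_inv, map_one]
  have h2 : ∀ s, g (P.minus (.T s.inv)) * g (P.minus (.T s)) = 1 := fun s => by
    rw [← map_mul, minus_inv_mul, map_one]
  rcases s with i | i | i | i
  · exact h.K'_E i j
  · exact Half.inv_mul_of_mul (mul_ne_zero (inv_ne_zero (P.angle_ne_zero j i)) (P.ξ_ne_zero i j))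
      (h1 (.K i)) (h2 (.K i)) (h.K'_E i j)
  · exact (h.J'_E i j).trans (one_smul F _).symm
  · exact Half.inv_mul_of_mul one_ne_zero (h1 (.J i)) (h2 (.J i))
      ((h.J'_E i j).trans (one_smul F _).symm)

end Lift

end DeformationDatum

/-! ### The Hopf structure on the presented algebra. -/

section Commutator

variable {F : Type*} [Field F] {H : Type*} [Ring H] [Algebra F H]

/-- Of the four pairs of terms, those of E ⊗ J with J' ⊗ G and of K ⊗ E with G ⊗ K' cancel by the
commutation scalars; the other two keep a full commutator in one leg. -/
theorem comul_commutator {E G K J K' J' : H} {a c : F} (hc : c ≠ 0)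
    (hJG : J * G = c⁻¹ • (G * J)) (hKG : K * G = a⁻¹ • (G * K))
    (hK'E : K' * E = (a⁻¹ * c) • (E * K')) (hJ'E : J' * E = E * J') (hKJ' : K * J' = J' * K)
    (hJK' : J * K' = K' * J) :
    (E ⊗ₜ[F] J + K ⊗ₜ[F] E) * (J' ⊗ₜ[F] G + G ⊗ₜ[F] K') -
        c⁻¹ • ((J' ⊗ₜ[F] G + G ⊗ₜ[F] K') * (E ⊗ₜ[F] J + K ⊗ₜ[F] E)) =
      (E * G - c⁻¹ • (G * E)) ⊗ₜ[F] (J * K') + (K * J') ⊗ₜ[F] (E * G - c⁻¹ • (G * E)) := by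
  simp only [mul_add, add_mul, Algebra.TensorProduct.tmul_mul_tmul, hJG, hKG, hK'E, hJ'E, ← hKJ',
    ← hJK', TensorProduct.sub_tmul, TensorProduct.tmul_sub, TensorProduct.tmul_smul,
    TensorProduct.smul_tmul', smul_add, smul_smul]
  rw [mul_comm a⁻¹ c, inv_mul_cancel_left₀ hc]
  abel

/-- Here `Ki`, `Ji`, `Ki'`, `Ji'` play the part of inverse torus elements. Moving them to the
outside costs c⁻¹ for G E and c for E G, so the commutator reappears with opposite sign between
torus factors. -/
theorem antipode_commutator {E G Ki Ji Ki' Ji' : H} {a c : F} (hc : c ≠ 0) (ha : a ≠ 0)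
    (hJG : Ji * G = c • (G * Ji)) (hKG : Ki * G = a • (G * Ki))
    (hK'E : Ki' * E = (a * c⁻¹) • (E * Ki')) (hJ'E : Ji' * E = E * Ji')
    (hKJ : Ki * Ji' = Ji' * Ki) (hJJ : Ji * Ji' = Ji' * Ji) (hKK : Ki * Ki' = Ki' * Ki)
    (hJK : Ji * Ki' = Ki' * Ji) :
    (Ji' * G * Ki') * (Ki * E * Ji) - c⁻¹ • ((Ki * E * Ji) * (Ji' * G * Ki')) =
      -(Ji' * Ki * (E * G - c⁻¹ • (G * E)) * (Ki' * Ji)) := by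
  have h1 : G * Ki = a⁻¹ • (Ki * G) := by rw [hKG, smul_smul, inv_mul_cancel₀ ha, one_smul]
  have e1 : (Ji' * G * Ki') * (Ki * E * Ji) = c⁻¹ • (Ji' * Ki * (G * E) * (Ki' * Ji)) := by
    calc (Ji' * G * Ki') * (Ki * E * Ji) = Ji' * (G * (Ki' * Ki)) * E * Ji := by noncomm_ring
      _ = Ji' * (G * Ki) * (Ki' * E) * Ji := by rw [← hKK]; noncomm_ring
      _ = (a⁻¹ * (a * c⁻¹)) • (Ji' * (Ki * G) * (E * Ki') * Ji) := by
        rw [h1, hK'E]; simp only [mul_smul_comm, smul_mul_assoc, smul_smul, mul_comm]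
      _ = _ := by rw [inv_mul_cancel_left₀ ha]; simp only [mul_assoc]
  have e2 : (Ki * E * Ji) * (Ji' * G * Ki') = c • (Ji' * Ki * (E * G) * (Ki' * Ji)) := by
    calc (Ki * E * Ji) * (Ji' * G * Ki') = Ki * E * (Ji * Ji') * G * Ki' := by noncomm_ring
      _ = Ki * (E * Ji') * (Ji * G) * Ki' := by rw [hJJ]; noncomm_ring
      _ = c • ((Ki * Ji') * E * G * (Ji * Ki')) := by
        rw [← hJ'E, hJG]; simp only [mul_smul_comm, smul_mul_assoc, mul_assoc]
      _ = _ := by rw [hKJ, hJK]; simp only [mul_assoc]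
  rw [e1, e2, smul_smul, inv_mul_cancel₀ hc, one_smul]
  simp only [mul_sub, sub_mul, mul_smul_comm, smul_mul_assoc]
  abel

theorem neg_conj_mul {t x a b : H} {c : F} (hc : c ≠ 0) (ha : t * a = a * t) (hb : t * b = b * t)
    (hx : t * x = c⁻¹ • (x * t)) : -(a * x * b) * t = c • (t * -(a * x * b)) := by
  have hx' : x * t = c • (t * x) := by rw [hx, smul_smul, mul_inv_cancel₀ hc, one_smul]
  rw [neg_mul, mul_neg, smul_neg, mul_assoc, ← hb, mul_assoc, ← mul_assoc x, hx', smul_mul_assoc,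
    mul_smul_comm, mul_assoc t x, ← mul_assoc a, ← ha]
  simp only [mul_assoc]

theorem antipode_torus {K Ki J Ji K' Ki' J' Ji' : H} {c : F} (hK : Ki * K = 1)
    (hJ' : Ji' * J' = 1) (hK' : K' * Ki' = 1) (hJ : J * Ji = 1) :
    -(Ji' * Ki * (c • (K * J' - J * K')) * (Ki' * Ji)) = c • (Ji' * Ki - Ki' * Ji) := by
  have h1 : Ji' * Ki * (K * J') * (Ki' * Ji) = Ki' * Ji := by
    calc _ = Ji' * (Ki * K) * J' * (Ki' * Ji) := by simp only [mul_assoc]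
      _ = _ := by rw [hK, mul_one, hJ', one_mul]
  have h2 : Ji' * Ki * (J * K') * (Ki' * Ji) = Ji' * Ki := by
    calc _ = Ji' * Ki * (J * (K' * Ki') * Ji) := by simp only [mul_assoc]
      _ = _ := by rw [hK', mul_one, hJ, mul_one]
  rw [mul_smul_comm, smul_mul_assoc, mul_sub, sub_mul, h1, h2, ← smul_neg, neg_sub]

end Commutator

namespace HopfStructure

variable {R : Type u} [CommRing R] {A U : Type w} [Ring A] [Algebra R A] [Ring U] [Algebra R U]
variable (hA : HopfStructure R A) {i : A →ₐ[R] U} {Δ : U →ₐ[R] U ⊗[R] U} {ε : U →ₐ[R] R}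
  {S : U →ₐ[R] Uᵐᵒᵖ} (hΔ : ∀ x, Δ (i x) = Algebra.TensorProduct.map i i (hA.comul x))
  (hε : ∀ x, ε (i x) = hA.counit x) (hS : ∀ x, S (i x) = MulOpposite.op (i (hA.antipode x)))

include hΔ

/-- Transports the axiom along a map i that intertwines the coproducts. With the counit and antipode
analogues, the axioms of U need no checking beyond the images of its two halves. -/
theorem coassoc_of_map (x : A) : Algebra.TensorProduct.assoc R R R U U U
      (Algebra.TensorProduct.map Δ (.id R U) (Δ (i x))) =
    Algebra.TensorProduct.map (.id R U) Δ (Δ (i x)) := by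
  have h1 : ∀ z, Algebra.TensorProduct.assoc R R R U U U (Algebra.TensorProduct.map Δ (.id R U)
      (Algebra.TensorProduct.map i i z)) =
      Algebra.TensorProduct.map i (Algebra.TensorProduct.map i i)
        (TensorProduct.assoc R A A A (hA.comul.toLinearMap.rTensor A z)) := by
    intro z
    induction z with
    | zero => simp
    | add a b ha hb => simp only [map_add, ha, hb]
    | tmul a b =>
      rw [LinearMap.rTensor_tmul, AlgHom.toLinearMap_apply, Algebra.TensorProduct.map_tmul,
        Algebra.TensorProduct.map_tmul, hΔ]
      generalize hA.comul a = z
      induction z with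
      | zero => simp
      | add a b ha hb => simp only [map_add, TensorProduct.add_tmul, ha, hb]
      | tmul a b => simp
  have h2 : ∀ z, Algebra.TensorProduct.map (.id R U) Δ (Algebra.TensorProduct.map i i z) =
      Algebra.TensorProduct.map i (Algebra.TensorProduct.map i i)
        (hA.comul.toLinearMap.lTensor A z) := by
    intro z
    induction z with
    | zero => simp
    | add a b ha hb => simp only [map_add, ha, hb]
    | tmul a b => simp [hΔ]
  rw [hΔ, h1, h2, hA.coassoc_apply]

include hε in
theorem counit_left_of_map (x : A) :
    Algebra.TensorProduct.map ε (.id R U) (Δ (i x)) = 1 ⊗ₜ i x := by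
  have h : ∀ z, Algebra.TensorProduct.map ε (.id R U) (Algebra.TensorProduct.map i i z) =
      Algebra.TensorProduct.map (.id R R) i
        (TensorProduct.map hA.counit.toLinearMap LinearMap.id z) := by
    intro z
    induction z with
    | zero => simp
    | add a b ha hb => simp only [map_add, ha, hb]
    | tmul a b => simp [hε]
  rw [hΔ, h, hA.counit_left_apply]
  simp

include hε in
theorem counit_right_of_map (x : A) :
    Algebra.TensorProduct.map (.id R U) ε (Δ (i x)) = i x ⊗ₜ 1 := by
  have h : ∀ z, Algebra.TensorProduct.map (.id R U) ε (Algebra.TensorProduct.map i i z) =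
      Algebra.TensorProduct.map i (.id R R)
        (TensorProduct.map LinearMap.id hA.counit.toLinearMap z) := by
    intro z
    induction z with
    | zero => simp
    | add a b ha hb => simp only [map_add, ha, hb]
    | tmul a b => simp [hε]
  rw [hΔ, h, hA.counit_right_apply]
  simp

include hε hS in
theorem antipode_left_of_map (x : A) :
    LinearMap.mul' R U (((MulOpposite.opLinearEquiv R).symm.toLinearMap ∘ₗ
      S.toLinearMap).rTensor U (Δ (i x))) = algebraMap R U (ε (i x)) := by
  have h : ∀ z, LinearMap.mul' R U (((MulOpposite.opLinearEquiv R).symm.toLinearMap ∘ₗ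
      S.toLinearMap).rTensor U (Algebra.TensorProduct.map i i z)) =
      i (LinearMap.mul' R A (hA.antipode.rTensor A z)) := by
    intro z
    induction z with
    | zero => simp
    | add a b ha hb => simp only [map_add, ha, hb]
    | tmul a b => simp [hS]
  rw [hΔ, h, hA.antipode_left_apply, hε, AlgHom.commutes]

include hε hS in
theorem antipode_right_of_map (x : A) :
    LinearMap.mul' R U (((MulOpposite.opLinearEquiv R).symm.toLinearMap ∘ₗ
      S.toLinearMap).lTensor U (Δ (i x))) = algebraMap R U (ε (i x)) := by
  have h : ∀ z, LinearMap.mul' R U (((MulOpposite.opLinearEquiv R).symm.toLinearMap ∘ₗ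
      S.toLinearMap).lTensor U (Algebra.TensorProduct.map i i z)) =
      i (LinearMap.mul' R A (hA.antipode.lTensor A z)) := by
    intro z
    induction z with
    | zero => simp
    | add a b ha hb => simp only [map_add, ha, hb]
    | tmul a b => simp [hS]
  rw [hΔ, h, hA.antipode_right_apply, hε, AlgHom.commutes]

end HopfStructure

namespace DeformationDatum

attribute [local instance] Half.ring ringPlus ringMinus ringU

variable {I : Type u} {F : Type w} [Field F] [Algebra (RatFunc ℚ) F]
variable (P : DeformationDatum I F)

theorem isGroupLikePair_plus (s : TorusGen I) :
    IsGroupLikePair P.hopfPlus (P.plus (.T s)) (P.plus (.T s.inv)) :=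
  (Half.isGroupLikePair_T _ _ _ _ s).map P.isHopfMap_toPlus

theorem isGroupLikePair_minus (s : TorusGen I) :
    IsGroupLikePair P.hopfMinus (P.minus (.T s)) (P.minus (.T s.inv)) :=
  (Half.isGroupLikePair_T _ _ _ _ s).map P.isHopfMap_toMinus

variable [DecidableEq I]

section Cross

variable {P} {H : Type*} [Ring H] [Algebra F H] {f : P.FPlus →ₐ[F] H} {g : P.FMinus →ₐ[F] H}

/-- Says that the coproducts of the halves extend jointly to an algebra defined by the mixed
relations; only the E-F relation requires more than legwise commutation. -/
theorem CrossRel.comul (h : P.CrossRel f g) :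
    P.CrossRel ((Algebra.TensorProduct.map f f).comp P.hopfPlus.comul)
      ((Algebra.TensorProduct.map g g).comp P.hopfMinus.comul) where
  comm s t := by
    simp only [AlgHom.comp_apply, (P.isGroupLikePair_plus _).comul,
      (P.isGroupLikePair_minus _).comul, Algebra.TensorProduct.map_tmul,
      Algebra.TensorProduct.tmul_mul_tmul, h.comm]
  K'_E i j := by
    simp only [AlgHom.comp_apply, (P.isGroupLikePair_minus _).comul,
      (P.isPlusHopf_hopfPlus.E j).comul, map_add, Algebra.TensorProduct.map_tmul, mul_add, add_mul,
      Algebra.TensorProduct.tmul_mul_tmul, h.K'_E, h.comm, TensorProduct.smul_tmul',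
      TensorProduct.tmul_smul, smul_add]
  J'_E i j := by
    simp only [AlgHom.comp_apply, (P.isGroupLikePair_minus _).comul,
      (P.isPlusHopf_hopfPlus.E j).comul, map_add, Algebra.TensorProduct.map_tmul, mul_add, add_mul,
      Algebra.TensorProduct.tmul_mul_tmul, h.J'_E, h.comm]
  K_F i j := by
    simp only [AlgHom.comp_apply, (P.isGroupLikePair_plus _).comul,
      (P.isMinusHopf_hopfMinus.F j).comul, map_add, Algebra.TensorProduct.map_tmul, mul_add,
      add_mul, Algebra.TensorProduct.tmul_mul_tmul, h.K_F, h.comm, TensorProduct.smul_tmul',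
      TensorProduct.tmul_smul, smul_add]
  J_F i j := by
    simp only [AlgHom.comp_apply, (P.isGroupLikePair_plus _).comul,
      (P.isMinusHopf_hopfMinus.F j).comul, map_add, Algebra.TensorProduct.map_tmul, mul_add,
      add_mul, Algebra.TensorProduct.tmul_mul_tmul, h.J_F, h.comm, TensorProduct.smul_tmul',
      TensorProduct.tmul_smul, smul_add]
  E_F i j := by
    have key := comul_commutator (P.ξ_ne_zero j i) (h.J_F i j) (h.K_F i j) (h.K'_E j i)
      (h.J'_E j i) (h.comm (.K i) (.J j)) (h.comm (.J i) (.K j))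
    simp only [AlgHom.comp_apply, (P.isPlusHopf_hopfPlus.E i).comul,
      (P.isMinusHopf_hopfMinus.F j).comul, (P.isGroupLikePair_plus _).comul,
      (P.isGroupLikePair_minus _).comul, map_add, Algebra.TensorProduct.map_tmul]
    rw [add_comm (g (P.minus (.X j)) ⊗ₜ[F] _), key, h.E_F i j]
    split_ifs with hij
    · subst hij
      -- With A = K_i J'_i and B = J_i K'_i the sum telescopes: (A - B) ⊗ B + A ⊗ (A - B) = A ⊗ A -
      -- B ⊗ B.
      simp only [Algebra.TensorProduct.tmul_mul_tmul, TensorProduct.sub_tmul,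
        TensorProduct.tmul_sub, TensorProduct.tmul_smul, ← TensorProduct.smul_tmul', ← smul_add]
      congr 1
      abel
    · simp

/-- The relations are checked in the opposite algebra, where torus elements are replaced by their
inverses; `antipode_commutator` and `antipode_torus` settle the E-F relation. -/
theorem CrossRel.antipode (h : P.CrossRel f g) :
    P.CrossRel ((AlgHom.op f).comp P.hopfPlus.antipodeHom)
      ((AlgHom.op g).comp P.hopfMinus.antipodeHom) where
  comm s t := MulOpposite.unop_injective <| by
    change g (P.hopfMinus.antipode _) * f (P.hopfPlus.antipode _) =
      f (P.hopfPlus.antipode _) * g (P.hopfMinus.antipode _)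
    rw [(P.isGroupLikePair_plus _).antipode, (P.isGroupLikePair_minus _).antipode, h.comm]
  K'_E i j := MulOpposite.unop_injective <| by
    change f (P.hopfPlus.antipode _) * g (P.hopfMinus.antipode _) =
      _ • (g (P.hopfMinus.antipode _) * f (P.hopfPlus.antipode _))
    rw [(P.isPlusHopf_hopfPlus.E j).antipode, (P.isGroupLikePair_minus (.K i)).antipode, map_neg,
      map_mul, map_mul]
    exact neg_conj_mul (mul_ne_zero (inv_ne_zero (P.angle_ne_zero j i)) (P.ξ_ne_zero i j))
      (h.comm _ _).symm (h.comm _ _).symm (h.minus_T_mul_E (.Kinv i) j)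
  J'_E i j := MulOpposite.unop_injective <| by
    change f (P.hopfPlus.antipode _) * g (P.hopfMinus.antipode _) =
      g (P.hopfMinus.antipode _) * f (P.hopfPlus.antipode _)
    rw [(P.isPlusHopf_hopfPlus.E j).antipode, (P.isGroupLikePair_minus (.J i)).antipode, map_neg,
      map_mul, map_mul]
    exact (neg_conj_mul (one_ne_zero (α := F))
      (h.comm _ _).symm (h.comm _ _).symm (h.minus_T_mul_E (.Jinv i) j)).trans (one_smul F _)
  K_F i j := MulOpposite.unop_injective <| by
    change g (P.hopfMinus.antipode _) * f (P.hopfPlus.antipode _) =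
      _ • (f (P.hopfPlus.antipode _) * g (P.hopfMinus.antipode _))
    rw [(P.isMinusHopf_hopfMinus.F j).antipode, (P.isGroupLikePair_plus (.K i)).antipode, map_neg,
      map_mul, map_mul]
    exact neg_conj_mul (inv_ne_zero (P.angle_ne_zero i j))
      (h.comm _ _) (h.comm _ _) (h.plus_T_mul_F (.Kinv i) j)
  J_F i j := MulOpposite.unop_injective <| by
    change g (P.hopfMinus.antipode _) * f (P.hopfPlus.antipode _) =
      _ • (f (P.hopfPlus.antipode _) * g (P.hopfMinus.antipode _))
    rw [(P.isMinusHopf_hopfMinus.F j).antipode, (P.isGroupLikePair_plus (.J i)).antipode, map_neg,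
      map_mul, map_mul]
    exact neg_conj_mul (inv_ne_zero (P.ξ_ne_zero j i))
      (h.comm _ _) (h.comm _ _) (h.plus_T_mul_F (.Jinv i) j)
  E_F i j := MulOpposite.unop_injective <| by
    have h1 := h.plus_T_mul_F (.Jinv i) j
    have h2 := h.plus_T_mul_F (.Kinv i) j
    have h3 := h.minus_T_mul_E (.Kinv j) i
    have h4 := h.minus_T_mul_E (.Jinv j) i
    simp only [Half.char, inv_inv, inv_one, one_smul, mul_inv] at h1 h2 h3 h4
    have key := antipode_commutator (P.ξ_ne_zero j i) (P.angle_ne_zero i j) h1 h2 h3 h4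
      (h.comm _ _) (h.comm _ _) (h.comm _ _) (h.comm _ _)
    rw [h.E_F i j] at key
    have key2 : g (P.hopfMinus.antipode (P.minus (.X j))) * f (P.hopfPlus.antipode (P.plus (.X i))) -
        (P.ξ.at j i)⁻¹ • (f (P.hopfPlus.antipode (P.plus (.X i))) *
          g (P.hopfMinus.antipode (P.minus (.X j)))) = if i = j then
      (P.vi i - (P.vi i)⁻¹)⁻¹ • (g (P.hopfMinus.antipode (P.minus (.T (.J i)))) *
          f (P.hopfPlus.antipode (P.plus (.T (.K i)))) -
        g (P.hopfMinus.antipode (P.minus (.T (.K i)))) *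
          f (P.hopfPlus.antipode (P.plus (.T (.J i))))) else 0 := by
      rw [(P.isMinusHopf_hopfMinus.F j).antipode, (P.isPlusHopf_hopfPlus.E i).antipode, map_neg,
        map_neg, neg_mul_neg, neg_mul_neg]
      simp only [map_mul]
      rw [key]
      split_ifs with hij
      · subst hij
        simp only [(P.isGroupLikePair_plus _).antipode, (P.isGroupLikePair_minus _).antipode]
        refine antipode_torus ?_ ?_ ?_ ?_
        · rw [← map_mul]; exact (congrArg f (P.plus_inv_mul (.K i))).trans (map_one f)
        · rw [← map_mul]; exact (congrArg g (P.minus_inv_mul (.J i))).trans (map_one g)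
        · rw [← map_mul]; exact (congrArg g (P.minus_mul_inv (.K i))).trans (map_one g)
        · rw [← map_mul]; exact (congrArg f (P.plus_mul_inv (.J i))).trans (map_one f)
      · simp
    split_ifs at key2 ⊢ <;> exact key2

end Cross

/-- The comultiplication of `PresentedU`. -/
noncomputable def comulU : P.PresentedU →ₐ[F] P.PresentedU ⊗[F] P.PresentedU :=
  P.crossRel_inc.comul.lift

theorem comulU_incPlus (x : P.FPlus) : P.comulU (P.incPlus x) =
    Algebra.TensorProduct.map P.incPlus P.incPlus (P.hopfPlus.comul x) :=
  P.crossRel_inc.comul.lift_incPlus x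

theorem comulU_incMinus (x : P.FMinus) : P.comulU (P.incMinus x) =
    Algebra.TensorProduct.map P.incMinus P.incMinus (P.hopfMinus.comul x) :=
  P.crossRel_inc.comul.lift_incMinus x

theorem crossRel_counit : P.CrossRel P.hopfPlus.counit P.hopfMinus.counit where
  comm _ _ := mul_comm _ _
  K'_E i j := by simp [(P.isPlusHopf_hopfPlus.E j).counit]
  J'_E i j := mul_comm _ _
  K_F i j := by simp [(P.isMinusHopf_hopfMinus.F j).counit]
  J_F i j := by simp [(P.isMinusHopf_hopfMinus.F j).counit]
  E_F i j := by
    simp [(P.isPlusHopf_hopfPlus.E i).counit, (P.isGroupLikePair_plus _).counit,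
      (P.isGroupLikePair_minus _).counit]

/-- The counit of `PresentedU`. -/
noncomputable def counitU : P.PresentedU →ₐ[F] F := P.crossRel_counit.lift

theorem counitU_incPlus (x : P.FPlus) : P.counitU (P.incPlus x) = P.hopfPlus.counit x :=
  P.crossRel_counit.lift_incPlus x

theorem counitU_incMinus (x : P.FMinus) : P.counitU (P.incMinus x) = P.hopfMinus.counit x :=
  P.crossRel_counit.lift_incMinus x

/-- The antipode of `PresentedU`. -/
noncomputable def antipodeU : P.PresentedU →ₐ[F] P.PresentedUᵐᵒᵖ := P.crossRel_inc.antipode.lift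

theorem antipodeU_incPlus (x : P.FPlus) : P.antipodeU (P.incPlus x) =
    MulOpposite.op (P.incPlus (P.hopfPlus.antipode x)) :=
  P.crossRel_inc.antipode.lift_incPlus x

theorem antipodeU_incMinus (x : P.FMinus) : P.antipodeU (P.incMinus x) =
    MulOpposite.op (P.incMinus (P.hopfMinus.antipode x)) :=
  P.crossRel_inc.antipode.lift_incMinus x

/-- The Hopf algebra structure on `PresentedU`. -/
noncomputable def hopfU : HopfStructure F P.PresentedU :=
  HopfStructure.ofGenerators P.comulU P.counitU P.antipodeU
    (s := Set.range P.incPlus ∪ Set.range P.incMinus)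
    (top_unique <| P.adjoin_range_genU.ge.trans <| Algebra.adjoin_mono <| by
      rintro _ ⟨x, rfl⟩
      obtain ⟨x, rfl | rfl⟩ := exists_half x
      · exact .inl ⟨_, P.incPlus_plus x⟩
      · exact .inr ⟨_, P.incMinus_minus x⟩)
    (by
      rintro _ (⟨x, rfl⟩ | ⟨x, rfl⟩)
      · exact HopfStructure.coassoc_of_map _ P.comulU_incPlus x
      · exact HopfStructure.coassoc_of_map _ P.comulU_incMinus x)
    (by
      rintro _ (⟨x, rfl⟩ | ⟨x, rfl⟩)
      · exact HopfStructure.counit_left_of_map _ P.comulU_incPlus P.counitU_incPlus x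
      · exact HopfStructure.counit_left_of_map _ P.comulU_incMinus P.counitU_incMinus x)
    (by
      rintro _ (⟨x, rfl⟩ | ⟨x, rfl⟩)
      · exact HopfStructure.counit_right_of_map _ P.comulU_incPlus P.counitU_incPlus x
      · exact HopfStructure.counit_right_of_map _ P.comulU_incMinus P.counitU_incMinus x)
    (by
      rintro _ (⟨x, rfl⟩ | ⟨x, rfl⟩)
      · exact HopfStructure.antipode_left_of_map _ P.comulU_incPlus P.counitU_incPlus
          P.antipodeU_incPlus x
      · exact HopfStructure.antipode_left_of_map _ P.comulU_incMinus P.counitU_incMinus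
          P.antipodeU_incMinus x)
    (by
      rintro _ (⟨x, rfl⟩ | ⟨x, rfl⟩)
      · exact HopfStructure.antipode_right_of_map _ P.comulU_incPlus P.counitU_incPlus
          P.antipodeU_incPlus x
      · exact HopfStructure.antipode_right_of_map _ P.comulU_incMinus P.counitU_incMinus
          P.antipodeU_incMinus x)

theorem isHopfMap_incPlus : IsHopfMap P.hopfPlus P.hopfU P.incPlus where
  comul := P.comulU_incPlus
  counit := P.counitU_incPlus
  antipode x := congrArg MulOpposite.unop (P.antipodeU_incPlus x)

theorem isHopfMap_incMinus : IsHopfMap P.hopfMinus P.hopfU P.incMinus where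
  comul := P.comulU_incMinus
  counit := P.counitU_incMinus
  antipode x := congrArg MulOpposite.unop (P.antipodeU_incMinus x)

theorem isPlusHopf_hopfU : IsPlusHopf P.hopfU (fun g => P.genU g.toUPlus) := by
  simp only [← incPlus_plus]
  exact ⟨fun i => (P.isPlusHopf_hopfPlus.E i).map P.isHopfMap_incPlus,
    fun i => (P.isPlusHopf_hopfPlus.K i).map P.isHopfMap_incPlus,
    fun i => (P.isPlusHopf_hopfPlus.J i).map P.isHopfMap_incPlus⟩

theorem isMinusHopf_hopfU : IsMinusHopf P.hopfU (fun g => P.genU g.toUMinus) := by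
  simp only [← incMinus_minus]
  exact ⟨fun i => (P.isMinusHopf_hopfMinus.F i).map P.isHopfMap_incMinus,
    fun i => (P.isMinusHopf_hopfMinus.K i).map P.isHopfMap_incMinus,
    fun i => (P.isMinusHopf_hopfMinus.J i).map P.isHopfMap_incMinus⟩

end DeformationDatum

/-! ### The mixed relations for the action on A ⊗ B. -/

namespace IsSkewHopfPairing

variable {R : Type u} [CommRing R] {A B : Type w} [Ring A] [Algebra R A] [Ring B] [Algebra R B]
variable {hA : HopfStructure R A} {hB : HopfStructure R B} {ψ : A →ₗ[R] B →ₗ[R] R}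
variable (h : IsSkewHopfPairing hA hB ψ)

section Mul

variable {y a a' b b' : B}

theorem rightHom_mul_of_groupLike (hb : IsGroupLikePair hB b b') (x x' : A) :
    h.rightHom b (x * x') = h.rightHom b x * h.rightHom b x' := by
  rw [rightHom_mul, hb.comul]; simp

theorem leftHom_mul_of_groupLike (hb : IsGroupLikePair hB b b') (x x' : A) :
    h.leftHom b (x * x') = h.leftHom b x * h.leftHom b x' := by
  rw [leftHom_apply, h.hitLeft_mul, hb.antipode, hb.comul_inv]; simp

theorem rightHom_mul_of_skewPrimitive (hy : IsSkewPrimitive hB y a a' b b') (x x' : A) :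
    h.rightHom y (x * x') =
      h.rightHom b x * h.rightHom y x' + h.rightHom y x * h.rightHom a x' := by
  rw [rightHom_mul, hy.comul]; simp

theorem leftHom_mul_of_skewPrimitive (hy : IsSkewPrimitive hB y a a' b b')
    (ha : IsGroupLikePair hB a a') (hb : IsGroupLikePair hB b b') (x x' : A) :
    h.leftHom y (x * x') =
      h.leftHom a x * h.leftHom y x' + h.leftHom y x * h.leftHom b x' := by
  -- S(y) = -a' y b' is again skew-primitive, with the inverse group-likes in exchanged positions.
  have hS : hB.comul (hB.antipode y) = hB.antipode y ⊗ₜ a' + b' ⊗ₜ hB.antipode y := by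
    rw [hy.antipode, map_neg, map_mul, map_mul, hy.comul, ha.comul_inv, hb.comul_inv]
    simp only [mul_add, add_mul, Algebra.TensorProduct.tmul_mul_tmul, mul_assoc, hb.mul_eq_one,
      mul_one, TensorProduct.neg_tmul, TensorProduct.tmul_neg, neg_add]
    rw [← mul_assoc a' a, ha.mul_eq_one', one_mul]
  rw [leftHom_apply, h.hitLeft_mul, hS]
  simp only [map_add, TensorProduct.comm_tmul, TensorProduct.map_tmul, LinearMap.mul'_apply]
  rw [← ha.antipode, ← hb.antipode]
  rfl

end Mul

section Apply

variable {x a a' b b' : A}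

theorem rightHom_groupLike (ha : IsGroupLikePair hA a a') (y : B) :
    h.rightHom y a = ψ a y • a := by
  rw [rightHom_apply, HopfStructure.hitRight_apply, ha.comul]; simp

theorem leftHom_groupLike (ha : IsGroupLikePair hA a a') (y : B) :
    h.leftHom y a = ψ a (hB.antipode y) • a := by
  rw [leftHom_apply, HopfStructure.hitLeft_apply, ha.comul]; simp

theorem rightHom_skewPrimitive (hx : IsSkewPrimitive hA x a a' b b') (y : B) :
    h.rightHom y x = ψ b y • x + ψ x y • a := by
  rw [rightHom_apply, HopfStructure.hitRight_apply, hx.comul]; simp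

theorem leftHom_skewPrimitive (hx : IsSkewPrimitive hA x a a' b b') (y : B) :
    h.leftHom y x = ψ x (hB.antipode y) • b + ψ a (hB.antipode y) • x := by
  rw [leftHom_apply, HopfStructure.hitLeft_apply, hx.comul]; simp

end Apply

theorem doubleHom_groupLike {b b' : B} (hb : IsGroupLikePair hB b b') (x : A) (z : B) :
    h.doubleHom b (x ⊗ₜ z) = h.leftHom b (h.rightHom b x) ⊗ₜ (b * z) := by
  have h2 : hB.comul₂ b = b ⊗ₜ (b ⊗ₜ b) := by simp [HopfStructure.comul₂, hb.comul]
  rw [doubleHom_apply, h2, tripleHom_tmul]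

theorem doubleHom_skewPrimitive {y a a' b b' : B} (hy : IsSkewPrimitive hB y a a' b b')
    (hb : IsGroupLikePair hB b b') (x : A) (z : B) :
    h.doubleHom y (x ⊗ₜ z) = h.leftHom y (h.rightHom b x) ⊗ₜ (b * z) +
      h.leftHom a (h.rightHom b x) ⊗ₜ (y * z) + h.leftHom a (h.rightHom y x) ⊗ₜ (a * z) := by
  -- The iterated coproduct of a skew-primitive element has y in each position once, with a to its
  -- left and b to its right.
  have h2 : hB.comul₂ y = y ⊗ₜ (b ⊗ₜ b) + a ⊗ₜ (y ⊗ₜ b) + a ⊗ₜ (a ⊗ₜ y) := by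
    simp [HopfStructure.comul₂, hy.comul, hb.comul, TensorProduct.tmul_add, add_assoc]
  rw [doubleHom_apply, h2]
  simp only [map_add, LinearMap.add_apply, tripleHom_tmul]

/-- The action of `A` on `A ⊗ B` by left multiplication on the first factor. -/
noncomputable def _root_.leftMulHom (R A B : Type*) [CommRing R] [Ring A] [Algebra R A] [Ring B]
    [Algebra R B] : A →ₐ[R] Module.End R (A ⊗[R] B) :=
  (Module.End.rTensorAlgHom R A B).comp (Algebra.lmul R A)

theorem _root_.leftMulHom_tmul {R A B : Type*} [CommRing R] [Ring A] [Algebra R A] [Ring B]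
    [Algebra R B] (a x : A) (z : B) : leftMulHom R A B a (x ⊗ₜ z) = (a * x) ⊗ₜ z := rfl

include h in
theorem pairing_groupLike_mul {a a' : A} (ha : IsGroupLikePair hA a a') (y y' : B) :
    ψ a (y * y') = ψ a y * ψ a y' := by
  rw [h.mul_right, ha.comul]; simp [tensorPairing]

/-- Moving b past a costs ψ(a, S(b)) ψ(a, b), which is ψ(a, b' b) = 1. -/
theorem doubleHom_mul_leftMulHom_groupLike {a a' : A} {b b' : B} (ha : IsGroupLikePair hA a a')
    (hb : IsGroupLikePair hB b b') :
    h.doubleHom b * leftMulHom R A B a = leftMulHom R A B a * h.doubleHom b := by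
  have h1 : ψ a b' * ψ a b = 1 := by
    rw [← h.pairing_groupLike_mul ha, hb.mul_eq_one', h.one_right, ha.counit]
  refine TensorProduct.ext' fun x z => ?_
  simp only [Module.End.mul_apply, leftMulHom_tmul, h.doubleHom_groupLike hb,
    h.rightHom_mul_of_groupLike hb, h.leftHom_mul_of_groupLike hb, h.rightHom_groupLike ha,
    h.leftHom_groupLike ha, map_smul, hb.antipode, smul_smul, mul_comm (ψ a b), h1, one_smul]

theorem doubleHom_mul_leftMulHom_skewPrimitive {x a a' c c' : A} {b b' : B}
    (hx : IsSkewPrimitive hA x a a' c c') (hb : IsGroupLikePair hB b b') (h1 : ψ x b = 0)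
    (h2 : ψ x b' = 0) :
    h.doubleHom b * leftMulHom R A B x =
      (ψ a b' * ψ c b) • (leftMulHom R A B x * h.doubleHom b) := by
  refine TensorProduct.ext' fun z w => ?_
  simp only [Module.End.mul_apply, LinearMap.smul_apply, leftMulHom_tmul, h.doubleHom_groupLike hb,
    h.rightHom_mul_of_groupLike hb, h.leftHom_mul_of_groupLike hb, h.rightHom_skewPrimitive hx,
    h.leftHom_skewPrimitive hx, map_smul, hb.antipode, h1, h2, zero_smul, zero_add, add_zero,
    smul_smul, smul_mul_assoc, TensorProduct.smul_tmul', mul_comm (ψ c b)]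

theorem skewPrimitive_doubleHom_mul_leftMulHom {g g' : A} {y a a' b b' : B}
    (hg : IsGroupLikePair hA g g') (hy : IsSkewPrimitive hB y a a' b b')
    (ha : IsGroupLikePair hB a a') (hb : IsGroupLikePair hB b b') (h1 : ψ g y = 0)
    (h2 : ψ g (hB.antipode y) = 0) (h3 : ψ g a' = 1) :
    h.doubleHom y * leftMulHom R A B g = ψ g b • (leftMulHom R A B g * h.doubleHom y) := by
  refine TensorProduct.ext' fun z w => ?_
  simp only [Module.End.mul_apply, LinearMap.smul_apply, leftMulHom_tmul,
    h.doubleHom_skewPrimitive hy hb, h.rightHom_mul_of_groupLike hb,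
    h.rightHom_mul_of_skewPrimitive hy, h.leftHom_mul_of_groupLike ha,
    h.leftHom_mul_of_skewPrimitive hy ha hb, h.rightHom_groupLike hg,
    h.leftHom_groupLike hg, map_smul, map_add, ha.antipode, h1, h2, h3, zero_smul, zero_mul,
    add_zero, one_smul, smul_mul_assoc, ← TensorProduct.smul_tmul', smul_add]

/-- With most pairings zero, three terms survive: y sits in the middle leg and is not paired, or it
is paired through S in the first leg, or directly in the last. The last two produce the torus part
of the E-F relation. -/
theorem doubleHom_mul_leftMulHom_skewPrimitive_skewPrimitive {x c c' d d' : A} {y a a' b b' : B}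
    (hx : IsSkewPrimitive hA x c c' d d') (hc : IsGroupLikePair hA c c')
    (hy : IsSkewPrimitive hB y a a' b b')
    (ha : IsGroupLikePair hB a a') (hb : IsGroupLikePair hB b b') (h1 : ψ x b = 0)
    (h2 : ψ x a' = 0) (h3 : ψ c a' = 1) (h4 : ψ c (hB.antipode y) = 0) (h5 : ψ d y = 0) :
    h.doubleHom y * leftMulHom R A B x = ψ d b • (leftMulHom R A B x * h.doubleHom y) +
      (ψ d b * ψ x (hB.antipode y)) • (leftMulHom R A B d * h.doubleHom b) +
      ψ x y • (leftMulHom R A B c * h.doubleHom a) := by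
  refine TensorProduct.ext' fun z w => ?_
  simp only [Module.End.mul_apply, LinearMap.smul_apply, LinearMap.add_apply, leftMulHom_tmul,
    h.doubleHom_skewPrimitive hy hb, h.doubleHom_groupLike ha, h.doubleHom_groupLike hb,
    h.rightHom_mul_of_groupLike hb,
    h.rightHom_mul_of_skewPrimitive hy, h.leftHom_mul_of_groupLike ha,
    h.leftHom_mul_of_skewPrimitive hy ha hb, h.rightHom_skewPrimitive hx, h.leftHom_groupLike hc,
    h.leftHom_skewPrimitive hx, map_smul, map_add, ha.antipode, h1, h2, h3, h4, h5, zero_smul,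
    zero_add, add_zero, one_smul, smul_mul_assoc, ← TensorProduct.smul_tmul', smul_add,
    TensorProduct.add_tmul, mul_smul]
  abel

end IsSkewHopfPairing

namespace DeformationDatum

attribute [local instance] Half.ring ringPlus ringMinus ringU

variable {I : Type u} {F : Type w} [Field F] [Algebra (RatFunc ℚ) F] [DecidableEq I]
variable (P : DeformationDatum I F)

theorem psi_plus_minus (g g' : HalfGen I) :
    P.psi (P.plus g) (P.minus g') = P.phi (P.genPlus g) (P.genMinus g') := P.psi_apply _ _

theorem psi_T_T (s t : TorusGen I) : P.psi (P.plus (.T s)) (P.minus (.T t)) =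
    Half.weight (P.torusUnit s) (.T t) := by
  rw [psi_plus_minus, phi_T_T]

theorem psi_T_F (s : TorusGen I) (i : I) : P.psi (P.plus (.T s)) (P.minus (.X i)) = 0 := by
  rw [psi_plus_minus, phi_T_F]

theorem psi_E_T (i : I) (s : TorusGen I) : P.psi (P.plus (.X i)) (P.minus (.T s)) = 0 := by
  rw [psi_plus_minus, phi_E_T]

theorem psi_E_F (i j : I) : P.psi (P.plus (.X i)) (P.minus (.X j)) =
    if j = i then ((P.vi i)⁻¹ - P.vi i)⁻¹ * P.ξ.at j i else 0 := by
  rw [psi_plus_minus, phi_E_F]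

theorem psi_T_antipode_F (s : TorusGen I) (i : I) :
    P.psi (P.plus (.T s)) (P.hopfMinus.antipode (P.minus (.X i))) = 0 := by
  rw [(P.isMinusHopf_hopfMinus.F i).antipode, map_neg,
    P.isSkewHopfPairing_psi.pairing_groupLike_mul (P.isGroupLikePair_plus s),
    P.isSkewHopfPairing_psi.pairing_groupLike_mul (P.isGroupLikePair_plus s), psi_T_F]
  simp

theorem psi_E_antipode_F (i j : I) :
    P.psi (P.plus (.X i)) (P.hopfMinus.antipode (P.minus (.X j))) =
      if j = i then -((P.vi i)⁻¹ - P.vi i)⁻¹ else 0 := by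
  rw [(P.isMinusHopf_hopfMinus.F j).antipode, map_neg, plus, minus, minus, minus, ← map_mul,
    ← map_mul, P.psi_apply, phi_E_mul, phi_E_mul, phi_E_T, phi_E_T, phi_E_F, phi_T_T, phi_T_T]
  have hξ := P.ξ_ne_zero j i
  split_ifs with hij
  · subst hij
    -- The factor ξ in ψ(E_i, F_i) is cancelled by ψ(J_i, K_i'⁻¹) = ξ(i, i)⁻¹.
    simp [Half.weight, torusUnit, ξUnit, hξ]
  · simp

/-- The relations between left multiplication by `FPlus` and the action of `FMinus` on
`FPlus ⊗ FMinus`. -/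
theorem crossRel_double : P.CrossRel (leftMulHom F P.FPlus P.FMinus)
    P.isSkewHopfPairing_psi.doubleHom where
  comm s t := (P.isSkewHopfPairing_psi.doubleHom_mul_leftMulHom_groupLike
    (P.isGroupLikePair_plus s) (P.isGroupLikePair_minus t)).symm
  K'_E i j := by
    rw [P.isSkewHopfPairing_psi.doubleHom_mul_leftMulHom_skewPrimitive
      (P.isPlusHopf_hopfPlus.E j) (P.isGroupLikePair_minus (.K i)) (P.psi_E_T _ _) (P.psi_E_T _ _),
      psi_T_T, psi_T_T]
    simp [Half.weight, torusUnit, ξUnit, angleUnit, TorusGen.inv]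
  J'_E i j := by
    rw [P.isSkewHopfPairing_psi.doubleHom_mul_leftMulHom_skewPrimitive
      (P.isPlusHopf_hopfPlus.E j) (P.isGroupLikePair_minus (.J i)) (P.psi_E_T _ _) (P.psi_E_T _ _),
      psi_T_T, psi_T_T]
    simp [Half.weight, TorusGen.inv]
  K_F i j := by
    rw [P.isSkewHopfPairing_psi.skewPrimitive_doubleHom_mul_leftMulHom
      (P.isGroupLikePair_plus (.K i)) (P.isMinusHopf_hopfMinus.F j) (P.isMinusHopf_hopfMinus.J j)
      (P.isMinusHopf_hopfMinus.K j) (P.psi_T_F _ _) (P.psi_T_antipode_F _ _)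
      (by rw [psi_T_T]; rfl), psi_T_T, smul_smul]
    simp [Half.weight, torusUnit, angleUnit, P.angle_ne_zero i j]
  J_F i j := by
    rw [P.isSkewHopfPairing_psi.skewPrimitive_doubleHom_mul_leftMulHom
      (P.isGroupLikePair_plus (.J i)) (P.isMinusHopf_hopfMinus.F j) (P.isMinusHopf_hopfMinus.J j)
      (P.isMinusHopf_hopfMinus.K j) (P.psi_T_F _ _) (P.psi_T_antipode_F _ _)
      (by rw [psi_T_T]; rfl), psi_T_T, smul_smul]
    simp [Half.weight, torusUnit, ξUnit, P.ξ_ne_zero j i]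
  E_F i j := by
    have hξ := P.ξ_ne_zero j i
    rw [P.isSkewHopfPairing_psi.doubleHom_mul_leftMulHom_skewPrimitive_skewPrimitive
      (P.isPlusHopf_hopfPlus.E i) (P.isPlusHopf_hopfPlus.K i) (P.isMinusHopf_hopfMinus.F j)
      (P.isMinusHopf_hopfMinus.J j) (P.isMinusHopf_hopfMinus.K j) (P.psi_E_T _ _) (P.psi_E_T _ _)
      (by rw [psi_T_T]; rfl) (P.psi_T_antipode_F _ _) (P.psi_T_F _ _), psi_T_T, psi_E_F,
      psi_E_antipode_F]
    have hw : Half.weight (P.torusUnit (.J i)) (.T (.K j)) = P.ξ.at j i := rfl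
    rw [hw]
    by_cases hij : i = j
    · subst hij
      simp only [if_true, smul_add, smul_smul, smul_sub]
      -- Multiplying by ξ⁻¹ clears ξ from both torus terms, and v_i⁻¹ - v_i changes sign to v_i -
      -- v_i⁻¹.
      rw [inv_mul_cancel₀ hξ, one_smul, inv_mul_cancel_left₀ hξ, mul_comm _ (P.ξ.at i i),
        inv_mul_cancel_left₀ hξ, ← neg_sub (P.vi i), inv_neg]
      simp only [neg_neg, neg_smul]
      abel
    · simp only [if_neg hij, if_neg (Ne.symm hij), mul_zero, zero_smul, add_zero, smul_smul,
        inv_mul_cancel₀ hξ, one_smul, sub_self]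

end DeformationDatum

theorem map_mul_map_eq {R A B U : Type*} [CommRing R] [Ring A] [Algebra R A] [Ring B] [Algebra R B]
    [Ring U] [Algebra R U] {f : A →ₐ[R] U} {g : B →ₐ[R] U} {t : A ⊗[R] B ≃ₗ[R] U}
    (ht : ∀ a b, t (a ⊗ₜ b) = f a * g b) (z : A ⊗[R] A) (w : B ⊗[R] B) :
    TensorProduct.map f.toLinearMap f.toLinearMap z *
        TensorProduct.map g.toLinearMap g.toLinearMap w =
      TensorProduct.map t.toLinearMap t.toLinearMap
        (TensorProduct.tensorTensorTensorComm R A A B B (z ⊗ₜ w)) := by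
  induction z with
  | zero => simp
  | add a b ha hb => simp only [map_add, TensorProduct.add_tmul, add_mul, ha, hb]
  | tmul a b =>
    induction w with
    | zero => simp
    | add c d hc hd => simp only [map_add, TensorProduct.tmul_add, mul_add, hc, hd]
    | tmul c d => simp [ht]

/-! ### Triangular decomposition and identification with the Drinfeld double. -/

namespace DeformationDatum

attribute [local instance] Half.ring ringPlus ringMinus ringU

variable {I : Type u} {F : Type w} [Field F] [Algebra (RatFunc ℚ) F] [DecidableEq I]
variable (P : DeformationDatum I F)

/-- The linear map `x ⊗ y ↦ x y` from `FPlus ⊗ FMinus` to `PresentedU`. -/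
noncomputable def triangular : P.FPlus ⊗[F] P.FMinus →ₗ[F] P.PresentedU :=
  LinearMap.mul' F P.PresentedU ∘ₗ TensorProduct.map P.incPlus.toLinearMap P.incMinus.toLinearMap

theorem triangular_tmul (x : P.FPlus) (y : P.FMinus) :
    P.triangular (x ⊗ₜ y) = P.incPlus x * P.incMinus y := rfl

/-- The action of `PresentedU` on `FPlus ⊗ FMinus`. -/
noncomputable def doubleAction : P.PresentedU →ₐ[F] Module.End F (P.FPlus ⊗[F] P.FMinus) :=
  P.crossRel_double.lift

theorem doubleAction_incPlus (x : P.FPlus) :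
    P.doubleAction (P.incPlus x) = leftMulHom F P.FPlus P.FMinus x :=
  P.crossRel_double.lift_incPlus x

theorem doubleAction_incMinus (y : P.FMinus) :
    P.doubleAction (P.incMinus y) = P.isSkewHopfPairing_psi.doubleHom y :=
  P.crossRel_double.lift_incMinus y

/-- The product x y acts on 1 ⊗ 1 by y first, giving 1 ⊗ y, and then by x, giving x ⊗ y. Injectivity
of multiplication follows without a basis of either half. -/
theorem doubleAction_triangular (w : P.FPlus ⊗[F] P.FMinus) :
    P.doubleAction (P.triangular w) (1 ⊗ₜ 1) = w := by
  induction w with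
  | zero => simp
  | add a b ha hb => rw [map_add, map_add, LinearMap.add_apply, ha, hb]
  | tmul x y =>
    rw [triangular_tmul, map_mul, Module.End.mul_apply, doubleAction_incMinus,
      IsSkewHopfPairing.doubleHom_one_tmul_one, doubleAction_incPlus, leftMulHom_tmul, mul_one]

theorem triangular_injective : Function.Injective P.triangular :=
  fun a b hab => by rw [← P.doubleAction_triangular a, hab, doubleAction_triangular]

theorem incPlus_mul_mem_range (x : P.FPlus) {r : P.PresentedU}
    (hr : r ∈ LinearMap.range P.triangular) : P.incPlus x * r ∈ LinearMap.range P.triangular := by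
  obtain ⟨w, rfl⟩ := hr
  induction w with
  | zero => simp
  | add a b ha hb => rw [map_add, mul_add]; exact add_mem ha hb
  | tmul a b => exact ⟨(x * a) ⊗ₜ b, by rw [triangular_tmul, triangular_tmul, map_mul, mul_assoc]⟩

theorem minus_X_mul_E (i j : I) :
    P.incMinus (P.minus (.X j)) * P.incPlus (P.plus (.X i)) =
      P.ξ.at j i • (P.incPlus (P.plus (.X i)) * P.incMinus (P.minus (.X j)) - if i = j then
        (P.vi i - (P.vi i)⁻¹)⁻¹ •
          (P.incPlus (P.plus (.T (.K i))) * P.incMinus (P.minus (.T (.J i))) -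
            P.incPlus (P.plus (.T (.J i))) * P.incMinus (P.minus (.T (.K i))))
        else 0) := by
  rw [← P.crossRel_inc.E_F i j, sub_sub_cancel, smul_smul, mul_inv_cancel₀ (P.ξ_ne_zero j i),
    one_smul]

/-- A generator of the negative half is moved past the first letter of x. Apart from a multiple of
the swapped product, only the E-F relation adds terms. Their negative generator is a torus element
instead of F_j, so the induction must allow all g. -/
theorem incMinus_mul_mem_range (g : HalfGen I) (x : P.FPlus) (y : P.FMinus) :
    P.incMinus (P.minus g) * (P.incPlus x * P.incMinus y) ∈ LinearMap.range P.triangular := by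
  induction x using P.FPlus_induction generalizing g with
  | one => exact ⟨1 ⊗ₜ (P.minus g * y), by rw [triangular_tmul, map_one, one_mul, one_mul, map_mul]⟩
  | smul r x hx =>
    rw [map_smul, smul_mul_assoc, mul_smul_comm]
    exact Submodule.smul_mem _ r (hx g)
  | add a b ha hb =>
    rw [map_add, add_mul, mul_add]
    exact add_mem (ha g) (hb g)
  | mul g₀ x hx =>
    have key : ∀ c : F, P.incMinus (P.minus g) * P.incPlus (P.plus g₀) =
        c • (P.incPlus (P.plus g₀) * P.incMinus (P.minus g)) →
        P.incMinus (P.minus g) * (P.incPlus (P.plus g₀ * x) * P.incMinus y) ∈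
          LinearMap.range P.triangular := by
      intro c hc
      rw [map_mul, mul_assoc, ← mul_assoc, hc, smul_mul_assoc, mul_assoc]
      exact Submodule.smul_mem _ c (P.incPlus_mul_mem_range _ (hx g))
    rcases g with j | t <;> rcases g₀ with i | s
    · rw [map_mul, mul_assoc, ← mul_assoc, minus_X_mul_E, smul_mul_assoc, sub_mul]
      refine Submodule.smul_mem _ _ (sub_mem ?_ ?_)
      · rw [mul_assoc]
        exact P.incPlus_mul_mem_range _ (hx _)
      · split_ifs
        · rw [smul_mul_assoc, sub_mul, mul_assoc, mul_assoc]
          exact Submodule.smul_mem _ _ (sub_mem (P.incPlus_mul_mem_range _ (hx _))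
            (P.incPlus_mul_mem_range _ (hx _)))
        · rw [zero_mul]
          exact zero_mem _
    · have hne := Half.char_ne_zero (fun i j => inv_ne_zero (P.angle_ne_zero i j))
        (fun i j => inv_ne_zero (P.ξ_ne_zero j i)) s j
      refine key (Half.char (fun i j => (P.angle i j)⁻¹) (fun i j => (P.ξ.at j i)⁻¹) s j)⁻¹ ?_
      rw [P.crossRel_inc.plus_T_mul_F s j, smul_smul, inv_mul_cancel₀ hne, one_smul]
    · exact key _ (P.crossRel_inc.minus_T_mul_E t i)
    · exact key 1 (by rw [one_smul, P.crossRel_inc.comm])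

/-- The range is a left ideal. Since it contains 1, it is everything. -/
theorem mul_mem_range_triangular (u : P.PresentedU) :
    ∀ r ∈ LinearMap.range P.triangular, u * r ∈ LinearMap.range P.triangular := by
  have hu : u ∈ Algebra.adjoin F (Set.range P.genU) := by
    rw [adjoin_range_genU]
    exact Algebra.mem_top
  induction hu using Algebra.adjoin_induction with
  | mem u hu =>
    obtain ⟨u, rfl⟩ := hu
    obtain ⟨g, rfl | rfl⟩ := exists_half u
    · rw [← incPlus_plus]
      exact fun r hr => P.incPlus_mul_mem_range _ hr
    · rw [← incMinus_minus]
      rintro _ ⟨w, rfl⟩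
      induction w with
      | zero => simp
      | add a b ha hb => rw [map_add, mul_add]; exact add_mem ha hb
      | tmul x y => exact P.incMinus_mul_mem_range g x y
  | algebraMap c =>
    intro r hr
    rw [← Algebra.smul_def]
    exact Submodule.smul_mem _ c hr
  | add u v _ _ hu hv =>
    intro r hr
    rw [add_mul]
    exact add_mem (hu r hr) (hv r hr)
  | mul u v _ _ hu hv =>
    intro r hr
    rw [mul_assoc]
    exact hu _ (hv r hr)

theorem triangular_surjective : Function.Surjective P.triangular := fun u => by
  have := P.mul_mem_range_triangular u 1 ⟨1 ⊗ₜ 1, by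
    rw [triangular_tmul, map_one, map_one, one_mul]⟩
  rwa [mul_one] at this

/-- The triangular decomposition of `PresentedU`. -/
noncomputable def triangularEquiv : P.FPlus ⊗[F] P.FMinus ≃ₗ[F] P.PresentedU :=
  LinearEquiv.ofBijective P.triangular ⟨P.triangular_injective, P.triangular_surjective⟩

theorem triangularEquiv_tmul (x : P.FPlus) (y : P.FMinus) :
    P.triangularEquiv (x ⊗ₜ y) = P.incPlus x * P.incMinus y := rfl

theorem triangularEquiv_tmul_one (x : P.FPlus) : P.triangularEquiv (x ⊗ₜ 1) = P.incPlus x := by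
  rw [triangularEquiv_tmul, map_one, mul_one]

theorem triangularEquiv_one_tmul (y : P.FMinus) : P.triangularEquiv (1 ⊗ₜ y) = P.incMinus y := by
  rw [triangularEquiv_tmul, map_one, one_mul]

theorem triangularEquiv_doubleAction (u : P.PresentedU) :
    P.triangularEquiv (P.doubleAction u (1 ⊗ₜ 1)) = u := by
  obtain ⟨w, rfl⟩ := P.triangular_surjective u
  rw [doubleAction_triangular]
  rfl

theorem isDrinfeldDouble_hopfU :
    IsDrinfeldDouble P.hopfPlus P.hopfMinus P.psi P.hopfU P.triangularEquiv where
  one := by rw [triangularEquiv_tmul_one, map_one]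
  mul_left x x' := by simp only [triangularEquiv_tmul_one, map_mul]
  mul_right y y' := by simp only [triangularEquiv_one_tmul, map_mul]
  mul_left_right x y := by
    rw [triangularEquiv_tmul_one, triangularEquiv_one_tmul, triangularEquiv_tmul]
  mul_right_left x y := by
    rw [triangularEquiv_tmul_one, triangularEquiv_one_tmul,
      ← P.isSkewHopfPairing_psi.doubleHom_tmul_one, ← doubleAction_incMinus]
    -- Once x ⊗ 1 is written as x acting on 1 ⊗ 1, the cross product is the image of 1 ⊗ 1 under the
    -- element y x of U, and `triangularEquiv_doubleAction` returns y x itself.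
    have h : x ⊗ₜ[F] (1 : P.FMinus) = P.doubleAction (P.incPlus x) (1 ⊗ₜ 1) := by
      rw [doubleAction_incPlus, leftMulHom_tmul, mul_one]
    rw [h, ← Module.End.mul_apply, ← map_mul, triangularEquiv_doubleAction]
  comul x y := by
    rw [triangularEquiv_tmul, map_mul, P.isHopfMap_incPlus.comul, P.isHopfMap_incMinus.comul]
    exact map_mul_map_eq P.triangularEquiv_tmul _ _
  counit x y := by
    rw [triangularEquiv_tmul, map_mul, P.isHopfMap_incPlus.counit, P.isHopfMap_incMinus.counit]
  antipode x y := by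
    rw [triangularEquiv_tmul, HopfStructure.antipode_mul, P.isHopfMap_incPlus.antipode,
      P.isHopfMap_incMinus.antipode, triangularEquiv_tmul_one, triangularEquiv_one_tmul]

end DeformationDatum

theorem mainTheorem4 {I : Type u} [DecidableEq I] {F : Type w} [Field F] [Algebra (RatFunc ℚ) F]
    (P : DeformationDatum I F) :
    ∃ (hPlus : HopfStructure F P.FPlus) (hMinus : HopfStructure F P.FMinus)
      (ψ : P.FPlus →ₗ[F] P.FMinus →ₗ[F] F),
      IsPlusHopf hPlus P.plus ∧ IsMinusHopf hMinus P.minus ∧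
      (∀ x y, ψ (P.toPlus x) (P.toMinus y) = P.phi x y) ∧
      IsSkewHopfPairing hPlus hMinus ψ ∧
      ∃ (U : Type (max u w)) (_ : Ring U) (_ : Algebra F U) (hU : HopfStructure F U)
        (t : P.FPlus ⊗[F] P.FMinus ≃ₗ[F] U),
        IsDrinfeldDouble hPlus hMinus ψ hU t ∧
        ∃ e : P.PresentedU ≃ₐ[F] U,
          (∀ g : HalfGen I, e (P.genU g.toUPlus) = t (P.plus g ⊗ₜ 1)) ∧
          (∀ g : HalfGen I, e (P.genU g.toUMinus) = t (1 ⊗ₜ P.minus g)) ∧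
          IsPlusHopf hU (fun g => e (P.genU g.toUPlus)) ∧
          IsMinusHopf hU (fun g => e (P.genU g.toUMinus)) :=
  ⟨P.hopfPlus, P.hopfMinus, P.psi, P.isPlusHopf_hopfPlus, P.isMinusHopf_hopfMinus, P.psi_apply,
    P.isSkewHopfPairing_psi, P.PresentedU, inferInstance, inferInstance, P.hopfU,
    -- The double is realised on the presented algebra itself, so the comparison isomorphism is the
    -- identity.
    P.triangularEquiv, P.isDrinfeldDouble_hopfU, AlgEquiv.refl,
    fun g => (P.incPlus_plus g).symm.trans (P.triangularEquiv_tmul_one _).symm,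
    fun g => (P.incMinus_minus g).symm.trans (P.triangularEquiv_one_tmul _).symm,
    P.isPlusHopf_hopfU, P.isMinusHopf_hopfU⟩
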